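/- Let $q\in(0,1]$, $p\in(0,3/4]$ and $r\in(0,2]$. Let $(X_n)_{n\ge1}$ be the steps of the elephant random walk with memory parameter $p$ and first-step parameter $q$: $\mathbf P(X_1=1)=q=1-\mathbf P(X_1=-1)$ and, for $n\ge2$, $X_n=\alpha_nX_{\beta_n}$, where $\mathbf P(\alpha_n=1)=p=1-\mathbf P(\alpha_n=-1)$, $\beta_n$ is uniformly distributed on $\{1,\dots,n-1\}$, and $\alpha_n$, $\beta_n$ and $(X_1,\dots,X_{n-1})$ are mutually independent. Put $T_n=\sum_{i=1}^nX_i$, $a_n=\Gamma(n)\Gamma(2p)/\Gamma(n+2p-1)$ (so $a_1=1$) and $v_n=\sum_{i=1}^na_i^2$. For probability measures $\mu,\nu$ on $\mathbf R$ let $$\zeta_r(\mu,\nu)=\sup\Big\{\int f\,d\mu-\int f\,d\nu:\ f\in\Lambda_r\Big\},$$ where, $l$ being the natural number with $l<r\le l+1$, $\Lambda_r$ is the class of $l$ times continuously differentiable functions $f:\mathbf R\to\mathbf R$ such that $|f^{(l)}(x)-f^{(l)}(y)|\le|x-y|^{r-l}$ for all $x,y\in\mathbf R$. Then every $f\in\Lambda_r$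 is integrable with respect to the law of $(a_nT_n-(2q-1))/\sqrt{v_n}$ and to $\mathcal N(0,1)$, and there is a constant $C>0$, depending only on $p$, $q$ and $r$, such that for all $n\ge1$ $$\zeta_r\Big(\frac{a_nT_n-(2q-1)}{\sqrt{v_n}},\ \mathcal N(0,1)\Big)\le C\Big(\frac1{n^{r/2}}+\frac1{v_n}\Big),$$ where a random variable stands for its law. For $r=1$, the same bound $C\big(n^{-1/2}+1/v_n\big)$ holds for the Wasserstein distance of order $1$, $W_1(\mu,\nu)=\inf_\pi\int|x-y|\,\pi(dx,dy)$, the infimum being over all couplings $\pi$ of $\mu$ and $\nu$. -/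

import Mathlib

open MeasureTheory ProbabilityTheory
open scoped ENNReal

noncomputable section

/-- `Y` has the Rademacher distribution `R(s)`: it equals `1` with probability `s` and `-1` with
probability `1 - s`. -/
def IsRademacher {Ω : Type*} [MeasurableSpace Ω] (P : Measure Ω) (s : ℝ) (Y : Ω → ℝ) : Prop :=
  P.real {ω | Y ω = 1} = s ∧ P.real {ω | Y ω = -1} = 1 - s

/-- `X 1, X 2, ...` are the steps of an elephant random walk with memory parameter `p` and first
step distributed as `R(q)`. For `n ≥ 2`, `β n` is the uniformly chosen past time in
`{1, ..., n - 1}` and `α n ~ R(p)` tells whether the remembered step `X (β n)` is repeated or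
reversed. For each `n ≥ 2`, the three objects `α n`, `β n` and `(X 1, ..., X (n - 1))` are mutually
independent. Indices start at `1`; the values `X 0`, `α 0`, `α 1`, `β 0`, `β 1` play no role. -/
structure IsElephantWalk {Ω : Type*} [MeasurableSpace Ω] (P : Measure Ω) (p q : ℝ)
    (X α : ℕ → Ω → ℝ) (β : ℕ → Ω → ℕ) : Prop where
  measurable_X : ∀ n, 1 ≤ n → Measurable (X n)
  measurable_α : ∀ n, 2 ≤ n → Measurable (α n)
  measurable_β : ∀ n, 2 ≤ n → Measurable (β n)
  first_step : IsRademacher P q (X 1)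
  law_α : ∀ n, 2 ≤ n → IsRademacher P p (α n)
  mem_β : ∀ n, 2 ≤ n → ∀ ω, β n ω ∈ Finset.Icc 1 (n - 1)
  law_β : ∀ n, 2 ≤ n → ∀ k ∈ Finset.Icc 1 (n - 1),
    P.real {ω | β n ω = k} = 1 / ((n : ℝ) - 1)
  indep_β : ∀ n, 2 ≤ n →
    IndepFun (β n) (fun ω (i : Finset.Icc 1 (n - 1)) => X i ω) P
  indep_α : ∀ n, 2 ≤ n →
    IndepFun (α n) (fun ω => (β n ω, fun i : Finset.Icc 1 (n - 1) => X i ω)) P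
  step : ∀ n, 2 ≤ n → ∀ ω, X n ω = α n ω * X (β n ω) ω

/-- The position `T_n = X_1 + ... + X_n`. -/
def position {Ω : Type*} (X : ℕ → Ω → ℝ) (n : ℕ) (ω : Ω) : ℝ :=
  ∑ i ∈ Finset.Icc 1 n, X i ω

/-- `a_n = Γ(n) Γ(2p) / Γ(n + 2p - 1)` for `n ≥ 1`; in particular `a_1 = 1` for `p > 0`. -/
def aSeq (p : ℝ) (n : ℕ) : ℝ :=
  Real.Gamma n * Real.Gamma (2 * p) / Real.Gamma (n + 2 * p - 1)

/-- `v_n = a_1 ^ 2 + ... + a_n ^ 2`. -/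
def vSeq (p : ℝ) (n : ℕ) : ℝ :=
  ∑ i ∈ Finset.Icc 1 n, aSeq p i ^ 2

/-- The normalized position `(a_n T_n - (2q - 1)) / √v_n`. -/
def normalizedPosition {Ω : Type*} (p q : ℝ) (X : ℕ → Ω → ℝ) (n : ℕ) (ω : Ω) : ℝ :=
  (aSeq p n * position X n ω - (2 * q - 1)) / √(vSeq p n)

/-- For `r > 0`, the natural number `l` with `l < r ≤ l + 1`. -/
def zolotarevIndex (r : ℝ) : ℕ := ⌈r⌉₊ - 1

/-- The class `Λ_r`: with `l < r ≤ l + 1`, the functions `f : ℝ → ℝ` that are `l` times continuously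
differentiable and satisfy `|f^(l) x - f^(l) y| ≤ |x - y| ^ (r - l)` for all `x`, `y`. -/
def zolotarevClass (r : ℝ) : Set (ℝ → ℝ) :=
  {f | ContDiff ℝ (zolotarevIndex r) f ∧
    ∀ x y : ℝ, |iteratedDeriv (zolotarevIndex r) f x - iteratedDeriv (zolotarevIndex r) f y|
      ≤ |x - y| ^ (r - (zolotarevIndex r : ℝ))}

/-- Zolotarev's distance `ζ_r` of order `r`, as an extended real supremum. -/
def zolotarevDist (r : ℝ) (μ ν : Measure ℝ) : EReal :=
  ⨆ f ∈ zolotarevClass r, (((∫ x, f x ∂μ) - ∫ x, f x ∂ν : ℝ) : EReal)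

/-- The Wasserstein distance of order `1`: the infimum of the transport cost `∫ |x - y| dπ` over all
couplings `π` of `μ` and `ν`. -/
def wassersteinOne (μ ν : Measure ℝ) : ℝ≥0∞ :=
  ⨅ (π : Measure (ℝ × ℝ)) (_ : π.map Prod.fst = μ ∧ π.map Prod.snd = ν),
    ∫⁻ z, ENNReal.ofReal |z.1 - z.2| ∂π

end

/-! The proof is Stein's method carried out along the Markov chain (T_n). Put c = 2p - 1 and c⁺ =
max(c, 0). From x at time n the walk moves to x ± 1 with probabilities (1 ± c x / n) / 2
(`IsElephantWalk.integral_position`), and a_n E T_n = 2q - 1, so the normalized position is (T_n - E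
T_n) / σ with σ² = V_n = v_n / a_n².

For a test function H centred under the normal law, let f solve f' - x f = H and put F(k) = f((k - E
T_n) / σ). Then σ E H = E[σ² F'(T_n) - (T_n - E T_n) F(T_n)]. Let D be the central difference, A the
average of the two neighbours and w_n = E T_n². Up to replacing σ² by w_n and F' by D A F, the right
side is the defect S_n(F) = w_n E[D A F(T_n)] - E[(T_n - E T_n) F(T_n)] (`abs_walkExp_le_of_stein`).
The first replacement is harmless because 0 ≤ V_n - w_n = O(n^(2c⁺)).

The heart is the exact recursion `steinDefect_succ`: S_{n+1}(f) equals S_n(P f) + (c/n) S_n(A f),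
with P the transition operator, plus errors in which only D³f, T_n · A D²f and T_n · D f occur.
Since D intertwines P with operators of the same type (`dif_walkOp`), sup norms and Hölder constants
of D f and D²f are propagated with explicit factors 1 + κ/n. The resulting linear recursions grow at
most like n^max(1, r/2 + 2c⁺), n^(1/2 + 2c⁺) and n^(2c⁺) (`exists_steinDefect_le_low` for r ≤ 1,
`exists_steinDefect_le_high` for r > 1). The assumption p ≤ 3/4, that is c ≤ 1/2, keeps the
homogeneous exponents (2 + r)c⁺, 3c⁺ and 2c⁺ at or below these.

For F, the Hölder constant of D F (r ≤ 1) or D²F (r > 1) is of order σ^(-r-1), while D F and, for r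
> 1, D²F are of order σ^(-1) and σ^(-2). As σ is at least a constant times √n, all terms are bounded
by multiples of n^(-r/2) and n^(2c⁺) / V_n, and the latter is dominated by n^(-r/2) + 1/v_n
(`rpow_div_varScale_le`).

The analytic input is the regularity of f. For s-Hölder data f' is bounded and s-Hölder
(`steinSol_deriv_regular`). For data with s-Hölder derivative, g = f' solves the same equation with
data H' + f, which is again s-Hölder (`exists_steinSol_second_regular`).

For r = 1 the class consists of the 1-Lipschitz functions. The quantile coupling costs at most the
L¹ distance of the distribution functions, and on bounded windows that distance is a difference of
integrals of a Lipschitz function (`wassersteinOne_le_of_lipschitz`). -/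

/-! ### Discrete Grönwall estimates with polynomial rates -/

/-- The weight `n ^ κ * n / (n + 2)`, a supersolution of `x (n + 1) = (1 + κ / n) * x n`. -/
noncomputable def growthWeight (κ : ℝ) (n : ℕ) : ℝ := (n : ℝ) ^ κ * (n / (n + 2))

lemma growthWeight_le (κ : ℝ) (n : ℕ) : growthWeight κ n ≤ (n : ℝ) ^ κ := by
  unfold growthWeight
  have h : (n : ℝ) / (n + 2) ≤ 1 := by
    rw [div_le_one (by positivity)]; linarith
  have := Real.rpow_nonneg (Nat.cast_nonneg (α := ℝ) n) κ
  nlinarith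

lemma le_growthWeight (κ : ℝ) {n : ℕ} (hn : 1 ≤ n) : (n : ℝ) ^ κ / 3 ≤ growthWeight κ n := by
  unfold growthWeight
  have hn' : (1 : ℝ) ≤ n := by exact_mod_cast hn
  have h : (1 : ℝ) / 3 ≤ (n : ℝ) / (n + 2) := by
    rw [div_le_div_iff₀ (by positivity) (by positivity)]; linarith
  have := Real.rpow_nonneg (Nat.cast_nonneg (α := ℝ) n) κ
  nlinarith

/-- For κ ≥ 1 Bernoulli's inequality suffices. For κ < 1 the pure power n ^ κ grows too slowly by a
relative amount of order κ(1 - κ)/n². The factor n / (n + 2) gains about 2/n² per step, which covers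
this since κ(1 - κ) ≤ 1/4. -/
lemma growthWeight_succ {κ : ℝ} (hκ : 0 ≤ κ) {n : ℕ} (hn : 1 ≤ n) :
    (1 + κ / n) * growthWeight κ n ≤ growthWeight κ (n + 1) := by
  have hn' : (1 : ℝ) ≤ n := by exact_mod_cast hn
  have hn0 : (0 : ℝ) < n := by linarith
  unfold growthWeight
  push_cast
  have hpos : 0 ≤ ((n : ℝ) + 1) ^ κ := by positivity
  rcases le_total 1 κ with h1 | h1
  · have hb : 1 + κ * (1 / (n : ℝ)) ≤ (1 + 1 / (n : ℝ)) ^ κ :=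
      one_add_mul_self_le_rpow_one_add (by have : 0 ≤ 1 / (n : ℝ) := by positivity
                                           linarith) h1
    have e : ((n : ℝ) + 1) ^ κ = (1 + 1 / (n : ℝ)) ^ κ * (n : ℝ) ^ κ := by
      rw [← Real.mul_rpow (by positivity) (by positivity)]
      congr 1; field_simp
    have hq : (n : ℝ) / (n + 2) ≤ (n + 1) / (n + 1 + 2) := by
      rw [div_le_div_iff₀ (by positivity) (by positivity)]; nlinarith
    calc (1 + κ / n) * ((n : ℝ) ^ κ * (n / (n + 2)))
        = ((1 + κ * (1 / (n : ℝ))) * (n : ℝ) ^ κ) * (n / (n + 2)) := by ring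
      _ ≤ ((1 + 1 / (n : ℝ)) ^ κ * (n : ℝ) ^ κ) * ((n + 1) / (n + 1 + 2)) := by gcongr
      _ = _ := by rw [e]
  · have hb : (1 + (-1 / ((n : ℝ) + 1))) ^ κ ≤ 1 + κ * (-1 / ((n : ℝ) + 1)) := by
      apply rpow_one_add_le_one_add_mul_self _ hκ h1
      rw [le_div_iff₀ (by positivity)]; linarith
    have e : (n : ℝ) ^ κ = (1 + (-1 / ((n : ℝ) + 1))) ^ κ * ((n : ℝ) + 1) ^ κ := by
      rw [← Real.mul_rpow _ (by positivity)]
      · congr 1; field_simp; ring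
      · have : 1 + (-1 / ((n : ℝ) + 1)) = n / (n + 1) := by field_simp; ring
        rw [this]; positivity
    have hq : (1 + κ / n) * ((1 + κ * (-1 / ((n : ℝ) + 1))) * (n / (n + 2)))
        ≤ (n + 1) / (n + 1 + 2) := by
      have : (1 + κ / n) * ((1 + κ * (-1 / ((n : ℝ) + 1))) * (n / (n + 2)))
          = ((n + κ) * (n + 1 - κ)) / ((n + 1) * (n + 2)) := by field_simp; ring
      rw [this, div_le_div_iff₀ (by positivity) (by positivity)]
      nlinarith [sq_nonneg (κ - 1 / 2)]
    have hk : 0 ≤ 1 + κ / n := by positivity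
    calc (1 + κ / n) * ((n : ℝ) ^ κ * (n / (n + 2)))
        ≤ (1 + κ / n) * (((1 + κ * (-1 / ((n : ℝ) + 1))) * ((n : ℝ) + 1) ^ κ)
            * (n / (n + 2))) := by
          gcongr
          rw [e]
          gcongr
      _ = ((n : ℝ) + 1) ^ κ * ((1 + κ / n) * ((1 + κ * (-1 / ((n : ℝ) + 1)))
            * (n / (n + 2)))) := by ring
      _ ≤ _ := by gcongr

lemma growthWeight_pos (κ : ℝ) {n : ℕ} (hn : 1 ≤ n) : 0 < growthWeight κ n := by
  have hn' : (0 : ℝ) < n := by exact_mod_cast hn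
  unfold growthWeight; positivity

/-- Subcritical growth: if `κ < θ`, a forcing term of order `n ^ (θ - 1)` produces `n ^ θ`. -/
lemma exists_le_rpow_of_growth_lt {x : ℕ → ℝ} {κ θ C : ℝ} {n₀ : ℕ} (hn₀ : 1 ≤ n₀)
    (hκ : 0 ≤ κ) (hθ : κ < θ)
    (hx : ∀ n, n₀ ≤ n → x (n + 1) ≤ (1 + κ / n) * x n + C * (n : ℝ) ^ (θ - 1)) :
    ∃ B, 0 ≤ B ∧ ∀ n, n₀ ≤ n → x n ≤ B * (n : ℝ) ^ θ := by
  -- The first summand of the witness starts the induction and the second absorbs the forcing. The 3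
  -- comes from n ^ θ / 3 ≤ `growthWeight θ n`.
  obtain ⟨B, hB1, hB2, hB0⟩ : ∃ B : ℝ, x n₀ ≤ B * growthWeight θ n₀ ∧ C * 3 ≤ B * (θ - κ)
      ∧ 0 ≤ B := by
    refine ⟨|x n₀| / growthWeight θ n₀ + 3 * |C| / (θ - κ), ?_, ?_, ?_⟩
    all_goals have h1 := growthWeight_pos θ hn₀
    all_goals have h2 : 0 < θ - κ := by linarith
    · have : 0 ≤ 3 * |C| / (θ - κ) * growthWeight θ n₀ := by positivity
      rw [add_mul, div_mul_cancel₀ _ h1.ne']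
      linarith [le_abs_self (x n₀)]
    · have : 0 ≤ |x n₀| / growthWeight θ n₀ * (θ - κ) := by positivity
      rw [add_mul, div_mul_cancel₀ _ h2.ne']
      linarith [le_abs_self C]
    · positivity
  have key : ∀ n, n₀ ≤ n → x n ≤ B * growthWeight θ n := by
    intro n hn
    induction n, hn using Nat.le_induction with
    | base => exact hB1
    | succ n hn ih =>
      have hn1 : 1 ≤ n := hn₀.trans hn
      have hn' : (0 : ℝ) < n := by exact_mod_cast hn1
      have h1 := growthWeight_succ (κ := θ) (by linarith) hn1
      have h2 := le_growthWeight θ hn1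
      have e : (n : ℝ) ^ (θ - 1) = (n : ℝ) ^ θ / n := by
        rw [Real.rpow_sub_one hn'.ne']
      have hp : 0 ≤ (n : ℝ) ^ θ / n := by positivity
      calc x (n + 1) ≤ (1 + κ / n) * x n + C * (n : ℝ) ^ (θ - 1) := hx n hn
        _ ≤ (1 + κ / n) * (B * growthWeight θ n) + C * ((n : ℝ) ^ θ / n) := by
            rw [e]; gcongr
        _ ≤ (1 + κ / n) * (B * growthWeight θ n) + (B * (θ - κ) / 3) * ((n : ℝ) ^ θ / n) := by
            gcongr; linarith
        _ = (1 + κ / n) * (B * growthWeight θ n) + (B * (θ - κ)) / n * ((n : ℝ) ^ θ / 3) := by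
            ring
        _ ≤ (1 + κ / n) * (B * growthWeight θ n) + (B * (θ - κ)) / n * growthWeight θ n := by
            have : 0 ≤ B * (θ - κ) / n := by
              have : 0 < θ - κ := by linarith
              positivity
            gcongr
        _ = B * ((1 + θ / n) * growthWeight θ n) := by ring
        _ ≤ B * growthWeight θ (n + 1) := by gcongr
  exact ⟨B, hB0, fun n hn => (key n hn).trans (by gcongr; exact growthWeight_le θ n)⟩

/-- Critical growth: a forcing term of order `n ^ (κ - 1 - ε)` does not change the rate. -/
lemma exists_le_rpow_of_growth {x : ℕ → ℝ} {κ ε C : ℝ} {n₀ : ℕ} (hn₀ : 1 ≤ n₀)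
    (hκ : 0 ≤ κ) (hε : 0 < ε) (hε1 : ε ≤ 1)
    (hx : ∀ n, n₀ ≤ n → x (n + 1) ≤ (1 + κ / n) * x n + C * (n : ℝ) ^ (κ - 1 - ε)) :
    ∃ B, 0 ≤ B ∧ ∀ n, n₀ ≤ n → x n ≤ B * (n : ℝ) ^ κ := by
  have hle1 : ∀ n : ℕ, 1 ≤ n → (n : ℝ) ^ (-ε) ≤ 1 := fun n hn =>
    Real.rpow_le_one_of_one_le_of_nonpos (by exact_mod_cast hn) (by linarith)
  obtain ⟨B, hB1, hB2, hB0⟩ : ∃ B : ℝ, x n₀ ≤ B * growthWeight κ n₀ ∧ C ≤ B * (ε / 6)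
      ∧ 0 ≤ B := by
    refine ⟨|x n₀| / growthWeight κ n₀ + |C| / (ε / 6), ?_, ?_, ?_⟩
    all_goals have h1 := growthWeight_pos κ hn₀
    all_goals have h2 : 0 < ε / 6 := by linarith
    · have : 0 ≤ |C| / (ε / 6) * growthWeight κ n₀ := by positivity
      rw [add_mul, div_mul_cancel₀ _ h1.ne']
      linarith [le_abs_self (x n₀)]
    · have : 0 ≤ |x n₀| / growthWeight κ n₀ * (ε / 6) := by positivity
      rw [add_mul, div_mul_cancel₀ _ h2.ne']
      linarith [le_abs_self C]
    · positivity
  -- The factor 2 - n ^ (-ε) stays in [1, 2], and its increments, at least (ε / 2) n ^ (-1 - ε), pay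
  -- for the forcing. The constant ε / 6 is this ε / 2 times the 1 / 3 lost in `le_growthWeight`.
  have key : ∀ n, n₀ ≤ n → x n ≤ B * growthWeight κ n * (2 - (n : ℝ) ^ (-ε)) := by
    intro n hn
    induction n, hn using Nat.le_induction with
    | base =>
      have h1 := growthWeight_pos κ hn₀
      have h2 := hle1 n₀ hn₀
      have : 0 ≤ B * growthWeight κ n₀ := by positivity
      nlinarith
    | succ n hn ih =>
      have hn1 : 1 ≤ n := hn₀.trans hn
      have hn' : (1 : ℝ) ≤ n := by exact_mod_cast hn1
      have hn0 : (0 : ℝ) < n := by linarith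
      have h1 := growthWeight_succ (κ := κ) hκ hn1
      have h2 := le_growthWeight κ (n := n + 1) (by omega)
      have h3 := hle1 n hn1
      have hp0 : 0 ≤ (n : ℝ) ^ (-ε) := by positivity
      -- decrement of `n ^ (-ε)`
      have hdec : ε / 2 * ((n : ℝ) ^ (-ε) / n) ≤ (n : ℝ) ^ (-ε) - ((n + 1 : ℕ) : ℝ) ^ (-ε) := by
        have hb : (1 + (-1 / ((n : ℝ) + 1))) ^ ε ≤ 1 + ε * (-1 / ((n : ℝ) + 1)) := by
          apply rpow_one_add_le_one_add_mul_self _ hε.le hε1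
          rw [le_div_iff₀ (by positivity)]; linarith
        have e : ((n + 1 : ℕ) : ℝ) ^ (-ε) = (1 + (-1 / ((n : ℝ) + 1))) ^ ε * (n : ℝ) ^ (-ε) := by
          have : 1 + (-1 / ((n : ℝ) + 1)) = n / (n + 1) := by field_simp; ring
          rw [this, Real.div_rpow (by positivity) (by positivity), Real.rpow_neg (by positivity),
            Real.rpow_neg (by positivity)]
          push_cast
          have : (n : ℝ) ^ ε ≠ 0 := by positivity
          field_simp
        have hq : ε / 2 * (1 / n) ≤ 1 - (1 + ε * (-1 / ((n : ℝ) + 1))) := by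
          have : 1 - (1 + ε * (-1 / ((n : ℝ) + 1))) = ε / (n + 1) := by field_simp; ring
          rw [this, div_mul_div_comm, div_le_div_iff₀ (by positivity) (by positivity)]
          nlinarith
        rw [e]
        calc ε / 2 * ((n : ℝ) ^ (-ε) / n) = (ε / 2 * (1 / n)) * (n : ℝ) ^ (-ε) := by ring
          _ ≤ (1 - (1 + ε * (-1 / ((n : ℝ) + 1)))) * (n : ℝ) ^ (-ε) := by gcongr
          _ ≤ (1 - (1 + (-1 / ((n : ℝ) + 1))) ^ ε) * (n : ℝ) ^ (-ε) := by gcongr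
          _ = _ := by ring
      have e2 : (n : ℝ) ^ (κ - 1 - ε) = (n : ℝ) ^ κ * ((n : ℝ) ^ (-ε) / n) := by
        rw [sub_sub, Real.rpow_sub hn0, Real.rpow_add hn0, Real.rpow_one, Real.rpow_neg hn0.le]
        field_simp
      have hmono : (n : ℝ) ^ κ ≤ ((n + 1 : ℕ) : ℝ) ^ κ := by
        gcongr; linarith
      have hnn : 0 ≤ (n : ℝ) ^ (-ε) / n := by positivity
      have hGp := growthWeight_pos κ (n := n + 1) (by omega)
      have hkn : 0 ≤ (n : ℝ) ^ κ := by positivity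
      calc x (n + 1) ≤ (1 + κ / n) * x n + C * (n : ℝ) ^ (κ - 1 - ε) := hx n hn
        _ ≤ (1 + κ / n) * (B * growthWeight κ n * (2 - (n : ℝ) ^ (-ε)))
            + B * (ε / 6) * ((n : ℝ) ^ κ * ((n : ℝ) ^ (-ε) / n)) := by rw [e2]; gcongr
        _ = B * ((1 + κ / n) * growthWeight κ n) * (2 - (n : ℝ) ^ (-ε))
            + B * ((n : ℝ) ^ κ / 3) * (ε / 2 * ((n : ℝ) ^ (-ε) / n)) := by ring
        _ ≤ B * growthWeight κ (n + 1) * (2 - (n : ℝ) ^ (-ε))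
            + B * growthWeight κ (n + 1) * (ε / 2 * ((n : ℝ) ^ (-ε) / n)) := by
            have : 0 ≤ 2 - (n : ℝ) ^ (-ε) := by linarith
            gcongr
            exact (div_le_div_of_nonneg_right hmono (by norm_num)).trans h2
        _ ≤ B * growthWeight κ (n + 1) * (2 - (n : ℝ) ^ (-ε))
            + B * growthWeight κ (n + 1) * ((n : ℝ) ^ (-ε) - ((n + 1 : ℕ) : ℝ) ^ (-ε)) := by
            gcongr
        _ = _ := by ring
  refine ⟨2 * B, by positivity, fun n hn => (key n hn).trans ?_⟩
  have h1 := growthWeight_le κ n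
  have h2 := growthWeight_pos κ (hn₀.trans hn)
  have h3 : 0 ≤ (n : ℝ) ^ (-ε) := by positivity
  calc B * growthWeight κ n * (2 - (n : ℝ) ^ (-ε)) ≤ B * growthWeight κ n * 2 := by
        gcongr; linarith
    _ ≤ B * (n : ℝ) ^ κ * 2 := by gcongr
    _ = _ := by ring

/-! ### The Markov chain of positions, as a family of functionals on `ℤ → ℝ` -/

/-- Average of the two neighbouring values. -/
noncomputable def avg (f : ℤ → ℝ) (x : ℤ) : ℝ := (f (x + 1) + f (x - 1)) / 2

/-- Central difference. -/
noncomputable def dif (f : ℤ → ℝ) (x : ℤ) : ℝ := (f (x + 1) - f (x - 1)) / 2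

/-- The operator `f ↦ (1 + ρ (x + j)) / 2 * f (x + 1) + (1 - ρ (x - j)) / 2 * f (x - 1)`. For
`j = 0` and `ρ = (2 * p - 1) / n` it is the transition operator of the walk at time `n`. -/
noncomputable def walkOp (ρ j : ℝ) (f : ℤ → ℝ) (x : ℤ) : ℝ :=
  (1 + ρ * (x + j)) / 2 * f (x + 1) + (1 - ρ * (x - j)) / 2 * f (x - 1)

/-- Because the drift is linear in x, differencing only raises j by one. The family is thus closed
under D, and the estimates for D f and D²f are those of `walkOp` with j = 1 and j = 2. -/
lemma dif_walkOp (ρ j : ℝ) (f : ℤ → ℝ) : dif (walkOp ρ j f) = walkOp ρ (j + 1) (dif f) := by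
  ext x
  simp only [dif, walkOp, show x + 1 + 1 = x + 2 by ring, show x - 1 - 1 = x - 2 by ring,
    show x + 1 - 1 = x by ring, show x - 1 + 1 = x by ring]
  push_cast; ring

lemma dif_avg (f : ℤ → ℝ) : dif (avg f) = avg (dif f) := by
  ext x
  simp only [dif, avg, show x + 1 + 1 = x + 2 by ring, show x - 1 - 1 = x - 2 by ring,
    show x + 1 - 1 = x by ring, show x - 1 + 1 = x by ring]
  ring

/-- Expectation of `f (T_n)`, where `c = 2 * p - 1`. -/
noncomputable def walkExp (c q : ℝ) : ℕ → (ℤ → ℝ) → ℝ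
  | 0, f => f 0
  | 1, f => q * f 1 + (1 - q) * f (-1)
  | (n + 2), f => walkExp c q (n + 1) (walkOp (c / ((n + 1 : ℕ) : ℝ)) 0 f)

lemma walkExp_succ (c q : ℝ) {n : ℕ} (hn : 1 ≤ n) (f : ℤ → ℝ) :
    walkExp c q (n + 1) f = walkExp c q n (walkOp (c / n) 0 f) := by
  obtain ⟨m, rfl⟩ : ∃ m, n = m + 1 := ⟨n - 1, by omega⟩
  rw [walkExp]

section
variable (c q : ℝ)

lemma walkExp_add {n : ℕ} (hn : 1 ≤ n) (f g : ℤ → ℝ) :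
    walkExp c q n (fun x => f x + g x) = walkExp c q n f + walkExp c q n g := by
  induction n, hn using Nat.le_induction generalizing f g with
  | base => simp only [walkExp]; ring
  | succ n hn ih =>
    rw [walkExp_succ _ _ hn, walkExp_succ _ _ hn, walkExp_succ _ _ hn, ← ih]
    congr 1; ext x; simp only [walkOp]; ring

lemma walkExp_const_mul {n : ℕ} (hn : 1 ≤ n) (a : ℝ) (f : ℤ → ℝ) :
    walkExp c q n (fun x => a * f x) = a * walkExp c q n f := by
  induction n, hn using Nat.le_induction generalizing f with
  | base => simp only [walkExp]; ring
  | succ n hn ih =>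
    rw [walkExp_succ _ _ hn, walkExp_succ _ _ hn, ← ih]
    congr 1; ext x; simp only [walkOp]; ring

lemma walkExp_sub {n : ℕ} (hn : 1 ≤ n) (f g : ℤ → ℝ) :
    walkExp c q n (fun x => f x - g x) = walkExp c q n f - walkExp c q n g := by
  have h := walkExp_add c q hn f (fun x => (-1) * g x)
  rw [walkExp_const_mul c q hn] at h
  rw [show (fun x => f x - g x) = fun x => f x + (-1) * g x by ext x; ring, h]; ring

lemma walkExp_const {n : ℕ} (hn : 1 ≤ n) (a : ℝ) : walkExp c q n (fun _ => a) = a := by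
  induction n, hn using Nat.le_induction with
  | base => simp only [walkExp]; ring
  | succ n hn ih =>
    rw [walkExp_succ _ _ hn]
    convert ih using 2
    ext x; simp only [walkOp]; ring

variable {c q}

/-- The transition weights are probabilities only for |x| ≤ n, which is also where the walk lives at
time n. Hence comparisons, and later all regularity conditions, are restricted to balls. -/
lemma walkExp_mono (hc : |c| ≤ 1) (hq0 : 0 ≤ q) (hq1 : q ≤ 1) {n : ℕ} (hn : 1 ≤ n)
    {f g : ℤ → ℝ} (h : ∀ x : ℤ, |x| ≤ n → f x ≤ g x) : walkExp c q n f ≤ walkExp c q n g := by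
  induction n, hn using Nat.le_induction generalizing f g with
  | base =>
    simp only [walkExp]
    have h1 := h 1 (by simp)
    have h2 := h (-1) (by simp)
    have : 0 ≤ 1 - q := by linarith
    gcongr
  | succ n hn ih =>
    rw [walkExp_succ _ _ hn, walkExp_succ _ _ hn]
    apply ih
    intro x hx
    have hn' : (0 : ℝ) < n := by exact_mod_cast hn
    have hx' : |(x : ℝ)| ≤ n := by exact_mod_cast hx
    have hb : |c / n * x| ≤ 1 := by
      rw [abs_mul, abs_div, abs_of_pos hn', div_mul_eq_mul_div, div_le_one hn']
      calc |c| * |(x : ℝ)| ≤ 1 * n := by gcongr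
        _ = n := one_mul _
    rw [abs_le] at hb hx
    simp only [walkOp]
    have h1 := h (x + 1) (by rw [abs_le]; push_cast; omega)
    have h2 := h (x - 1) (by rw [abs_le]; push_cast; omega)
    have : 0 ≤ (1 + c / n * (x + 0)) / 2 := by linarith
    have : 0 ≤ (1 - c / n * (x - 0)) / 2 := by linarith
    gcongr

lemma abs_walkExp_le (hc : |c| ≤ 1) (hq0 : 0 ≤ q) (hq1 : q ≤ 1) {n : ℕ} (hn : 1 ≤ n)
    {f g : ℤ → ℝ} (h : ∀ x : ℤ, |x| ≤ n → |f x| ≤ g x) :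
    |walkExp c q n f| ≤ walkExp c q n g := by
  rw [abs_le]
  constructor
  · have := walkExp_mono hc hq0 hq1 hn (f := fun x => (-1) * g x) (g := f)
      (fun x hx => by have := (abs_le.mp (h x hx)).1; linarith)
    rw [walkExp_const_mul c q hn] at this
    linarith
  · exact walkExp_mono hc hq0 hq1 hn (fun x hx => (abs_le.mp (h x hx)).2)

lemma abs_walkExp_le_const (hc : |c| ≤ 1) (hq0 : 0 ≤ q) (hq1 : q ≤ 1) {n : ℕ} (hn : 1 ≤ n)
    {f : ℤ → ℝ} {B : ℝ} (h : ∀ x : ℤ, |x| ≤ n → |f x| ≤ B) :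
    |walkExp c q n f| ≤ B := by
  have := abs_walkExp_le hc hq0 hq1 hn (g := fun _ => B) h
  rwa [walkExp_const c q hn] at this

/-! ### First and second moments of the walk -/

variable (c q)

/-- `E T_n`. -/
noncomputable def walkMean (n : ℕ) : ℝ := walkExp c q n (fun x => x)

/-- `E T_n ^ 2`. -/
noncomputable def walkSq (n : ℕ) : ℝ := walkExp c q n (fun x => (x : ℝ) ^ 2)

lemma walkMean_one : walkMean c q 1 = 2 * q - 1 := by
  simp only [walkMean, walkExp]; push_cast; ring

lemma walkMean_succ {n : ℕ} (hn : 1 ≤ n) :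
    walkMean c q (n + 1) = (1 + c / n) * walkMean c q n := by
  rw [walkMean, walkMean, walkExp_succ _ _ hn, ← walkExp_const_mul c q hn]
  congr 1; ext x; simp only [walkOp]; push_cast; ring

lemma walkSq_one : walkSq c q 1 = 1 := by
  simp only [walkSq, walkExp]; push_cast; ring

lemma walkSq_succ {n : ℕ} (hn : 1 ≤ n) :
    walkSq c q (n + 1) = (1 + 2 * (c / n)) * walkSq c q n + 1 := by
  rw [walkSq, walkSq, walkExp_succ _ _ hn]
  calc _ = walkExp c q n (fun x => (1 + 2 * (c / n)) * (x : ℝ) ^ 2 + 1) := by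
        congr 1; ext x; simp only [walkOp]; push_cast; ring
    _ = _ := by
        rw [walkExp_add c q hn (fun x => (1 + 2 * (c / n)) * (x : ℝ) ^ 2) (fun _ => 1),
          walkExp_const c q hn, walkExp_const_mul c q hn]

variable {c q}

/-- Cauchy–Schwarz, obtained from the positivity of E (|T_n| - E|T_n|)². -/
lemma walkExp_abs_le (hc : |c| ≤ 1) (hq0 : 0 ≤ q) (hq1 : q ≤ 1) {n : ℕ} (hn : 1 ≤ n) :
    walkExp c q n (fun x => |(x : ℝ)|) ≤ √(walkSq c q n) := by
  apply Real.le_sqrt_of_sq_le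
  set t := walkExp c q n (fun x => |(x : ℝ)|) with ht
  have h := walkExp_mono hc hq0 hq1 hn (f := fun _ => 0) (g := fun x : ℤ => (|(x : ℝ)| - t) ^ 2)
    (fun x _ => by positivity)
  have e : (fun x : ℤ => (|(x : ℝ)| - t) ^ 2)
      = fun x : ℤ => ((x : ℝ) ^ 2 + (-2 * t) * |(x : ℝ)|) + t ^ 2 := by
    ext x; rw [sub_sq, sq_abs]; ring
  rw [e, walkExp_const c q hn, walkExp_add c q hn, walkExp_const c q hn, walkExp_add c q hn,
    walkExp_const_mul c q hn, ← ht] at h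
  unfold walkSq
  nlinarith

lemma walkSq_nonneg (hc : |c| ≤ 1) (hq0 : 0 ≤ q) (hq1 : q ≤ 1) {n : ℕ} (hn : 1 ≤ n) :
    0 ≤ walkSq c q n := by
  have h := walkExp_mono hc hq0 hq1 hn (f := fun _ => 0) (g := fun x : ℤ => (x : ℝ) ^ 2)
    (fun x _ => by positivity)
  rwa [walkExp_const c q hn] at h

lemma abs_walkMean_le (hc : |c| ≤ 1) (hq0 : 0 ≤ q) (hq1 : q ≤ 1) {n : ℕ} (hn : 1 ≤ n) :
    |walkMean c q n| ≤ √(walkSq c q n) :=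
  (abs_walkExp_le hc hq0 hq1 hn (fun _ _ => le_rfl)).trans (walkExp_abs_le hc hq0 hq1 hn)

/-! ### The Stein defect of the walk -/

variable (c q)

/-- The discrete Stein functional `E[T_n²] E[D A f (T_n)] - E[(T_n - E T_n) f (T_n)]`. -/
noncomputable def steinDefect (n : ℕ) (f : ℤ → ℝ) : ℝ :=
  walkSq c q n * walkExp c q n (dif (avg f))
    - walkExp c q n (fun x => (x - walkMean c q n) * f x)

/-- Write ρ = c/n and P = A + ρ x D. The product rules D(x g) = x D g + A g and A(x g) = x A g + D
g, together with A² = 1 + D², make every term of lower order cancel. The unit of variance gained in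
one step multiplies P D A f = D f + D³f + ρ x A D²f, whose first term cancels the D f produced by
P(x f) = x P f + D f + ρ x A f. After moving everything under E at time n the identity is pointwise
in x. -/
lemma steinDefect_succ {n : ℕ} (hn : 1 ≤ n) (f : ℤ → ℝ) :
    steinDefect c q (n + 1) f =
      steinDefect c q n (walkOp (c / n) 0 f) + c / n * steinDefect c q n (avg f)
      + (1 - c / n * walkSq c q n) * walkExp c q n (dif (dif (dif f)))
      + c / n * (1 + 2 * (c / n) * walkSq c q n)
          * walkExp c q n (fun x => x * avg (dif (dif f)) x)
      + (c / n) ^ 2 * walkMean c q n * walkExp c q n (fun x => x * dif f x) := by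
  unfold steinDefect
  rw [walkExp_succ _ _ hn, walkExp_succ _ _ hn, walkSq_succ _ _ hn, walkMean_succ _ _ hn]
  set ρ := c / n
  set w := walkSq c q n
  set m := walkMean c q n
  simp only [← walkExp_const_mul c q hn, ← walkExp_sub c q hn, ← walkExp_add c q hn]
  congr 1; ext x
  simp only [walkOp, dif, avg, show x + 1 + 1 = x + 2 by ring, show x - 1 - 1 = x - 2 by ring,
    show x + 1 - 1 = x by ring, show x - 1 + 1 = x by ring, show x + 2 + 1 = x + 3 by ring,
    show x + 2 - 1 = x + 1 by ring, show x - 2 + 1 = x - 1 by ring,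
    show x - 2 - 1 = x - 3 by ring]
  push_cast; ring
end

/-! ### Local regularity classes on the integers -/

/-- `|f| ≤ B` on the integers of modulus at most `N`. -/
def BoundedOnBall (N : ℕ) (B : ℝ) (f : ℤ → ℝ) : Prop := ∀ x : ℤ, |x| ≤ N → |f x| ≤ B

/-- `f` is `s`-Hölder with constant `K` on the integers of modulus at most `N`. -/
def HolderOnBall (N : ℕ) (s K : ℝ) (f : ℤ → ℝ) : Prop :=
  ∀ x y : ℤ, |x| ≤ N → |y| ≤ N → |f x - f y| ≤ K * |(x : ℝ) - y| ^ s

lemma BoundedOnBall.avg {N : ℕ} {B : ℝ} {f : ℤ → ℝ} (h : BoundedOnBall (N + 1) B f) :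
    BoundedOnBall N B (avg f) := by
  intro x hx
  rw [abs_le] at hx
  have h1 := h (x + 1) (by rw [abs_le]; push_cast; omega)
  have h2 := h (x - 1) (by rw [abs_le]; push_cast; omega)
  rw [abs_le] at *
  unfold _root_.avg
  constructor <;> linarith

lemma BoundedOnBall.dif {N : ℕ} {B : ℝ} {f : ℤ → ℝ} (h : BoundedOnBall (N + 1) B f) :
    BoundedOnBall N B (dif f) := by
  intro x hx
  rw [abs_le] at hx
  have h1 := h (x + 1) (by rw [abs_le]; push_cast; omega)
  have h2 := h (x - 1) (by rw [abs_le]; push_cast; omega)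
  rw [abs_le] at *
  unfold _root_.dif
  constructor <;> linarith

lemma HolderOnBall.avg {N : ℕ} {s K : ℝ} {f : ℤ → ℝ} (h : HolderOnBall (N + 1) s K f) :
    HolderOnBall N s K (avg f) := by
  intro x y hx hy
  rw [abs_le] at hx hy
  have h1 := h (x + 1) (y + 1) (by rw [abs_le]; push_cast; omega) (by rw [abs_le]; push_cast; omega)
  have h2 := h (x - 1) (y - 1) (by rw [abs_le]; push_cast; omega) (by rw [abs_le]; push_cast; omega)
  push_cast at h1 h2
  rw [show (x : ℝ) + 1 - (y + 1) = x - y by ring] at h1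
  rw [show (x : ℝ) - 1 - (y - 1) = x - y by ring] at h2
  rw [abs_le] at *
  unfold _root_.avg
  constructor <;> linarith

lemma HolderOnBall.boundedOnBall_dif {N : ℕ} {s K : ℝ} {f : ℤ → ℝ} (hK : 0 ≤ K) (hs : s ≤ 1)
    (h : HolderOnBall (N + 1) s K f) : BoundedOnBall N K (_root_.dif f) := by
  intro x hx
  rw [abs_le] at hx
  have h1 := h (x + 1) (x - 1) (by rw [abs_le]; push_cast; omega) (by rw [abs_le]; push_cast; omega)
  push_cast at h1
  rw [show (x : ℝ) + 1 - (x - 1) = 2 by ring, abs_of_pos (by norm_num : (0 : ℝ) < 2)] at h1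
  have h2 : (2 : ℝ) ^ s ≤ 2 := by
    calc (2 : ℝ) ^ s ≤ 2 ^ (1 : ℝ) := by gcongr; norm_num
      _ = 2 := by norm_num
  unfold _root_.dif
  rw [abs_div, abs_of_pos (by norm_num : (0 : ℝ) < 2), div_le_iff₀ (by norm_num)]
  exact h1.trans (by gcongr)

/-- The smallness of ρ makes both weights nonnegative, and they add up to 1 + jρ. The sign of ρ is
kept, so that negative memory contracts. -/
lemma BoundedOnBall.walkOp {N : ℕ} {B ρ j : ℝ} {f : ℤ → ℝ} (hj : 0 ≤ j)
    (hρ : |ρ| * (N + j) ≤ 1) (h : BoundedOnBall (N + 1) B f) :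
    BoundedOnBall N ((1 + j * ρ) * B) (walkOp ρ j f) := by
  intro x hx
  have hx' : |(x : ℝ)| ≤ N := by exact_mod_cast hx
  rw [abs_le] at hx
  have h1 := h (x + 1) (by rw [abs_le]; push_cast; omega)
  have h2 := h (x - 1) (by rw [abs_le]; push_cast; omega)
  have e1 : |ρ * (x + j)| ≤ 1 := by
    rw [abs_mul]
    refine le_trans ?_ hρ
    gcongr
    exact (abs_add_le _ _).trans (by rw [abs_of_nonneg hj]; linarith)
  have e2 : |ρ * (x - j)| ≤ 1 := by
    rw [abs_mul]
    refine le_trans ?_ hρ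
    gcongr
    exact (abs_sub _ _).trans (by rw [abs_of_nonneg hj]; linarith)
  rw [abs_le] at e1 e2
  unfold _root_.walkOp
  have p1 : 0 ≤ (1 + ρ * (x + j)) / 2 := by linarith
  have p2 : 0 ≤ (1 - ρ * (x - j)) / 2 := by linarith
  calc |(1 + ρ * (x + j)) / 2 * f (x + 1) + (1 - ρ * (x - j)) / 2 * f (x - 1)|
      ≤ (1 + ρ * (x + j)) / 2 * |f (x + 1)| + (1 - ρ * (x - j)) / 2 * |f (x - 1)| := by
        refine (abs_add_le _ _).trans ?_
        rw [abs_mul, abs_mul, abs_of_nonneg p1, abs_of_nonneg p2]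
    _ ≤ (1 + ρ * (x + j)) / 2 * B + (1 - ρ * (x - j)) / 2 * B := by gcongr
    _ = _ := by ring

/-- Transitions from x and y at distance d are coupled. Both points move the same way, except for a
mass |ρ| d / 2. For ρ ≥ 0 this mass drives them apart to d + 2, and concavity, (d + 2)^s ≤ d^s (1 +
2s/d), gives the extra sρ. For ρ ≤ 0 it moves them to distance |d - 2| ≤ d, at no cost, because d ≥
1 on the integers. -/
lemma HolderOnBall.walkOp {N : ℕ} {s K ρ j : ℝ} {f : ℤ → ℝ} (hs : 0 ≤ s) (hs1 : s ≤ 1)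
    (hK : 0 ≤ K) (hj : 0 ≤ j) (hρ : |ρ| * (N + j) ≤ 1) (h : HolderOnBall (N + 1) s K f) :
    HolderOnBall N s ((1 + j * ρ + s * max ρ 0) * K) (walkOp ρ j f) := by
  -- it suffices to treat `y < x`
  have key : ∀ x y : ℤ, |x| ≤ N → |y| ≤ N → y < x → |_root_.walkOp ρ j f x - _root_.walkOp ρ j f y|
      ≤ (1 + j * ρ + s * max ρ 0) * K * |(x : ℝ) - y| ^ s := by
    intro x y hx hy hxy
    have coef : ∀ z : ℤ, |z| ≤ N → 0 ≤ (1 + ρ * (z + j)) / 2 ∧ 0 ≤ (1 - ρ * (z - j)) / 2 := by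
      intro z hz
      have hz' : |(z : ℝ)| ≤ N := by exact_mod_cast hz
      have e1 : |ρ * (z + j)| ≤ 1 := by
        rw [abs_mul]
        refine le_trans ?_ hρ
        gcongr
        exact (abs_add_le _ _).trans (by rw [abs_of_nonneg hj]; linarith)
      have e2 : |ρ * (z - j)| ≤ 1 := by
        rw [abs_mul]
        refine le_trans ?_ hρ
        gcongr
        exact (abs_sub _ _).trans (by rw [abs_of_nonneg hj]; linarith)
      rw [abs_le] at e1 e2
      constructor <;> linarith
    obtain ⟨ax, bx⟩ := coef x hx
    obtain ⟨ay, by'⟩ := coef y hy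
    rw [abs_le] at hx hy
    have hd : (1 : ℝ) ≤ x - y := by
      have : y + 1 ≤ x := hxy
      have : (y : ℝ) + 1 ≤ x := by exact_mod_cast this
      linarith
    have hpp := h (x + 1) (y + 1) (by rw [abs_le]; push_cast; omega)
      (by rw [abs_le]; push_cast; omega)
    have hmm := h (x - 1) (y - 1) (by rw [abs_le]; push_cast; omega)
      (by rw [abs_le]; push_cast; omega)
    have hpm := h (x + 1) (y - 1) (by rw [abs_le]; push_cast; omega)
      (by rw [abs_le]; push_cast; omega)
    have hmp := h (x - 1) (y + 1) (by rw [abs_le]; push_cast; omega)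
      (by rw [abs_le]; push_cast; omega)
    push_cast at hpp hmm hpm hmp
    rw [show (x : ℝ) + 1 - (y + 1) = x - y by ring] at hpp
    rw [show (x : ℝ) - 1 - (y - 1) = x - y by ring] at hmm
    rw [show (x : ℝ) + 1 - (y - 1) = x - y + 2 by ring] at hpm
    rw [show (x : ℝ) - 1 - (y + 1) = x - y - 2 by ring] at hmp
    set d : ℝ := (x : ℝ) - y with hd_def
    rw [abs_of_pos (by linarith : 0 < d)] at hpp hmm ⊢
    rw [abs_of_pos (by linarith : 0 < d + 2)] at hpm
    have hds : 0 ≤ d ^ s := by positivity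
    unfold _root_.walkOp
    rcases le_total 0 ρ with h0 | h0
    · rw [max_eq_left h0]
      have hb : (d + 2) ^ s ≤ d ^ s * (1 + s * (2 / d)) := by
        have : (1 + 2 / d) ^ s ≤ 1 + s * (2 / d) :=
          rpow_one_add_le_one_add_mul_self (by have : 0 ≤ 2 / d := by positivity
                                               linarith) hs hs1
        calc (d + 2) ^ s = (d * (1 + 2 / d)) ^ s := by congr 1; field_simp
          _ = d ^ s * (1 + 2 / d) ^ s := Real.mul_rpow (by positivity) (by positivity)
          _ ≤ _ := by gcongr
      have e : (1 + ρ * (x + j)) / 2 * f (x + 1) + (1 - ρ * (x - j)) / 2 * f (x - 1)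
          - ((1 + ρ * (y + j)) / 2 * f (y + 1) + (1 - ρ * (y - j)) / 2 * f (y - 1))
          = (1 + ρ * (y + j)) / 2 * (f (x + 1) - f (y + 1))
            + (1 - ρ * (x - j)) / 2 * (f (x - 1) - f (y - 1))
            + ρ * d / 2 * (f (x + 1) - f (y - 1)) := by rw [hd_def]; ring
      rw [e]
      have hrd : 0 ≤ ρ * d / 2 := by positivity
      calc _ ≤ (1 + ρ * (y + j)) / 2 * |f (x + 1) - f (y + 1)|
            + (1 - ρ * (x - j)) / 2 * |f (x - 1) - f (y - 1)|
            + ρ * d / 2 * |f (x + 1) - f (y - 1)| := by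
            refine (abs_add_le _ _).trans (add_le_add ((abs_add_le _ _).trans ?_) ?_)
            · rw [abs_mul, abs_mul, abs_of_nonneg ay, abs_of_nonneg bx]
            · rw [abs_mul, abs_of_nonneg hrd]
        _ ≤ (1 + ρ * (y + j)) / 2 * (K * d ^ s) + (1 - ρ * (x - j)) / 2 * (K * d ^ s)
            + ρ * d / 2 * (K * (d ^ s * (1 + s * (2 / d)))) := by
            gcongr
            exact hpm.trans (by gcongr)
        _ = (1 + j * ρ + s * ρ) * K * d ^ s := by
            have : d ≠ 0 := by linarith
            field_simp
            rw [hd_def]; ring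
    · rw [max_eq_right h0]
      have hb : |d - 2| ^ s ≤ d ^ s := by
        apply Real.rpow_le_rpow (abs_nonneg _) _ hs
        rw [abs_le]; constructor <;> linarith
      have e : (1 + ρ * (x + j)) / 2 * f (x + 1) + (1 - ρ * (x - j)) / 2 * f (x - 1)
          - ((1 + ρ * (y + j)) / 2 * f (y + 1) + (1 - ρ * (y - j)) / 2 * f (y - 1))
          = (1 + ρ * (x + j)) / 2 * (f (x + 1) - f (y + 1))
            + (1 - ρ * (y - j)) / 2 * (f (x - 1) - f (y - 1))
            + (-ρ) * d / 2 * (f (x - 1) - f (y + 1)) := by rw [hd_def]; ring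
      rw [e]
      have hrd : 0 ≤ (-ρ) * d / 2 := by
        have : 0 ≤ -ρ := by linarith
        positivity
      calc _ ≤ (1 + ρ * (x + j)) / 2 * |f (x + 1) - f (y + 1)|
            + (1 - ρ * (y - j)) / 2 * |f (x - 1) - f (y - 1)|
            + (-ρ) * d / 2 * |f (x - 1) - f (y + 1)| := by
            refine (abs_add_le _ _).trans (add_le_add ((abs_add_le _ _).trans ?_) ?_)
            · rw [abs_mul, abs_mul, abs_of_nonneg ax, abs_of_nonneg by']
            · rw [abs_mul, abs_of_nonneg hrd]
        _ ≤ (1 + ρ * (x + j)) / 2 * (K * d ^ s) + (1 - ρ * (y - j)) / 2 * (K * d ^ s)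
            + (-ρ) * d / 2 * (K * d ^ s) := by
            gcongr
            exact hmp.trans (by gcongr)
        _ = (1 + j * ρ + s * 0) * K * d ^ s := by rw [hd_def]; ring
  have hG : 0 ≤ (1 + j * ρ + s * max ρ 0) * K := by
    have : |j * ρ| ≤ 1 := by
      rw [abs_mul, abs_of_nonneg hj, mul_comm]
      refine le_trans ?_ hρ
      gcongr; have : (0 : ℝ) ≤ N := by positivity
      linarith
    have h1 := (abs_le.mp this).1
    have h2 : 0 ≤ s * max ρ 0 := by positivity
    have : 0 ≤ 1 + j * ρ + s * max ρ 0 := by linarith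
    positivity
  intro x y hx hy
  rcases lt_trichotomy x y with hxy | hxy | hxy
  · rw [abs_sub_comm, abs_sub_comm (x : ℝ)]
    exact key y x hy hx hxy
  · subst hxy
    simp only [sub_self, abs_zero]
    exact mul_nonneg hG (Real.rpow_nonneg le_rfl s)
  · exact key x y hx hy hxy

/-! ### One-step estimates for the Stein defect -/

lemma abs_steinDefect_succ_le {c q : ℝ} (hc : |c| ≤ 1) (hq0 : 0 ≤ q) (hq1 : q ≤ 1) {n : ℕ}
    (hn : 1 ≤ n) {f : ℤ → ℝ} {S₁ S₂ S₃ : ℝ} (h1 : BoundedOnBall n S₁ (dif f))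
    (h2 : BoundedOnBall (n + 1) S₂ (dif (dif f))) (h3 : BoundedOnBall n S₃ (dif (dif (dif f)))) :
    |steinDefect c q (n + 1) f| ≤
      |steinDefect c q n (walkOp (c / n) 0 f)| + |c| / n * |steinDefect c q n (avg f)|
      + (1 + |c| / n * walkSq c q n) * S₃
      + |c| / n * (1 + 2 * (|c| / n) * walkSq c q n) * √(walkSq c q n) * S₂
      + (|c| / n) ^ 2 * |walkMean c q n| * √(walkSq c q n) * S₁ := by
  have hn' : (0 : ℝ) < n := by exact_mod_cast hn
  have hw := walkSq_nonneg hc hq0 hq1 hn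
  have hS2 : 0 ≤ S₂ := (abs_nonneg _).trans (h2 0 (by simp; positivity))
  have hS1 : 0 ≤ S₁ := (abs_nonneg _).trans (h1 0 (by simp))
  have hS3 : 0 ≤ S₃ := (abs_nonneg _).trans (h3 0 (by simp))
  have lin : ∀ {g : ℤ → ℝ} {S : ℝ}, 0 ≤ S → BoundedOnBall n S g →
      |walkExp c q n (fun x => x * g x)| ≤ √(walkSq c q n) * S := by
    intro g S hS hg
    refine (abs_walkExp_le hc hq0 hq1 hn (g := fun x => S * |(x : ℝ)|) ?_).trans ?_
    · intro x hx
      rw [abs_mul, mul_comm]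
      gcongr
      exact hg x hx
    · rw [walkExp_const_mul c q hn, mul_comm]
      gcongr
      exact walkExp_abs_le hc hq0 hq1 hn
  have e : |c / n| = |c| / n := by rw [abs_div, abs_of_pos hn']
  rw [steinDefect_succ c q hn]
  refine (abs_add_le _ _).trans (add_le_add ((abs_add_le _ _).trans (add_le_add
    ((abs_add_le _ _).trans (add_le_add ((abs_add_le _ _).trans (add_le_add le_rfl ?_)) ?_)) ?_)) ?_)
  · rw [abs_mul, e]
  · rw [abs_mul]
    gcongr
    · refine (abs_sub _ _).trans ?_
      rw [abs_one, abs_mul, e, abs_of_nonneg hw]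
    · exact abs_walkExp_le_const hc hq0 hq1 hn h3
  · rw [abs_mul, abs_mul, e, mul_assoc _ (√_)]
    gcongr
    · refine (abs_add_le _ _).trans ?_
      rw [abs_one, abs_mul, abs_mul, e, abs_of_nonneg hw, abs_of_pos (by norm_num : (0 : ℝ) < 2)]
    · exact lin hS2 h2.avg
  · rw [abs_mul, abs_mul, abs_pow, e, mul_assoc _ (√_)]
    gcongr
    exact lin hS1 h1

lemma BoundedOnBall.mono {N M : ℕ} {B B' : ℝ} {f : ℤ → ℝ} (h : BoundedOnBall N B f)
    (hNM : M ≤ N) (hB : B ≤ B') : BoundedOnBall M B' f :=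
  fun x hx => (h x (hx.trans (by exact_mod_cast hNM))).trans hB

lemma HolderOnBall.mono {N M : ℕ} {s K : ℝ} {f : ℤ → ℝ} (h : HolderOnBall N s K f)
    (hNM : M ≤ N) : HolderOnBall M s K f :=
  fun x y hx hy => h x y (hx.trans (by exact_mod_cast hNM)) (hy.trans (by exact_mod_cast hNM))

/-- No sign of the weights is assumed. This serves fixed times, where negative weights may occur and
the size of the constant does not matter. -/
lemma BoundedOnBall.walkOp_crude {N : ℕ} {B ρ j : ℝ} {f : ℤ → ℝ} (hj : 0 ≤ j)
    (h : BoundedOnBall (N + 1) B f) :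
    BoundedOnBall N ((1 + |ρ| * (N + j)) * B) (_root_.walkOp ρ j f) := by
  intro x hx
  have hx' : |(x : ℝ)| ≤ N := by exact_mod_cast hx
  rw [abs_le] at hx
  have h1 := h (x + 1) (by rw [abs_le]; push_cast; omega)
  have h2 := h (x - 1) (by rw [abs_le]; push_cast; omega)
  have hB : 0 ≤ B := (abs_nonneg _).trans h1
  have e1 : |(1 + ρ * (x + j)) / 2| ≤ (1 + |ρ| * (N + j)) / 2 := by
    rw [abs_div, abs_of_pos (by norm_num : (0 : ℝ) < 2)]
    gcongr
    refine (abs_add_le _ _).trans ?_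
    rw [abs_one, abs_mul]
    gcongr
    exact (abs_add_le _ _).trans (by rw [abs_of_nonneg hj]; linarith)
  have e2 : |(1 - ρ * (x - j)) / 2| ≤ (1 + |ρ| * (N + j)) / 2 := by
    rw [abs_div, abs_of_pos (by norm_num : (0 : ℝ) < 2)]
    gcongr
    refine (abs_sub _ _).trans ?_
    rw [abs_one, abs_mul]
    gcongr
    exact (abs_sub _ _).trans (by rw [abs_of_nonneg hj]; linarith)
  unfold _root_.walkOp
  calc _ ≤ |(1 + ρ * (x + j)) / 2| * |f (x + 1)| + |(1 - ρ * (x - j)) / 2| * |f (x - 1)| := by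
        refine (abs_add_le _ _).trans ?_
        rw [abs_mul, abs_mul]
    _ ≤ (1 + |ρ| * (N + j)) / 2 * B + (1 + |ρ| * (N + j)) / 2 * B := by gcongr
    _ = _ := by ring

/-- At a fixed time the Stein defect is controlled by the first differences. -/
lemma exists_steinDefect_le_of_fixed {c q : ℝ} (hc : |c| ≤ 1) (hq0 : 0 ≤ q) (hq1 : q ≤ 1) {n : ℕ}
    (hn : 1 ≤ n) : ∃ C, 0 ≤ C ∧ ∀ (f : ℤ → ℝ) (I : ℝ), BoundedOnBall (n + 2) I (dif f) →
      |steinDefect c q n f| ≤ C * I := by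
  induction n, hn using Nat.le_induction with
  | base =>
    refine ⟨2, by norm_num, fun f I h => ?_⟩
    have h1 := abs_walkExp_le_const hc hq0 hq1 (n := 1) le_rfl (f := dif (avg f)) (B := I) (by
      rw [dif_avg]; exact (h.avg).mono (by norm_num) le_rfl)
    have h2 := h 0 (by simp)
    have hI : 0 ≤ I := (abs_nonneg _).trans h2
    have e : walkExp c q 1 (fun x => (x - walkMean c q 1) * f x) = 4 * q * (1 - q) * dif f 0 := by
      rw [walkMean_one]
      simp only [walkExp, dif, zero_add, zero_sub]
      push_cast; ring
    unfold steinDefect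
    rw [e, walkSq_one, one_mul]
    have h3 : |4 * q * (1 - q) * dif f 0| ≤ I := by
      rw [abs_mul]
      calc _ ≤ 1 * I := by
            gcongr
            rw [abs_le]; constructor <;> nlinarith [sq_nonneg (2 * q - 1)]
        _ = I := one_mul I
    exact (abs_sub _ _).trans (by linarith)
  | succ n hn ih =>
    obtain ⟨C, hC, ih⟩ := ih
    have hw := walkSq_nonneg hc hq0 hq1 hn
    refine ⟨C * (1 + |c / n| * ((n + 2 : ℕ) + 1)) + |c| / n * C
      + (1 + |c| / n * walkSq c q n)
      + |c| / n * (1 + 2 * (|c| / n) * walkSq c q n) * √(walkSq c q n)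
      + (|c| / n) ^ 2 * |walkMean c q n| * √(walkSq c q n), by positivity, fun f I h => ?_⟩
    have h' : BoundedOnBall ((n + 2) + 1) I (dif f) := h.mono (by omega) le_rfl
    have b1 := ih (walkOp (c / n) 0 f) ((1 + |c / n| * ((n + 2 : ℕ) + 1)) * I) (by
      rw [dif_walkOp, zero_add]
      exact h'.walkOp_crude zero_le_one)
    have b2 := ih (avg f) I (by rw [dif_avg]; exact h'.avg)
    have b3 := abs_steinDefect_succ_le hc hq0 hq1 hn (f := f) (S₁ := I) (S₂ := I) (S₃ := I)
      (h.mono (by omega) le_rfl) ((h'.mono (by omega) le_rfl : BoundedOnBall ((n + 1) + 1) I _).dif)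
      ((h'.mono (by omega) le_rfl : BoundedOnBall ((n + 1) + 1) I _).dif.dif)
    calc _ ≤ _ := b3
      _ ≤ C * ((1 + |c / n| * ((n + 2 : ℕ) + 1)) * I) + |c| / n * (C * I)
          + (1 + |c| / n * walkSq c q n) * I
          + |c| / n * (1 + 2 * (|c| / n) * walkSq c q n) * √(walkSq c q n) * I
          + (|c| / n) ^ 2 * |walkMean c q n| * √(walkSq c q n) * I := by gcongr
      _ = _ := by ring

/-! ### Moments and linear recursions -/

/-- The solution of `x (n + 1) = (1 + κ / n) * x n + e n` with `x 0 = x₀`. -/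
noncomputable def linRec (κ x₀ : ℝ) (e : ℕ → ℝ) : ℕ → ℝ
  | 0 => x₀
  | n + 1 => (1 + κ / n) * linRec κ x₀ e n + e n

/-- The recursion starts at index 0, where κ / 0 = 0, while the estimates start at a later time.
Monotonicity transports the initial value to that time. -/
lemma linRec_ge {κ x₀ : ℝ} {e : ℕ → ℝ} (hκ : 0 ≤ κ) (hx : 0 ≤ x₀) (he : ∀ n, 0 ≤ e n) (n : ℕ) :
    x₀ ≤ linRec κ x₀ e n := by
  induction n with
  | zero => exact le_rfl
  | succ n ih =>
    rw [linRec]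
    have : 0 ≤ κ / n := by positivity
    nlinarith [he n]

/-- The second moment is linear in n for c < 1/2 and of order n log n for c = 1/2. The margin η
hides the logarithm, so that the subcritical estimate with κ = 2c⁺ < 1 + η covers both cases. -/
lemma walkSq_le {c q : ℝ} (hc : |c| ≤ 1) (hq0 : 0 ≤ q) (hq1 : q ≤ 1)
    (hc2 : c ≤ 1 / 2) {η : ℝ} (hη : 0 ≤ η) (h : c < 1 / 2 ∨ 0 < η) :
    ∃ B, 0 ≤ B ∧ ∀ n : ℕ, 1 ≤ n → walkSq c q n ≤ B * (n : ℝ) ^ (1 + η) := by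
  apply exists_le_rpow_of_growth_lt (κ := 2 * max c 0) (C := 1) le_rfl
  · positivity
  · rcases h with h | h
    · have : max c 0 < 1 / 2 := max_lt h (by norm_num)
      linarith
    · have : max c 0 ≤ 1 / 2 := max_le hc2 (by norm_num)
      linarith
  · intro n hn
    have hn' : (1 : ℝ) ≤ n := by exact_mod_cast hn
    rw [walkSq_succ c q hn, add_sub_cancel_left]
    have h1 : 1 ≤ (n : ℝ) ^ η := Real.one_le_rpow hn' hη
    have h2 := walkSq_nonneg hc hq0 hq1 hn
    have h3 : 2 * (c / n) ≤ 2 * max c 0 / n := by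
      rw [← mul_div_assoc]; gcongr; exact le_max_left c 0
    rw [one_mul]
    gcongr

lemma abs_walkMean_le_one {c q : ℝ} (hc : -1 ≤ c) (hc0 : c ≤ 0) (hq0 : 0 ≤ q) (hq1 : q ≤ 1)
    {n : ℕ} (hn : 1 ≤ n) : |walkMean c q n| ≤ 1 := by
  induction n, hn using Nat.le_induction with
  | base => rw [walkMean_one, abs_le]; constructor <;> linarith
  | succ n hn ih =>
    have hn' : (1 : ℝ) ≤ n := by exact_mod_cast hn
    rw [walkMean_succ c q hn, abs_mul]
    have h1 : -1 ≤ c / n := by rw [le_div_iff₀ (by linarith)]; linarith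
    have h2 : c / n ≤ 0 := div_nonpos_of_nonpos_of_nonneg hc0 (by linarith)
    have : |1 + c / n| ≤ 1 := by rw [abs_le]; constructor <;> linarith
    exact mul_le_one₀ this (abs_nonneg _) ih

/-! ### Growth of the accumulated one-step errors -/

section
variable (c q : ℝ)

/-- Coefficient of the third differences in the one-step error. -/
noncomputable def errThird (n : ℕ) : ℝ := 1 + |c| / n * walkSq c q n

/-- Coefficient of the second differences in the one-step error. -/
noncomputable def errSecond (n : ℕ) : ℝ :=
  |c| / n * (1 + 2 * (|c| / n) * walkSq c q n) * √(walkSq c q n)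

/-- Coefficient of the first differences in the one-step error. -/
noncomputable def errFirst (n : ℕ) : ℝ :=
  (|c| / n) ^ 2 * |walkMean c q n| * √(walkSq c q n)

variable {c q}

lemma errThird_le (hc : |c| ≤ 1) {n : ℕ} (hn : 1 ≤ n) {B η : ℝ}
    (hη : 0 ≤ η) (hw0 : 0 ≤ walkSq c q n) (hw : walkSq c q n ≤ B * (n : ℝ) ^ (1 + η)) :
    errThird c q n ≤ (1 + B) * (n : ℝ) ^ η := by
  have hn' : (1 : ℝ) ≤ n := by exact_mod_cast hn
  have h1 : 1 ≤ (n : ℝ) ^ η := Real.one_le_rpow hn' hη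
  have e : (n : ℝ) ^ (1 + η) = n * (n : ℝ) ^ η := by
    rw [Real.rpow_add (by linarith), Real.rpow_one]
  have : |c| / n * walkSq c q n ≤ 1 / n * (B * (n * (n : ℝ) ^ η)) := by
    rw [← e]; gcongr
  have e2 : 1 / n * (B * (n * (n : ℝ) ^ η)) = B * (n : ℝ) ^ η := by
    have : (n : ℝ) ≠ 0 := by linarith
    field_simp
  unfold errThird
  linarith

lemma sqrt_walkSq_le {n : ℕ} {B η : ℝ} (hB : 0 ≤ B)
    (hw : walkSq c q n ≤ B * (n : ℝ) ^ (1 + η)) :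
    √(walkSq c q n) ≤ √B * (n : ℝ) ^ (1 / 2 + η / 2) := by
  calc √(walkSq c q n) ≤ √(B * (n : ℝ) ^ (1 + η)) := Real.sqrt_le_sqrt hw
    _ = √B * (n : ℝ) ^ (1 / 2 + η / 2) := by
        rw [Real.sqrt_mul hB, Real.sqrt_eq_rpow ((n : ℝ) ^ (1 + η)), ← Real.rpow_mul (by positivity)]
        congr 2; ring

lemma errSecond_le (hc : |c| ≤ 1) {n : ℕ} (hn : 1 ≤ n) {B η : ℝ}
    (hη : 0 ≤ η) (hB : 0 ≤ B) (hw0 : 0 ≤ walkSq c q n)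
    (hw : walkSq c q n ≤ B * (n : ℝ) ^ (1 + η)) :
    errSecond c q n ≤ (1 + 2 * B) * √B * (n : ℝ) ^ (2 * η - 1 / 2) := by
  have hn' : (1 : ℝ) ≤ n := by exact_mod_cast hn
  have hn0 : (0 : ℝ) < n := by linarith
  have h1 := errThird_le hc hn hη hw0 hw
  have h3 : 1 + 2 * (|c| / n) * walkSq c q n ≤ (1 + 2 * B) * (n : ℝ) ^ η := by
    have h1' : 1 ≤ (n : ℝ) ^ η := Real.one_le_rpow hn' hη
    unfold errThird at h1
    have h4 : |c| / n * walkSq c q n ≤ B * (n : ℝ) ^ η := by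
      have e : (n : ℝ) ^ (1 + η) = n * (n : ℝ) ^ η := by rw [Real.rpow_add hn0, Real.rpow_one]
      calc |c| / n * walkSq c q n ≤ 1 / n * (B * (n * (n : ℝ) ^ η)) := by rw [← e]; gcongr
        _ = _ := by field_simp
    nlinarith
  have h2 := sqrt_walkSq_le hB hw
  unfold errSecond
  calc _ ≤ 1 / (n : ℝ) * ((1 + 2 * B) * (n : ℝ) ^ η) * (√B * (n : ℝ) ^ (1 / 2 + η / 2)) := by
        gcongr
    _ = (1 + 2 * B) * √B * (n : ℝ) ^ (-1 + η + (1 / 2 + η / 2)) := by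
        rw [Real.rpow_add hn0 (-1 + η), Real.rpow_add hn0 (-1) η, Real.rpow_neg_one]; ring
    _ ≤ _ := by
        gcongr ?_ * ?_
        apply Real.rpow_le_rpow_of_exponent_le hn'
        linarith

/-- For c < 1/2 the homogeneous exponent (2 + r)c⁺ lies strictly below max(1, r/2 + 2c⁺), and
bounded forcing is admissible since that maximum is at least 1. At c = 1/2 both exponents equal 1 +
r/2, and the forcing n ^ (r/4) leaves the margin ε = r/4 for the critical estimate. -/
lemma exists_linRec_third_le (hc2 : c ≤ 1 / 2) {r x₀ : ℝ} {e : ℕ → ℝ} (hr : 0 < r) (hr2 : r ≤ 2)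
    (h1 : c < 1 / 2 → ∃ C, ∀ n, 1 ≤ n → e n ≤ C)
    (h2 : ∃ C, ∀ n : ℕ, 1 ≤ n → e n ≤ C * (n : ℝ) ^ (r / 4)) :
    ∃ B, 0 ≤ B ∧ ∀ n : ℕ, 1 ≤ n → linRec ((2 + r) * max c 0) x₀ e n
      ≤ B * (n : ℝ) ^ (max 1 (r / 2 + 2 * max c 0)) := by
  have hcp : 0 ≤ max c 0 := le_max_right _ _
  rcases lt_or_eq_of_le hc2 with h | h
  · obtain ⟨C, hC⟩ := h1 h
    apply exists_le_rpow_of_growth_lt (κ := (2 + r) * max c 0) (C := max C 0) le_rfl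
      (by positivity)
    · rcases le_total c 0 with h0 | h0
      · rw [max_eq_right h0, mul_zero]
        exact lt_max_of_lt_left one_pos
      · rw [max_eq_left h0]
        apply lt_max_of_lt_right
        nlinarith
    · intro n hn
      have hn' : (1 : ℝ) ≤ n := by exact_mod_cast hn
      rw [linRec]
      gcongr
      calc e n ≤ max C 0 * 1 := by rw [mul_one]; exact (hC n hn).trans (le_max_left _ _)
        _ ≤ _ := by
            gcongr
            exact Real.one_le_rpow hn' (by have := le_max_left 1 (r / 2 + 2 * max c 0); linarith)
  · obtain ⟨C, hC⟩ := h2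
    have e1 : max c 0 = 1 / 2 := by rw [h]; norm_num
    have e2 : max 1 (r / 2 + 2 * max c 0) = (2 + r) * max c 0 := by
      rw [e1, max_eq_right (by linarith)]; ring
    rw [e2]
    apply exists_le_rpow_of_growth (C := C) (ε := r / 4) le_rfl (by positivity) (by linarith)
      (by linarith)
    intro n hn
    rw [linRec]
    have : (2 + r) * max c 0 - 1 - r / 4 = r / 4 := by rw [e1]; ring
    rw [this]
    gcongr
    exact hC n hn

/-- The exponents satisfy 3c⁺ < 1/2 + 2c⁺ exactly when c < 1/2. At equality the forcing is at most
of order n^0, which lies below n^(3/2 - 1 - 1/4). -/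
lemma exists_linRec_second_le (hc : |c| ≤ 1) (hq0 : 0 ≤ q) (hq1 : q ≤ 1) (hc2 : c ≤ 1 / 2)
    (x₀ : ℝ) :
    ∃ B, 0 ≤ B ∧ ∀ n : ℕ, 1 ≤ n → linRec (3 * max c 0) x₀ (errSecond c q) n
      ≤ B * (n : ℝ) ^ (1 / 2 + 2 * max c 0) := by
  have hcp : 0 ≤ max c 0 := le_max_right _ _
  rcases lt_or_eq_of_le hc2 with h | h
  · obtain ⟨B, hB, hw⟩ := walkSq_le hc hq0 hq1 hc2 (η := 0) le_rfl (Or.inl h)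
    apply exists_le_rpow_of_growth_lt (κ := 3 * max c 0) (C := (1 + 2 * B) * √B) le_rfl (by positivity)
    · have : max c 0 < 1 / 2 := max_lt h (by norm_num)
      linarith
    · intro n hn
      have hn' : (1 : ℝ) ≤ n := by exact_mod_cast hn
      rw [linRec]
      gcongr
      refine (errSecond_le hc hn le_rfl hB (walkSq_nonneg hc hq0 hq1 hn) (hw n hn)).trans ?_
      gcongr ?_ * ?_
      apply Real.rpow_le_rpow_of_exponent_le hn'
      linarith
  · obtain ⟨B, hB, hw⟩ := walkSq_le hc hq0 hq1 hc2 (η := 1 / 4) (by norm_num)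
      (Or.inr (by norm_num))
    have e1 : max c 0 = 1 / 2 := by rw [h]; norm_num
    have e2 : 1 / 2 + 2 * max c 0 = 3 * max c 0 := by rw [e1]; norm_num
    rw [e2]
    apply exists_le_rpow_of_growth (C := (1 + 2 * B) * √B) (ε := 1 / 4) le_rfl (by positivity)
      (by norm_num) (by norm_num)
    intro n hn
    have hn' : (1 : ℝ) ≤ n := by exact_mod_cast hn
    rw [linRec]
    gcongr
    refine (errSecond_le hc hn (by norm_num) hB (walkSq_nonneg hc hq0 hq1 hn) (hw n hn)).trans ?_
    gcongr ?_ * ?_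
    apply Real.rpow_le_rpow_of_exponent_le hn'
    rw [e1]; norm_num

/-- For c ≤ 0 the mean is bounded and the forcing is O(n^(-3/2)), hence summable. For c > 0 the
bound |E T_n| √w_n ≤ w_n = O(n^(1+c)) gives forcing n^(2c - 1 - c), which is critical with margin ε
= c. -/
lemma exists_linRec_first_le (hc : |c| ≤ 1) (hq0 : 0 ≤ q) (hq1 : q ≤ 1) (hc2 : c ≤ 1 / 2)
    (x₀ : ℝ) :
    ∃ B, 0 ≤ B ∧ ∀ n : ℕ, 1 ≤ n → linRec (2 * max c 0) x₀ (errFirst c q) n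
      ≤ B * (n : ℝ) ^ (2 * max c 0) := by
  have hcp : 0 ≤ max c 0 := le_max_right _ _
  rcases le_or_gt c 0 with h | h
  · obtain ⟨B, hB, hw⟩ := walkSq_le hc hq0 hq1 hc2 (η := 0) le_rfl (Or.inl (by linarith))
    apply exists_le_rpow_of_growth (C := √B) (ε := 1 / 2) le_rfl (by positivity) (by norm_num)
      (by norm_num)
    intro n hn
    have hn' : (1 : ℝ) ≤ n := by exact_mod_cast hn
    have hn0 : (0 : ℝ) < n := by linarith
    rw [linRec]
    gcongr
    have h2 := sqrt_walkSq_le hB (hw n hn)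
    have h3 := abs_walkMean_le_one (abs_le.mp hc).1 h hq0 hq1 hn
    unfold errFirst
    rw [max_eq_right h]
    calc _ ≤ (1 / (n : ℝ)) ^ 2 * 1 * (√B * (n : ℝ) ^ (1 / 2 + (0 : ℝ) / 2)) := by gcongr
      _ = √B * (n : ℝ) ^ (-(2 : ℕ) + (1 / 2 + (0 : ℝ) / 2)) := by
          rw [Real.rpow_add hn0 (-(2 : ℕ)), Real.rpow_neg hn0.le, Real.rpow_natCast]; ring
      _ = _ := by congr 2; norm_num
  · obtain ⟨B, hB, hw⟩ := walkSq_le hc hq0 hq1 hc2 (η := c) h.le (Or.inr h)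
    have e1 : max c 0 = c := max_eq_left h.le
    apply exists_le_rpow_of_growth (C := B) (ε := c) le_rfl (by positivity) h (by linarith)
    intro n hn
    have hn' : (1 : ℝ) ≤ n := by exact_mod_cast hn
    have hn0 : (0 : ℝ) < n := by linarith
    have hw0 := walkSq_nonneg hc hq0 hq1 hn
    rw [linRec]
    gcongr
    unfold errFirst
    rw [e1]
    calc _ ≤ (1 / (n : ℝ)) ^ 2 * √(walkSq c q n) * √(walkSq c q n) := by
          gcongr
          exact abs_walkMean_le hc hq0 hq1 hn
      _ = (1 / (n : ℝ)) ^ 2 * walkSq c q n := by rw [mul_assoc, Real.mul_self_sqrt hw0]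
      _ ≤ (1 / (n : ℝ)) ^ 2 * (B * (n : ℝ) ^ (1 + c)) := by gcongr; exact hw n hn
      _ = B * (n : ℝ) ^ (-(2 : ℕ) + (1 + c)) := by
          rw [Real.rpow_add hn0 (-(2 : ℕ)), Real.rpow_neg hn0.le, Real.rpow_natCast]; ring
      _ = _ := by congr 2; push_cast; ring
end

/-! ### Bounds for the Stein defect -/

/-- The 4 is the excess 2 of the ball radius n + 2 plus the largest shift j = 2. -/
lemma exists_time_coefficients_nonneg {c : ℝ} (hc : |c| < 1) :
    ∃ n₀ : ℕ, 1 ≤ n₀ ∧ ∀ n : ℕ, n₀ ≤ n → |c| * (n + 4) ≤ n := by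
  obtain ⟨k, hk⟩ := exists_nat_ge (4 * |c| / (1 - |c|))
  refine ⟨k + 1, by omega, fun n hn => ?_⟩
  have h1 : 0 < 1 - |c| := by linarith
  rw [div_le_iff₀ h1] at hk
  have : (k : ℝ) + 1 ≤ n := by exact_mod_cast hn
  nlinarith

lemma abs_div_mul_le {c : ℝ} {n : ℕ} (hn : 1 ≤ n) (h : |c| * (n + 4) ≤ n) {j : ℝ} (hj : j ≤ 2) :
    |c / n| * ((n + 2 : ℕ) + j) ≤ 1 := by
  have hn' : (0 : ℝ) < n := by exact_mod_cast hn
  rw [abs_div, abs_of_pos hn', div_mul_eq_mul_div, div_le_one hn']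
  refine le_trans ?_ h
  have : ((n + 2 : ℕ) : ℝ) + j ≤ n + 4 := by push_cast; linarith
  gcongr

/-- Induction on n through the one-step identity. The radius n + 2 leaves room: passing from n + 1
to n loses one unit of radius, and so does each difference. For Hölder D f, both D²f and D³f are
bounded by K, so the second- and third-order errors feed the same recursion. -/
lemma exists_steinDefect_le_low {c q s : ℝ} (hc : |c| < 1) (hq0 : 0 ≤ q) (hq1 : q ≤ 1)
    (hc2 : c ≤ 1 / 2) (hs : 0 < s) (hs1 : s ≤ 1) :
    ∃ B, 0 ≤ B ∧ ∃ n₀ : ℕ, 1 ≤ n₀ ∧ ∀ n : ℕ, n₀ ≤ n → ∀ (f : ℤ → ℝ) (K I : ℝ), 0 ≤ K →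
      HolderOnBall (n + 2) s K (dif f) → BoundedOnBall (n + 2) I (dif f) →
      |steinDefect c q n f| ≤ B * ((n : ℝ) ^ (max 1 (s / 2 + 2 * max c 0)) * K
        + (n : ℝ) ^ (2 * max c 0) * I) := by
  have hcp : 0 ≤ max c 0 := le_max_right _ _
  obtain ⟨n₀, hn₀, hcoef⟩ := exists_time_coefficients_nonneg hc
  obtain ⟨C₀, hC₀, hstart⟩ := exists_steinDefect_le_of_fixed hc.le hq0 hq1 hn₀
  set e : ℕ → ℝ := fun n => errThird c q n + errSecond c q n with he
  have hw0 : ∀ n, 1 ≤ n → 0 ≤ walkSq c q n := fun n hn => walkSq_nonneg hc.le hq0 hq1 hn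
  have ew0 : ∀ n, 0 ≤ walkSq c q n := by
    intro n
    rcases Nat.eq_zero_or_pos n with rfl | h
    · simp [walkSq, walkExp]
    · exact hw0 n h
  have e3 : ∀ n, 0 ≤ errThird c q n := fun n => by have := ew0 n; unfold errThird; positivity
  have e2 : ∀ n, 0 ≤ errSecond c q n := fun n => by have := ew0 n; unfold errSecond; positivity
  have e1 : ∀ n, 0 ≤ errFirst c q n := fun n => by unfold errFirst; positivity
  have he0 : ∀ n, 0 ≤ e n := fun n => add_nonneg (e3 n) (e2 n)
  -- A collects the coefficient of K and G that of I. Only G has a nonzero initial value, because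
  -- the bound at the starting time involves I alone.
  set A := linRec ((2 + s) * max c 0) 0 e with hA
  set G := linRec (2 * max c 0) C₀ (errFirst c q) with hG
  have bound : ∀ η : ℝ, 0 ≤ η → (c < 1 / 2 ∨ 0 < η) →
      ∃ C, ∀ n : ℕ, 1 ≤ n → e n ≤ C * (n : ℝ) ^ (2 * η) := by
    intro η hη h
    obtain ⟨B, hB, hw⟩ := walkSq_le hc.le hq0 hq1 hc2 hη h
    refine ⟨(1 + B) + (1 + 2 * B) * √B, fun n hn => ?_⟩
    have hn' : (1 : ℝ) ≤ n := by exact_mod_cast hn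
    rw [add_mul]
    apply add_le_add
    · refine (errThird_le hc.le hn hη (hw0 n hn) (hw n hn)).trans ?_
      gcongr ?_ * ?_
      exact Real.rpow_le_rpow_of_exponent_le hn' (by linarith)
    · refine (errSecond_le hc.le hn hη hB (hw0 n hn) (hw n hn)).trans ?_
      gcongr ?_ * ?_
      exact Real.rpow_le_rpow_of_exponent_le hn' (by linarith)
  obtain ⟨B₁, hB₁, hAle⟩ := exists_linRec_third_le (x₀ := 0) hc2 hs (by linarith)
    (fun h => by simpa using bound 0 le_rfl (Or.inl h))
    (by
      -- The bound on the forcing is n ^ (2η), so η = s/8 produces the required n ^ (s/4).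
      obtain ⟨C, hC⟩ := bound (s / 8) (by positivity) (Or.inr (by positivity))
      exact ⟨C, fun n hn => by convert hC n hn using 3; ring⟩)
  obtain ⟨B₂, hB₂, hGle⟩ := exists_linRec_first_le hc.le hq0 hq1 hc2 C₀
  have key : ∀ n : ℕ, n₀ ≤ n → ∀ (f : ℤ → ℝ) (K I : ℝ), 0 ≤ K →
      HolderOnBall (n + 2) s K (dif f) → BoundedOnBall (n + 2) I (dif f) →
      |steinDefect c q n f| ≤ A n * K + G n * I := by
    intro n hn
    induction n, hn using Nat.le_induction with
    | base =>
      intro f K I hK hf hI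
      have hI0 : 0 ≤ I := (abs_nonneg _).trans (hI 0 (by simp; positivity))
      have h1 := linRec_ge (κ := 2 * max c 0) (x₀ := C₀) (by positivity) hC₀ e1 n₀
      have h2 := linRec_ge (κ := (2 + s) * max c 0) (x₀ := 0) (by positivity) le_rfl he0 n₀
      calc _ ≤ C₀ * I := hstart f I hI
        _ ≤ G n₀ * I := by gcongr
        _ ≤ _ := by have : 0 ≤ A n₀ * K := mul_nonneg h2 hK
                    linarith
    | succ n hn ih =>
      intro f K I hK hf hI
      have hn1 : 1 ≤ n := hn₀.trans hn
      have hn' : (0 : ℝ) < n := by exact_mod_cast hn1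
      have hI0 : 0 ≤ I := (abs_nonneg _).trans (hI 0 (by simp; positivity))
      have hf' : HolderOnBall ((n + 2) + 1) s K (dif f) := hf.mono (by omega)
      have hI' : BoundedOnBall ((n + 2) + 1) I (dif f) := hI.mono (by omega) le_rfl
      have hρ := abs_div_mul_le hn1 (hcoef n hn) (j := 1) (by norm_num)
      have hA0 := linRec_ge (κ := (2 + s) * max c 0) (x₀ := 0) (by positivity) le_rfl he0 n
      have hG0 := hC₀.trans
        (linRec_ge (κ := 2 * max c 0) (x₀ := C₀) (by positivity) hC₀ e1 n)
      have hmx : max (c / n) 0 = max c 0 / n := by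
        rw [max_div_div_right hn'.le c 0 |>.symm, zero_div]
      have hfac : 0 ≤ (1 + 1 * (c / n) + s * max (c / n) 0) := by
        have : |c / n| ≤ 1 := by
          refine le_trans ?_ hρ
          push_cast
          have := abs_nonneg (c / n)
          nlinarith
        have := (abs_le.mp this).1
        have : 0 ≤ s * max (c / n) 0 := by positivity
        linarith
      have b1 := ih (walkOp (c / n) 0 f) _ _ (mul_nonneg hfac hK)
        (by rw [dif_walkOp, zero_add]; exact hf'.walkOp hs.le hs1 hK zero_le_one hρ)
        (by rw [dif_walkOp, zero_add]; exact hI'.walkOp zero_le_one hρ)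
      have b2 := ih (avg f) K I hK (by rw [dif_avg]; exact hf'.avg) (by rw [dif_avg]; exact hI'.avg)
      have hd2 : BoundedOnBall (n + 2) K (dif (dif f)) := hf'.boundedOnBall_dif hK hs1
      have b3 := abs_steinDefect_succ_le hc.le hq0 hq1 hn1 (f := f)
        (hI.mono (by omega) le_rfl) (hd2.mono (by omega) le_rfl)
        ((hd2.mono (by omega) le_rfl : BoundedOnBall (n + 1) K _).dif)
      -- The transition contributes c/n with its sign and the averaging term |c|/n. For c < 0 they
      -- cancel, which is why only c⁺ enters the exponents.
      have hsum : c / n + |c| / n ≤ 2 * (max c 0 / n) := by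
        rw [← add_div, ← mul_div_assoc]
        gcongr
        rcases le_total c 0 with h | h
        · rw [abs_of_nonpos h]; simp [h]
        · rw [abs_of_nonneg h, max_eq_left h]; linarith
      calc _ ≤ _ := b3
        _ ≤ (A n * ((1 + 1 * (c / n) + s * max (c / n) 0) * K) + G n * ((1 + 1 * (c / n)) * I))
            + |c| / n * (A n * K + G n * I)
            + (1 + |c| / n * walkSq c q n) * K
            + |c| / n * (1 + 2 * (|c| / n) * walkSq c q n) * √(walkSq c q n) * K
            + (|c| / n) ^ 2 * |walkMean c q n| * √(walkSq c q n) * I := by gcongr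
        _ = ((1 + (c / n + |c| / n) + s * (max c 0 / n)) * A n + e n) * K
            + ((1 + (c / n + |c| / n)) * G n + errFirst c q n) * I := by
            rw [hmx, he]; simp only [errThird, errSecond, errFirst]; ring
        _ ≤ ((1 + 2 * (max c 0 / n) + s * (max c 0 / n)) * A n + e n) * K
            + ((1 + 2 * (max c 0 / n)) * G n + errFirst c q n) * I := by gcongr
        _ = A (n + 1) * K + G (n + 1) * I := by
            rw [hA, hG, linRec, linRec]; ring
  refine ⟨max B₁ B₂, le_max_of_le_left hB₁, n₀, hn₀, fun n hn f K I hK hf hI => ?_⟩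
  have hI0 : 0 ≤ I := (abs_nonneg _).trans (hI 0 (by simp; positivity))
  have hn1 := hn₀.trans hn
  calc _ ≤ _ := key n hn f K I hK hf hI
    _ ≤ (B₁ * (n : ℝ) ^ (max 1 (s / 2 + 2 * max c 0))) * K + (B₂ * (n : ℝ) ^ (2 * max c 0)) * I := by
        gcongr
        · exact hAle n hn1
        · exact hGle n hn1
    _ ≤ (max B₁ B₂ * (n : ℝ) ^ (max 1 (s / 2 + 2 * max c 0))) * K
        + (max B₁ B₂ * (n : ℝ) ^ (2 * max c 0)) * I := by
        gcongr
        · exact le_max_left _ _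
        · exact le_max_right _ _
    _ = _ := by ring

/-- Here r = 1 + s and the Hölder condition sits on D²f, so that K controls D³f. The error T_n · A
D²f needs the sup norm J of D²f, which scales differently from K and gets its own recursion of
exponent 3c⁺. -/
lemma exists_steinDefect_le_high {c q s : ℝ} (hc : |c| < 1) (hq0 : 0 ≤ q) (hq1 : q ≤ 1)
    (hc2 : c ≤ 1 / 2) (hs : 0 < s) (hs1 : s ≤ 1) :
    ∃ B, 0 ≤ B ∧ ∃ n₀ : ℕ, 1 ≤ n₀ ∧ ∀ n : ℕ, n₀ ≤ n → ∀ (f : ℤ → ℝ) (K J I : ℝ), 0 ≤ K →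
      HolderOnBall (n + 2) s K (dif (dif f)) → BoundedOnBall (n + 2) J (dif (dif f)) →
      BoundedOnBall (n + 2) I (dif f) →
      |steinDefect c q n f| ≤ B * ((n : ℝ) ^ (max 1 ((1 + s) / 2 + 2 * max c 0)) * K
        + (n : ℝ) ^ (1 / 2 + 2 * max c 0) * J + (n : ℝ) ^ (2 * max c 0) * I) := by
  have hcp : 0 ≤ max c 0 := le_max_right _ _
  obtain ⟨n₀, hn₀, hcoef⟩ := exists_time_coefficients_nonneg hc
  obtain ⟨C₀, hC₀, hstart⟩ := exists_steinDefect_le_of_fixed hc.le hq0 hq1 hn₀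
  have hw0 : ∀ n, 1 ≤ n → 0 ≤ walkSq c q n := fun n hn => walkSq_nonneg hc.le hq0 hq1 hn
  have ew0 : ∀ n, 0 ≤ walkSq c q n := by
    intro n
    rcases Nat.eq_zero_or_pos n with rfl | h
    · simp [walkSq, walkExp]
    · exact hw0 n h
  have e3 : ∀ n, 0 ≤ errThird c q n := fun n => by have := ew0 n; unfold errThird; positivity
  have e2 : ∀ n, 0 ≤ errSecond c q n := fun n => by have := ew0 n; unfold errSecond; positivity
  have e1 : ∀ n, 0 ≤ errFirst c q n := fun n => by unfold errFirst; positivity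
  set A := linRec ((2 + (1 + s)) * max c 0) 0 (errThird c q) with hA
  set D := linRec (3 * max c 0) 0 (errSecond c q) with hD
  set G := linRec (2 * max c 0) C₀ (errFirst c q) with hG
  have bound : ∀ η : ℝ, 0 ≤ η → (c < 1 / 2 ∨ 0 < η) →
      ∃ C, ∀ n : ℕ, 1 ≤ n → errThird c q n ≤ C * (n : ℝ) ^ η := by
    intro η hη h
    obtain ⟨B, hB, hw⟩ := walkSq_le hc.le hq0 hq1 hc2 hη h
    exact ⟨1 + B, fun n hn => errThird_le hc.le hn hη (hw0 n hn) (hw n hn)⟩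
  obtain ⟨B₁, hB₁, hAle⟩ := exists_linRec_third_le (x₀ := 0) hc2 (r := 1 + s) (by linarith)
    (by linarith) (fun h => by simpa using bound 0 le_rfl (Or.inl h))
    (bound _ (by positivity) (Or.inr (by positivity)))
  obtain ⟨B₂, hB₂, hDle⟩ := exists_linRec_second_le hc.le hq0 hq1 hc2 0
  obtain ⟨B₃, hB₃, hGle⟩ := exists_linRec_first_le hc.le hq0 hq1 hc2 C₀
  have key : ∀ n : ℕ, n₀ ≤ n → ∀ (f : ℤ → ℝ) (K J I : ℝ), 0 ≤ K →
      HolderOnBall (n + 2) s K (dif (dif f)) → BoundedOnBall (n + 2) J (dif (dif f)) →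
      BoundedOnBall (n + 2) I (dif f) →
      |steinDefect c q n f| ≤ A n * K + D n * J + G n * I := by
    intro n hn
    have hA0 : ∀ n, 0 ≤ A n :=
      linRec_ge (κ := (2 + (1 + s)) * max c 0) (x₀ := 0) (by positivity) le_rfl e3
    have hD0 : ∀ n, 0 ≤ D n := linRec_ge (κ := 3 * max c 0) (x₀ := 0) (by positivity) le_rfl e2
    have hG0 : ∀ n, C₀ ≤ G n := linRec_ge (κ := 2 * max c 0) (x₀ := C₀) (by positivity) hC₀ e1
    induction n, hn using Nat.le_induction with
    | base =>
      intro f K J I hK hf hJ hI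
      have hI0 : 0 ≤ I := (abs_nonneg _).trans (hI 0 (by simp; positivity))
      have hJ0 : 0 ≤ J := (abs_nonneg _).trans (hJ 0 (by simp; positivity))
      calc _ ≤ C₀ * I := hstart f I hI
        _ ≤ G n₀ * I := by gcongr; exact hG0 n₀
        _ ≤ _ := by have : 0 ≤ A n₀ * K := mul_nonneg (hA0 n₀) hK
                    have : 0 ≤ D n₀ * J := mul_nonneg (hD0 n₀) hJ0
                    linarith
    | succ n hn ih =>
      intro f K J I hK hf hJ hI
      have hn1 : 1 ≤ n := hn₀.trans hn
      have hn' : (0 : ℝ) < n := by exact_mod_cast hn1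
      have hI0 : 0 ≤ I := (abs_nonneg _).trans (hI 0 (by simp; positivity))
      have hJ0 : 0 ≤ J := (abs_nonneg _).trans (hJ 0 (by simp; positivity))
      have hf' : HolderOnBall ((n + 2) + 1) s K (dif (dif f)) := hf.mono (by omega)
      have hJ' : BoundedOnBall ((n + 2) + 1) J (dif (dif f)) := hJ.mono (by omega) le_rfl
      have hI' : BoundedOnBall ((n + 2) + 1) I (dif f) := hI.mono (by omega) le_rfl
      have hρ := abs_div_mul_le hn1 (hcoef n hn) (j := 1) (by norm_num)
      have hρ2 := abs_div_mul_le hn1 (hcoef n hn) (j := 1 + 1) (by norm_num)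
      have hmx : max (c / n) 0 = max c 0 / n := by
        rw [max_div_div_right hn'.le c 0 |>.symm, zero_div]
      have hfac : 0 ≤ (1 + (1 + 1) * (c / n) + s * max (c / n) 0) := by
        have : |(1 + 1) * (c / n)| ≤ 1 := by
          refine le_trans ?_ hρ2
          rw [abs_mul, abs_of_pos (by norm_num : (0 : ℝ) < 1 + 1), mul_comm]
          have : (1 : ℝ) + 1 ≤ ((n + 2 : ℕ) : ℝ) + (1 + 1) := by push_cast; linarith
          exact mul_le_mul_of_nonneg_left this (abs_nonneg _)
        have := (abs_le.mp this).1
        have : 0 ≤ s * max (c / n) 0 := by positivity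
        linarith
      have hdd : dif (dif (walkOp (c / n) 0 f)) = walkOp (c / n) (1 + 1) (dif (dif f)) := by
        rw [dif_walkOp, zero_add, dif_walkOp]
      have b1 := ih (walkOp (c / n) 0 f) _ _ _ (mul_nonneg hfac hK)
        (by rw [hdd]; exact hf'.walkOp hs.le hs1 hK (by norm_num) hρ2)
        (by rw [hdd]; exact hJ'.walkOp (by norm_num) hρ2)
        (by rw [dif_walkOp, zero_add]; exact hI'.walkOp zero_le_one hρ)
      have b2 := ih (avg f) K J I hK (by rw [dif_avg, dif_avg]; exact hf'.avg)
        (by rw [dif_avg, dif_avg]; exact hJ'.avg) (by rw [dif_avg]; exact hI'.avg)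
      have hd3 : BoundedOnBall (n + 2) K (dif (dif (dif f))) := hf'.boundedOnBall_dif hK hs1
      have b3 := abs_steinDefect_succ_le hc.le hq0 hq1 hn1 (f := f)
        (hI.mono (by omega) le_rfl) (hJ.mono (by omega) le_rfl) (hd3.mono (by omega) le_rfl)
      have hsum : c / n + |c| / n ≤ 2 * (max c 0 / n) := by
        rw [← add_div, ← mul_div_assoc]
        gcongr
        rcases le_total c 0 with h | h
        · rw [abs_of_nonpos h]; simp [h]
        · rw [abs_of_nonneg h, max_eq_left h]; linarith
      have hsum1 : c / n ≤ max c 0 / n := by gcongr; exact le_max_left _ _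
      have hAn := hA0 n
      have hDn := hD0 n
      have hGn := hC₀.trans (hG0 n)
      calc _ ≤ _ := b3
        _ ≤ (A n * ((1 + (1 + 1) * (c / n) + s * max (c / n) 0) * K)
              + D n * ((1 + (1 + 1) * (c / n)) * J) + G n * ((1 + 1 * (c / n)) * I))
            + |c| / n * (A n * K + D n * J + G n * I)
            + (1 + |c| / n * walkSq c q n) * K
            + |c| / n * (1 + 2 * (|c| / n) * walkSq c q n) * √(walkSq c q n) * J
            + (|c| / n) ^ 2 * |walkMean c q n| * √(walkSq c q n) * I := by gcongr
        _ = ((1 + (c / n + |c| / n) + c / n + s * (max c 0 / n)) * A n + errThird c q n) * K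
            + ((1 + (c / n + |c| / n) + c / n) * D n + errSecond c q n) * J
            + ((1 + (c / n + |c| / n)) * G n + errFirst c q n) * I := by
            rw [hmx]; simp only [errThird, errSecond, errFirst]; ring
        _ ≤ ((1 + 2 * (max c 0 / n) + max c 0 / n + s * (max c 0 / n)) * A n
              + errThird c q n) * K
            + ((1 + 2 * (max c 0 / n) + max c 0 / n) * D n + errSecond c q n) * J
            + ((1 + 2 * (max c 0 / n)) * G n + errFirst c q n) * I := by gcongr
        _ = A (n + 1) * K + D (n + 1) * J + G (n + 1) * I := by
            rw [hA, hD, hG, linRec, linRec, linRec]; ring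
  refine ⟨B₁ + B₂ + B₃, by positivity, n₀, hn₀, fun n hn f K J I hK hf hJ hI => ?_⟩
  have hI0 : 0 ≤ I := (abs_nonneg _).trans (hI 0 (by simp; positivity))
  have hJ0 : 0 ≤ J := (abs_nonneg _).trans (hJ 0 (by simp; positivity))
  have hn1 := hn₀.trans hn
  calc _ ≤ _ := key n hn f K J I hK hf hJ hI
    _ ≤ (B₁ * (n : ℝ) ^ (max 1 ((1 + s) / 2 + 2 * max c 0))) * K
        + (B₂ * (n : ℝ) ^ (1 / 2 + 2 * max c 0)) * J + (B₃ * (n : ℝ) ^ (2 * max c 0)) * I := by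
        gcongr
        · exact hAle n hn1
        · exact hDle n hn1
        · exact hGle n hn1
    _ ≤ ((B₁ + B₂ + B₃) * (n : ℝ) ^ (max 1 ((1 + s) / 2 + 2 * max c 0))) * K
        + ((B₁ + B₂ + B₃) * (n : ℝ) ^ (1 / 2 + 2 * max c 0)) * J
        + ((B₁ + B₂ + B₃) * (n : ℝ) ^ (2 * max c 0)) * I := by
        gcongr <;> linarith
    _ = _ := by ring

/-! ### Elementary inequalities and Gaussian integrals -/

lemma rpow_le_one_add {t s : ℝ} (ht : 0 ≤ t) (hs : 0 ≤ s) (hs1 : s ≤ 1) : t ^ s ≤ 1 + t := by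
  rcases le_total t 1 with h | h
  · exact (Real.rpow_le_one ht h hs).trans (by linarith)
  · calc t ^ s ≤ t ^ (1 : ℝ) := Real.rpow_le_rpow_of_exponent_le h hs1
      _ ≤ 1 + t := by rw [Real.rpow_one]; linarith

lemma rpow_mul_exp_neg_le_one {t s : ℝ} (ht : 0 ≤ t) (hs : 0 ≤ s) (hs1 : s ≤ 1) :
    t ^ s * Real.exp (-t) ≤ 1 := by
  rw [Real.exp_neg, ← div_eq_mul_inv, div_le_one (Real.exp_pos t)]
  exact (rpow_le_one_add ht hs hs1).trans (by linarith [Real.add_one_le_exp t])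

lemma one_sub_exp_neg_le_rpow {t s : ℝ} (ht : 0 ≤ t) (hs : 0 ≤ s) (hs1 : s ≤ 1) :
    1 - Real.exp (-t) ≤ t ^ s := by
  rcases le_total t 1 with h | h
  · have h1 : t ≤ t ^ s := by
      rcases ht.eq_or_lt with h0 | h0
      · rw [← h0]; positivity
      · calc t = t ^ (1 : ℝ) := (Real.rpow_one t).symm
          _ ≤ t ^ s := Real.rpow_le_rpow_of_exponent_ge h0 h hs1
    linarith [Real.add_one_le_exp (-t)]
  · have := Real.one_le_rpow h hs
    linarith [Real.exp_pos (-t)]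

lemma integrable_pow_mul_exp_neg_sq (k : ℕ) :
    Integrable (fun u : ℝ => u ^ k * Real.exp (-u ^ 2 / 2)) := by
  have h := integrable_rpow_mul_exp_neg_mul_sq (b := 1 / 2) (by norm_num) (s := k)
    (by have : (0 : ℝ) ≤ k := by positivity
        linarith)
  refine h.congr (ae_of_all _ fun u => ?_)
  simp only [Real.rpow_natCast]
  congr 2; ring

lemma integrable_gaussDominating :
    Integrable (fun u : ℝ => (1 + u) ^ 4 * Real.exp (-u ^ 2 / 2)) := by
  have := (((((integrable_pow_mul_exp_neg_sq 0)).add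
    ((integrable_pow_mul_exp_neg_sq 1).const_mul 4)).add
    ((integrable_pow_mul_exp_neg_sq 2).const_mul 6)).add
    ((integrable_pow_mul_exp_neg_sq 3).const_mul 4)).add (integrable_pow_mul_exp_neg_sq 4)
  refine this.congr (ae_of_all _ fun u => ?_)
  simp only [Pi.add_apply]; ring

/-- The constant `∫_0^∞ (1 + u)^4 e^{-u²/2} du`. -/
noncomputable def gaussConst : ℝ := ∫ u in Set.Ioi (0 : ℝ), (1 + u) ^ 4 * Real.exp (-u ^ 2 / 2)

lemma gaussConst_nonneg : 0 ≤ gaussConst :=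
  setIntegral_nonneg measurableSet_Ioi fun u hu => by positivity

lemma integrableOn_of_le_gaussDominating {g : ℝ → ℝ} (hg : Continuous g) {M : ℝ}
    (h : ∀ u, 0 < u → |g u| ≤ M * ((1 + u) ^ 4 * Real.exp (-u ^ 2 / 2))) :
    IntegrableOn g (Set.Ioi 0) := by
  refine (integrable_gaussDominating.const_mul M).integrableOn.mono' hg.aestronglyMeasurable ?_
  filter_upwards [ae_restrict_mem measurableSet_Ioi] with u hu
  exact h u hu

lemma abs_setIntegral_le_gaussConst {g : ℝ → ℝ} {M : ℝ}
    (h : ∀ u, 0 < u → |g u| ≤ M * ((1 + u) ^ 4 * Real.exp (-u ^ 2 / 2))) :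
    |∫ u in Set.Ioi (0 : ℝ), g u| ≤ M * gaussConst := by
  rw [gaussConst, ← integral_const_mul, ← Real.norm_eq_abs]
  apply norm_integral_le_of_norm_le ((integrable_gaussDominating.const_mul M).integrableOn)
  filter_upwards [ae_restrict_mem measurableSet_Ioi] with u hu
  exact h u hu

lemma integrable_mul_exp_neg_sq {H : ℝ → ℝ} (hH : Continuous H) {M : ℝ}
    (hM : ∀ x, |H x| ≤ M * (1 + x ^ 2)) : Integrable (fun t => H t * Real.exp (-t ^ 2 / 2)) := by
  have := ((integrable_pow_mul_exp_neg_sq 0).add (integrable_pow_mul_exp_neg_sq 2)).const_mul M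
  refine this.mono' (by fun_prop) (ae_of_all _ fun t => ?_)
  rw [Real.norm_eq_abs, abs_mul, Real.abs_exp]
  simp only [Pi.add_apply, pow_zero]
  calc |H t| * Real.exp (-t ^ 2 / 2) ≤ M * (1 + t ^ 2) * Real.exp (-t ^ 2 / 2) := by
        gcongr; exact hM t
    _ = _ := by ring

lemma integrable_of_le_sq {H : ℝ → ℝ} (hH : Continuous H) {M : ℝ}
    (hM : ∀ x, |H x| ≤ M * (1 + x ^ 2)) : Integrable H (gaussianReal 0 1) := by
  have h2 : Integrable (fun x : ℝ => x ^ 2) (gaussianReal 0 1) :=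
    (memLp_id_gaussianReal 2).integrable_sq
  exact (((integrable_const (1 : ℝ)).add h2).const_mul M).mono' (by fun_prop)
    (ae_of_all _ fun t => hM t)

lemma integral_gaussianReal_eq (H : ℝ → ℝ) : ∫ x, H x ∂(gaussianReal 0 1)
    = (√(2 * Real.pi))⁻¹ * ∫ t, H t * Real.exp (-t ^ 2 / 2) := by
  rw [integral_gaussianReal_eq_integral_smul (by norm_num), ← integral_const_mul]
  congr 1; ext x
  simp only [gaussianPDFReal, smul_eq_mul, NNReal.coe_one, mul_one, sub_zero]
  ring

lemma integral_exp_neg_sq_eq_zero {H : ℝ → ℝ} (h0 : ∫ x, H x ∂(gaussianReal 0 1) = 0) :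
    ∫ t, H t * Real.exp (-t ^ 2 / 2) = 0 := by
  rw [integral_gaussianReal_eq] at h0
  have : (√(2 * Real.pi))⁻¹ ≠ 0 := by
    have := Real.pi_pos
    positivity
  exact (mul_eq_zero.mp h0).resolve_left this

/-! ### The solution of Stein's equation -/

/-- The bounded solution of `f' x - x * f x = H x` for `H` centred under the Gaussian law. -/
noncomputable def steinSol (H : ℝ → ℝ) (x : ℝ) : ℝ :=
  -(Real.exp (x ^ 2 / 2) * ∫ t in Set.Ioi x, H t * Real.exp (-t ^ 2 / 2))

lemma hasDerivAt_steinSol {H : ℝ → ℝ} (hH : Continuous H) {M : ℝ}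
    (hM : ∀ x, |H x| ≤ M * (1 + x ^ 2)) (x : ℝ) :
    HasDerivAt (steinSol H) (x * steinSol H x + H x) x := by
  set k : ℝ → ℝ := fun t => H t * Real.exp (-t ^ 2 / 2) with hk
  have hkc : Continuous k := by fun_prop
  have hki : Integrable k := integrable_mul_exp_neg_sq hH hM
  have e : (fun y => ∫ t in Set.Ioi y, k t)
      = fun y => (∫ t in Set.Ioi (0 : ℝ), k t) - ∫ t in (0 : ℝ)..y, k t := by
    ext y
    rcases le_total 0 y with h | h
    · rw [← intervalIntegral.integral_Ioi_sub_Ioi hki.integrableOn h]; ring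
    · rw [intervalIntegral.integral_symm,
        ← intervalIntegral.integral_Ioi_sub_Ioi hki.integrableOn h]; ring
  have h1 : HasDerivAt (fun y => ∫ t in Set.Ioi y, k t) (-k x) x := by
    rw [e]
    have := intervalIntegral.integral_hasDerivAt_right (hkc.intervalIntegrable 0 x)
      (hkc.stronglyMeasurableAtFilter _ _) hkc.continuousAt
    simpa using this.const_sub (∫ t in Set.Ioi (0 : ℝ), k t)
  have h2 : HasDerivAt (fun y : ℝ => Real.exp (y ^ 2 / 2)) (Real.exp (x ^ 2 / 2) * x) x := by
    have : HasDerivAt (fun y : ℝ => y ^ 2 / 2) x x := by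
      simpa using (hasDerivAt_pow 2 x).div_const 2
    exact this.exp
  have h3 : HasDerivAt (steinSol H) _ x := (h2.mul h1).neg
  refine h3.congr_deriv ?_
  have : Real.exp (x ^ 2 / 2) * Real.exp (-x ^ 2 / 2) = 1 := by
    rw [← Real.exp_add, show x ^ 2 / 2 + -x ^ 2 / 2 = 0 by ring, Real.exp_zero]
  unfold steinSol
  simp only [hk]
  linear_combination (H x) * this

/-- The shift t = x + u absorbs exp(x²/2). For x ≥ 0 the remaining kernel is at most exp(-u²/2), so
estimates are made on this half-line and then reflected. -/
lemma steinSol_eq {H : ℝ → ℝ} (x : ℝ) :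
    steinSol H x = -∫ u in Set.Ioi (0 : ℝ), H (x + u) * Real.exp (-(x * u) - u ^ 2 / 2) := by
  have hshift : ∫ t in Set.Ioi x, H t * Real.exp (-t ^ 2 / 2)
      = ∫ u in Set.Ioi (0 : ℝ), H (x + u) * Real.exp (-(x + u) ^ 2 / 2) := by
    have h := (measurePreserving_add_left (volume : Measure ℝ) x).setIntegral_preimage_emb
      (measurableEmbedding_addLeft x) (fun t => H t * Real.exp (-t ^ 2 / 2)) (Set.Ioi x)
    rw [← h]
    congr 2
    ext u; simp
  unfold steinSol
  rw [hshift, ← integral_const_mul]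
  congr 2
  ext u
  have : Real.exp (-(x * u) - u ^ 2 / 2)
      = Real.exp (x ^ 2 / 2) * Real.exp (-(x + u) ^ 2 / 2) := by
    rw [← Real.exp_add]; congr 1; ring
  rw [this]; ring

/-- Centring makes the right tail integral the negative of the left one, and reflection exchanges
the two. -/
lemma steinSol_neg {H : ℝ → ℝ} (hH : Continuous H) {M : ℝ}
    (hM : ∀ x, |H x| ≤ M * (1 + x ^ 2)) (h0 : ∫ x, H x ∂(gaussianReal 0 1) = 0) (x : ℝ) :
    steinSol H (-x) = -steinSol (fun y => H (-y)) x := by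
  have hki := integrable_mul_exp_neg_sq hH hM
  have h1 : ∫ t in Set.Ioi x, H (-t) * Real.exp (-t ^ 2 / 2)
      = ∫ t in Set.Iic (-x), H t * Real.exp (-t ^ 2 / 2) := by
    rw [← integral_comp_neg_Ioi]
    simp
  have h2 := intervalIntegral.integral_Iic_add_Ioi (b := -x) hki.integrableOn hki.integrableOn
  rw [integral_exp_neg_sq_eq_zero h0] at h2
  unfold steinSol
  rw [h1, neg_sq]
  have : ∫ t in Set.Ioi (-x), H t * Real.exp (-t ^ 2 / 2)
      = -∫ t in Set.Iic (-x), H t * Real.exp (-t ^ 2 / 2) := by linarith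
  rw [this]; ring

/-- For a standard normal N, -H(0) = E[H(N) - H(0)], and the 2 is E(1 + N²). -/
lemma abs_zero_le_of_centred {H : ℝ → ℝ} (hH : Continuous H) {M : ℝ}
    (hM : ∀ x, |H x - H 0| ≤ M * (1 + x ^ 2)) (h0 : ∫ x, H x ∂(gaussianReal 0 1) = 0) :
    |H 0| ≤ M * 2 := by
  have h2 : Integrable (fun x : ℝ => x ^ 2) (gaussianReal 0 1) :=
    (memLp_id_gaussianReal 2).integrable_sq
  have hi : Integrable (fun x => H x - H 0) (gaussianReal 0 1) :=
    integrable_of_le_sq (by fun_prop) hM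
  have hHi : Integrable H (gaussianReal 0 1) := by
    exact (hi.add (integrable_const (H 0))).congr (ae_of_all _ fun x => by simp)
  have e : ∫ x, (H x - H 0) ∂(gaussianReal 0 1) = -H 0 := by
    rw [integral_sub hHi (integrable_const _), h0]; simp
  have hsq : ∫ x : ℝ, x ^ 2 ∂(gaussianReal 0 1) = 1 := by
    have := variance_id_gaussianReal (μ := 0) (v := 1)
    rw [variance_eq_integral (by fun_prop)] at this
    simpa using this
  calc |H 0| = |∫ x, (H x - H 0) ∂(gaussianReal 0 1)| := by rw [e, abs_neg]
    _ ≤ ∫ x, M * (1 + x ^ 2) ∂(gaussianReal 0 1) := by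
        rw [← Real.norm_eq_abs]
        exact norm_integral_le_of_norm_le
          (((integrable_const (1 : ℝ)).add h2).const_mul M) (ae_of_all _ fun t => hM t)
    _ = M * 2 := by
        rw [integral_const_mul, integral_add (integrable_const _) h2, hsq]
        simp; norm_num

/-! ### The polar change of variables on a half-line -/

lemma integrableOn_sqrt_mul_exp_neg {H : ℝ → ℝ} (hH : Continuous H) {M : ℝ}
    (hM : ∀ x, |H x| ≤ M * (1 + x ^ 2)) (x : ℝ) :
    IntegrableOn (fun e => H (√(x ^ 2 + 2 * e)) * Real.exp (-e)) (Set.Ici 0) := by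
  rw [integrableOn_Ici_iff_integrableOn_Ioi]
  have h1 := Real.GammaIntegral_convergent (s := 1) one_pos
  have h2 := Real.GammaIntegral_convergent (s := 2) two_pos
  have h3 := (h1.const_mul (M * (1 + x ^ 2))).add (h2.const_mul (M * 2))
  refine h3.mono' (by fun_prop) ?_
  filter_upwards [ae_restrict_mem measurableSet_Ioi] with e he
  have he' : (0 : ℝ) < e := he
  rw [Real.norm_eq_abs, abs_mul, Real.abs_exp]
  have hs : √(x ^ 2 + 2 * e) ^ 2 = x ^ 2 + 2 * e := Real.sq_sqrt (by positivity)
  have := hM (√(x ^ 2 + 2 * e))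
  rw [hs] at this
  simp only [Pi.add_apply, sub_self, Real.rpow_zero]
  rw [show (2 : ℝ) - 1 = 1 by norm_num, Real.rpow_one]
  calc |H (√(x ^ 2 + 2 * e))| * Real.exp (-e) ≤ (M * (1 + (x ^ 2 + 2 * e))) * Real.exp (-e) := by
        gcongr
    _ = _ := by ring

lemma abs_le_of_le_sq_shift {H : ℝ → ℝ} {M : ℝ} (hM : ∀ x, |H x| ≤ M * (1 + x ^ 2)) {x u : ℝ}
    (hx : 0 ≤ x) (hu : 0 < u) : |H (x + u)| ≤ M * (1 + x) ^ 2 * (1 + u) ^ 2 := by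
  have hM0 : 0 ≤ M := by have := (abs_nonneg _).trans (hM 0); simpa using this
  refine (hM (x + u)).trans ?_
  rw [mul_assoc]
  gcongr
  have : 0 ≤ x * u := by positivity
  nlinarith [mul_nonneg this this, mul_nonneg hx this, mul_nonneg hu.le this]

lemma integrableOn_pow_mul_shift {H : ℝ → ℝ} (hH : Continuous H) {M : ℝ}
    (hM : ∀ x, |H x| ≤ M * (1 + x ^ 2)) {x : ℝ} (hx : 0 ≤ x) {k : ℕ} (hk : k ≤ 2) :
    IntegrableOn (fun u => u ^ k * (H (x + u) * Real.exp (-(x * u) - u ^ 2 / 2)))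
      (Set.Ioi 0) := by
  have hM0 : 0 ≤ M := by have := (abs_nonneg _).trans (hM 0); simpa using this
  apply integrableOn_of_le_gaussDominating (M := M * (1 + x) ^ 2) (by fun_prop)
  intro u hu
  rw [abs_mul, abs_mul, Real.abs_exp, abs_of_pos (by positivity : 0 < u ^ k)]
  have h1 : u ^ k ≤ (1 + u) ^ 2 :=
    (pow_le_pow_left₀ hu.le (by linarith) k).trans (pow_le_pow_right₀ (by linarith) hk)
  calc u ^ k * (|H (x + u)| * Real.exp (-(x * u) - u ^ 2 / 2))
      ≤ (1 + u) ^ 2 * ((M * (1 + x) ^ 2 * (1 + u) ^ 2) * Real.exp (-u ^ 2 / 2)) := by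
        gcongr
        · exact abs_le_of_le_sq_shift hM hx hu
        · have : 0 ≤ x * u := by positivity
          linarith
    _ = _ := by ring

/-- Substitute e = x u + u²/2, for which x + u = √(x² + 2e). The weight x + u is the Jacobian, and
what remains is the mean of H(√(x² + 2e)) under the standard exponential law. -/
lemma integral_shift_eq_sqrt {H : ℝ → ℝ} (hH : Continuous H) {M : ℝ}
    (hM : ∀ x, |H x| ≤ M * (1 + x ^ 2)) {x : ℝ} (hx : 0 ≤ x) :
    ∫ u in Set.Ioi (0 : ℝ), (x + u) * (H (x + u) * Real.exp (-(x * u) - u ^ 2 / 2))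
      = ∫ e in Set.Ioi (0 : ℝ), H (√(x ^ 2 + 2 * e)) * Real.exp (-e) := by
  set φ : ℝ → ℝ := fun u => x * u + u ^ 2 / 2 with hφ
  set g : ℝ → ℝ := fun e => H (√(x ^ 2 + 2 * e)) * Real.exp (-e) with hg
  have himg : φ '' Set.Ici 0 ⊆ Set.Ici 0 := by
    rintro _ ⟨u, hu, rfl⟩
    have : (0 : ℝ) ≤ u := hu
    simp only [hφ, Set.mem_Ici]; positivity
  have hcomp : ∀ u : ℝ, 0 ≤ u → g (φ u) * (x + u)
      = (x + u) * (H (x + u) * Real.exp (-(x * u) - u ^ 2 / 2)) := by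
    intro u hu
    simp only [hg, hφ]
    have : √(x ^ 2 + 2 * (x * u + u ^ 2 / 2)) = x + u := by
      rw [show x ^ 2 + 2 * (x * u + u ^ 2 / 2) = (x + u) ^ 2 by ring,
        Real.sqrt_sq (by positivity)]
    rw [this, show -(x * u + u ^ 2 / 2) = -(x * u) - u ^ 2 / 2 by ring]; ring
  have hint : IntegrableOn (fun u => (x + u) * (H (x + u) * Real.exp (-(x * u) - u ^ 2 / 2)))
      (Set.Ioi 0) := by
    have h0 := (integrableOn_pow_mul_shift hH hM hx (k := 0) (by norm_num)).const_mul x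
    have h1 := integrableOn_pow_mul_shift hH hM hx (k := 1) (by norm_num)
    refine (h0.add h1).congr (ae_of_all _ fun u => ?_)
    simp only [Pi.add_apply]; ring
  have key := integral_comp_mul_deriv_Ioi (f := φ) (f' := fun u => x + u) (g := g) (a := 0)
    (by fun_prop) ?_ ?_ (by fun_prop)
    ((integrableOn_sqrt_mul_exp_neg hH hM x).mono_set himg) ?_
  · have h00 : φ 0 = 0 := by simp [hφ]
    rw [h00] at key
    rw [← key]
    apply setIntegral_congr_fun measurableSet_Ioi
    intro u hu
    exact (hcomp u (le_of_lt hu)).symm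
  · apply Filter.tendsto_atTop_mono' _ _
      ((Filter.tendsto_pow_atTop (α := ℝ) (n := 2) (by norm_num)).atTop_div_const
        (by norm_num : (0 : ℝ) < 2))
    filter_upwards [Filter.eventually_ge_atTop (0 : ℝ)] with u hu
    have : 0 ≤ x * u := by positivity
    simp only [hφ]; linarith
  · intro u _
    have h1 : HasDerivAt φ (x * 1 + (2 : ℕ) * u ^ (2 - 1) / 2) u :=
      ((hasDerivAt_id u).const_mul x).add ((hasDerivAt_pow 2 u).div_const 2)
    refine (h1.congr_deriv ?_).hasDerivWithinAt
    norm_num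
  · rw [integrableOn_Ici_iff_integrableOn_Ioi]
    refine hint.congr_fun (fun u hu => (hcomp u (le_of_lt hu)).symm) measurableSet_Ioi

/-! ### Regularity of Stein solutions for Hölder data -/

/-- `H` is `s`-Hölder on the real line with constant `L`. -/
def RealHolder (s L : ℝ) (H : ℝ → ℝ) : Prop := ∀ x y : ℝ, |H x - H y| ≤ L * |x - y| ^ s

lemma RealHolder.nonneg {s L : ℝ} {H : ℝ → ℝ} (h : RealHolder s L H) : 0 ≤ L := by
  have := (abs_nonneg _).trans (h 1 0)
  simpa using this

lemma RealHolder.comp_neg {s L : ℝ} {H : ℝ → ℝ} (h : RealHolder s L H) :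
    RealHolder s L (fun x => H (-x)) := by
  intro x y
  refine (h (-x) (-y)).trans_eq ?_
  rw [show -x - -y = -(x - y) by ring, abs_neg]

/-- Hölder bounds on the two half-lines combine to a bound on the line. -/
lemma realHolder_of_half_lines {s C : ℝ} {g : ℝ → ℝ} (hs : 0 < s) (hC : 0 ≤ C)
    (pos : ∀ x y, 0 ≤ y → y ≤ x → |g x - g y| ≤ C * (x - y) ^ s)
    (neg : ∀ x y, 0 ≤ y → y ≤ x → |g (-x) - g (-y)| ≤ C * (x - y) ^ s) :
    RealHolder s (2 * C) g := by
  have main : ∀ x y, y ≤ x → |g x - g y| ≤ (2 * C) * (x - y) ^ s := by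
    intro x y hxy
    have hd : 0 ≤ (x - y) ^ s := Real.rpow_nonneg (by linarith) s
    rcases le_total 0 y with hy | hy
    · exact (pos x y hy hxy).trans (by nlinarith [mul_nonneg hC hd])
    · rcases le_total 0 x with hx | hx
      · have h1 := pos x 0 le_rfl hx
        have h2 := neg (-y) 0 le_rfl (by linarith)
        rw [neg_neg, neg_zero, sub_zero] at h2
        rw [sub_zero] at h1
        have h3 : x ^ s ≤ (x - y) ^ s := Real.rpow_le_rpow hx (by linarith) hs.le
        have h4 : (-y) ^ s ≤ (x - y) ^ s := Real.rpow_le_rpow (by linarith) (by linarith) hs.le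
        have h5 : |g x - g y| ≤ |g x - g 0| + |g y - g 0| := by
          have := abs_sub (g x - g 0) (g y - g 0)
          simpa using this
        nlinarith [mul_le_mul_of_nonneg_left h3 hC, mul_le_mul_of_nonneg_left h4 hC]
      · have h2 := neg (-y) (-x) (by linarith) (by linarith)
        rw [neg_neg, neg_neg, abs_sub_comm, show -y - -x = x - y by ring] at h2
        exact h2.trans (by nlinarith [mul_nonneg hC hd])
  intro x y
  rcases le_total y x with hxy | hxy
  · rw [abs_of_nonneg (by linarith : 0 ≤ x - y)]; exact main x y hxy
  · rw [abs_sub_comm, abs_sub_comm x y, abs_of_nonneg (by linarith : 0 ≤ y - x)]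
    exact main y x hxy

section
variable {s L : ℝ} {H : ℝ → ℝ}

lemma RealHolder.sub_zero_le (h : RealHolder s L H) (hs : 0 < s) (hs1 : s ≤ 1) (x : ℝ) :
    |H x - H 0| ≤ (2 * L) * (1 + x ^ 2) := by
  have hL := h.nonneg
  refine (h x 0).trans ?_
  rw [sub_zero, mul_comm 2 L, mul_assoc]
  gcongr
  refine (rpow_le_one_add (abs_nonneg x) hs.le hs1).trans ?_
  rw [← sq_abs x]
  nlinarith [sq_nonneg (|x| - 1)]

lemma RealHolder.abs_le (h : RealHolder s L H) (hH : Continuous H) (hs : 0 < s) (hs1 : s ≤ 1)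
    (h0 : ∫ x, H x ∂(gaussianReal 0 1) = 0) (x : ℝ) : |H x| ≤ L * (4 + |x| ^ s) := by
  have h1 := abs_zero_le_of_centred hH (h.sub_zero_le hs hs1) h0
  have h2 := h x 0
  rw [sub_zero] at h2
  have h3 : |H x| ≤ |H x - H 0| + |H 0| := by
    have := abs_add_le (H x - H 0) (H 0); simpa using this
  linarith

lemma RealHolder.abs_le_sq (h : RealHolder s L H) (hH : Continuous H) (hs : 0 < s) (hs1 : s ≤ 1)
    (h0 : ∫ x, H x ∂(gaussianReal 0 1) = 0) (x : ℝ) : |H x| ≤ (6 * L) * (1 + x ^ 2) := by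
  have h1 := abs_zero_le_of_centred hH (h.sub_zero_le hs hs1) h0
  have h2 := h.sub_zero_le hs hs1 x
  have h3 : |H x| ≤ |H x - H 0| + |H 0| := by
    have := abs_add_le (H x - H 0) (H 0); simpa using this
  have : 0 ≤ L * x ^ 2 := mul_nonneg h.nonneg (sq_nonneg x)
  linarith

/-- Decomposition of the derivative of the Stein solution on the positive half-line. -/
lemma steinSol_deriv_eq (hH : Continuous H) {M : ℝ} (hM : ∀ x, |H x| ≤ M * (1 + x ^ 2)) {x : ℝ}
    (hx : 0 ≤ x) : x * steinSol H x + H x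
      = H x - (∫ e in Set.Ioi (0 : ℝ), H (√(x ^ 2 + 2 * e)) * Real.exp (-e))
        + ∫ u in Set.Ioi (0 : ℝ), u * (H (x + u) * Real.exp (-(x * u) - u ^ 2 / 2)) := by
  rw [← integral_shift_eq_sqrt hH hM hx, steinSol_eq]
  have h0 := (integrableOn_pow_mul_shift hH hM hx (k := 0) (by norm_num))
  have h1 := integrableOn_pow_mul_shift hH hM hx (k := 1) (by norm_num)
  simp only [pow_zero, one_mul, pow_one] at h0 h1
  -- Splitting x = (x + u) - u isolates the exponential average. The weight u in the other part
  -- tames the growth of H.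
  have e : ∀ u, (x + u) * (H (x + u) * Real.exp (-(x * u) - u ^ 2 / 2))
      = x * (H (x + u) * Real.exp (-(x * u) - u ^ 2 / 2))
        + u * (H (x + u) * Real.exp (-(x * u) - u ^ 2 / 2)) := fun u => by ring
  simp only [e]
  rw [integral_add (h0.const_mul x) h1, integral_const_mul]
  ring

/-- The growth x^s of H is paid for by (x u)^s exp(-x u) ≤ 1. Only powers of u remain, which makes
the bounds uniform in x. -/
lemma mul_holder_growth_le (hs : 0 < s) (hs1 : s ≤ 1) {x u : ℝ} (hx : 0 ≤ x) (hu : 0 < u) :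
    (4 + (x + u) ^ s) * Real.exp (-(x * u)) * u ≤ 5 * (1 + u) ^ 2 ∧
    (4 + (x + u) ^ s) * Real.exp (-(x * u)) * (u * u ^ s) ≤ 5 * (1 + u) ^ 4 := by
  have hxu : 0 ≤ x * u := by positivity
  have h1 : (x + u) ^ s ≤ x ^ s + u ^ s := Real.rpow_add_le_add_rpow hx hu.le hs.le hs1
  have h2 : (x * u) ^ s * Real.exp (-(x * u)) ≤ 1 := rpow_mul_exp_neg_le_one hxu hs.le hs1
  rw [Real.mul_rpow hx hu.le] at h2
  have h3 : Real.exp (-(x * u)) ≤ 1 := Real.exp_le_one_iff.mpr (by linarith)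
  have h4 : u ^ s ≤ 1 + u := rpow_le_one_add hu.le hs.le hs1
  have h5 : u ^ (1 - s) ≤ 1 + u := rpow_le_one_add hu.le (by linarith) (by linarith)
  have e5 : u = u ^ s * u ^ (1 - s) := by
    rw [← Real.rpow_add hu]; simp
  have hE := Real.exp_pos (-(x * u))
  have hus : 0 ≤ u ^ s := by positivity
  have hA : (4 + (x + u) ^ s) * Real.exp (-(x * u)) * u ≤ 4 * u + (1 + u) + (1 + u) * u := by
    calc (4 + (x + u) ^ s) * Real.exp (-(x * u)) * u
        ≤ (4 + (x ^ s + u ^ s)) * Real.exp (-(x * u)) * u := by gcongr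
      _ = (4 * u) * Real.exp (-(x * u)) + x ^ s * Real.exp (-(x * u)) * u
            + u ^ s * u * Real.exp (-(x * u)) := by ring
      _ = (4 * u) * Real.exp (-(x * u)) + (x ^ s * u ^ s * Real.exp (-(x * u))) * u ^ (1 - s)
            + u ^ s * u * Real.exp (-(x * u)) := by
          congr 2
          nth_rw 2 [e5]; ring
      _ ≤ 4 * u * 1 + 1 * (1 + u) + (1 + u) * u * 1 := by gcongr
      _ = _ := by ring
  have hB : (4 + (x + u) ^ s) * Real.exp (-(x * u)) * u ^ s ≤ 4 * (1 + u) + 1 + (1 + u) ^ 2 := by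
    calc (4 + (x + u) ^ s) * Real.exp (-(x * u)) * u ^ s
        ≤ (4 + (x ^ s + u ^ s)) * Real.exp (-(x * u)) * u ^ s := by gcongr
      _ = (4 * u ^ s) * Real.exp (-(x * u)) + x ^ s * u ^ s * Real.exp (-(x * u))
            + (u ^ s) ^ 2 * Real.exp (-(x * u)) := by ring
      _ ≤ 4 * (1 + u) * 1 + 1 + (1 + u) ^ 2 * 1 := by gcongr
      _ = _ := by ring
  constructor
  · nlinarith
  · calc _ = ((4 + (x + u) ^ s) * Real.exp (-(x * u)) * u ^ s) * u := by ring
      _ ≤ (4 * (1 + u) + 1 + (1 + u) ^ 2) * u := by gcongr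
      _ ≤ _ := by
        have : 0 < u ^ 2 := by positivity
        have : 0 < u ^ 3 := by positivity
        have : 0 < u ^ 4 := by positivity
        nlinarith

/-- The square root is the Euclidean norm of (x, √(2e)), so this is the reverse triangle inequality.
-/
lemma abs_sqrt_sub_sqrt_le {x y e : ℝ} (hy : 0 ≤ y) (hxy : y ≤ x) (he : 0 ≤ e) :
    |√(x ^ 2 + 2 * e) - √(y ^ 2 + 2 * e)| ≤ x - y := by
  have hx : 0 ≤ x := hy.trans hxy
  set a := √(x ^ 2 + 2 * e)
  set b := √(y ^ 2 + 2 * e)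
  have ha2 : a ^ 2 = x ^ 2 + 2 * e := Real.sq_sqrt (by positivity)
  have hb2 : b ^ 2 = y ^ 2 + 2 * e := Real.sq_sqrt (by positivity)
  have hab : b ≤ a := Real.sqrt_le_sqrt (by gcongr)
  have hax : x ≤ a := Real.le_sqrt_of_sq_le (by linarith)
  have hby : y ≤ b := Real.le_sqrt_of_sq_le (by linarith)
  rw [abs_of_nonneg (by linarith)]
  by_contra hcon
  push Not at hcon
  have : (a - b) * (a + b) = (x - y) * (x + y) := by ring_nf; linarith
  rcases eq_or_lt_of_le hx with h0 | h0
  · have : y = 0 := by linarith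
    subst this; subst h0
    simp [a, b] at hcon
  · nlinarith

lemma integrableOn_one_add_exp :
    IntegrableOn (fun e : ℝ => (2 + 2 * e) * Real.exp (-e)) (Set.Ioi 0) := by
  have h1 := Real.GammaIntegral_convergent (s := 1) one_pos
  have h2 := Real.GammaIntegral_convergent (s := 2) two_pos
  have h3 := (h1.const_mul 2).add (h2.const_mul 2)
  refine Integrable.congr h3 (ae_of_all _ fun e => ?_)
  simp only [Pi.add_apply, sub_self, Real.rpow_zero]
  rw [show (2 : ℝ) - 1 = 1 by norm_num, Real.rpow_one]
  ring

lemma integrableOn_exp_neg : IntegrableOn (fun e : ℝ => Real.exp (-e)) (Set.Ioi 0) := by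
  have h1 := Real.GammaIntegral_convergent (s := 1) one_pos
  simpa using h1

/-- The constant `∫_0^∞ (2 + 2 e) exp (-e) de`. -/
noncomputable def expConst : ℝ := ∫ e in Set.Ioi (0 : ℝ), (2 + 2 * e) * Real.exp (-e)

lemma expConst_nonneg : 0 ≤ expConst :=
  setIntegral_nonneg measurableSet_Ioi fun u hu => by
    have : (0 : ℝ) < u := hu
    positivity

/-- H itself may be unbounded, but the exponential law has mass one. Thus H(x) minus its exponential
average is a mean of increments over distances at most 1 + 2e, uniformly in x ≥ 0. -/
lemma abs_steinSol_deriv_le_of_nonneg (h : RealHolder s L H) (hH : Continuous H) (hs : 0 < s)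
    (hs1 : s ≤ 1) (h0 : ∫ x, H x ∂(gaussianReal 0 1) = 0) {x : ℝ} (hx : 0 ≤ x) :
    |x * steinSol H x + H x| ≤ (expConst + 5 * gaussConst) * L := by
  have hL := h.nonneg
  have hM := h.abs_le_sq hH hs hs1 h0
  rw [steinSol_deriv_eq hH hM hx]
  have b1 : |H x - ∫ e in Set.Ioi (0 : ℝ), H (√(x ^ 2 + 2 * e)) * Real.exp (-e)|
      ≤ expConst * L := by
    have e1 : H x = ∫ e in Set.Ioi (0 : ℝ), H x * Real.exp (-e) := by
      rw [integral_const_mul, integral_exp_neg_Ioi_zero, mul_one]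
    have hi := (integrableOn_sqrt_mul_exp_neg hH hM x).mono_set Set.Ioi_subset_Ici_self
    rw [e1, ← integral_sub (integrableOn_exp_neg.const_mul _) hi, mul_comm, expConst,
      ← integral_const_mul, ← Real.norm_eq_abs]
    apply norm_integral_le_of_norm_le (integrableOn_one_add_exp.const_mul L)
    filter_upwards [ae_restrict_mem measurableSet_Ioi] with e he
    have he' : (0 : ℝ) < e := he
    rw [← sub_mul, Real.norm_eq_abs, abs_mul, Real.abs_exp, ← mul_assoc]
    gcongr
    refine (h _ _).trans ?_
    gcongr
    have ha : x ≤ √(x ^ 2 + 2 * e) := Real.le_sqrt_of_sq_le (by linarith)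
    have hb : |x - √(x ^ 2 + 2 * e)| ≤ 1 + 2 * e := by
      rw [abs_sub_comm, abs_of_nonneg (by linarith)]
      have : √(x ^ 2 + 2 * e) ≤ x + (1 + 2 * e) := by
        apply Real.sqrt_le_iff.mpr
        constructor
        · positivity
        · nlinarith [mul_nonneg hx he'.le]
      linarith
    refine (rpow_le_one_add (abs_nonneg _) hs.le hs1).trans ?_
    linarith
  have b2 : |∫ u in Set.Ioi (0 : ℝ), u * (H (x + u) * Real.exp (-(x * u) - u ^ 2 / 2))|
      ≤ (5 * L) * gaussConst := by
    apply abs_setIntegral_le_gaussConst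
    intro u hu
    have h1 := (mul_holder_growth_le hs hs1 hx hu).1
    have h2 := h.abs_le hH hs hs1 h0 (x + u)
    rw [abs_of_nonneg (by positivity : 0 ≤ x + u)] at h2
    rw [abs_mul, abs_mul, Real.abs_exp, abs_of_pos hu]
    have e : Real.exp (-(x * u) - u ^ 2 / 2) = Real.exp (-(x * u)) * Real.exp (-u ^ 2 / 2) := by
      rw [← Real.exp_add]; congr 1; ring
    rw [e]
    calc u * (|H (x + u)| * (Real.exp (-(x * u)) * Real.exp (-u ^ 2 / 2)))
        ≤ u * ((L * (4 + (x + u) ^ s)) * (Real.exp (-(x * u)) * Real.exp (-u ^ 2 / 2))) := by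
          gcongr
      _ = L * (((4 + (x + u) ^ s) * Real.exp (-(x * u)) * u) * Real.exp (-u ^ 2 / 2)) := by ring
      _ ≤ L * ((5 * (1 + u) ^ 2) * Real.exp (-u ^ 2 / 2)) := by gcongr
      _ ≤ L * ((5 * (1 + u) ^ 4) * Real.exp (-u ^ 2 / 2)) := by
          gcongr
          · linarith
          · norm_num
      _ = _ := by ring
  exact (abs_add_le _ _).trans (by linarith)

/-- The exponential average inherits the modulus of H because x ↦ √(x² + 2e) is 1-Lipschitz on the
half-line. In the u-weighted integral, the change of the kernel over d = x - y is controlled by 1 -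
exp(-d u) ≤ (d u)^s. -/
lemma abs_steinSol_deriv_sub_le_of_nonneg (h : RealHolder s L H) (hH : Continuous H)
    (hs : 0 < s) (hs1 : s ≤ 1) (h0 : ∫ x, H x ∂(gaussianReal 0 1) = 0) {x y : ℝ} (hy : 0 ≤ y)
    (hxy : y ≤ x) :
    |(x * steinSol H x + H x) - (y * steinSol H y + H y)|
      ≤ ((2 + 6 * gaussConst) * L) * (x - y) ^ s := by
  have hL := h.nonneg
  have hx : 0 ≤ x := hy.trans hxy
  have hM := h.abs_le_sq hH hs hs1 h0
  rw [steinSol_deriv_eq hH hM hx, steinSol_deriv_eq hH hM hy]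
  have hd : 0 ≤ x - y := by linarith
  set d := x - y with hd_def
  have hds : 0 ≤ d ^ s := by positivity
  have b0 : |H x - H y| ≤ L * d ^ s := by
    have := h x y; rwa [← hd_def, abs_of_nonneg hd] at this
  have b1 : |(∫ e in Set.Ioi (0 : ℝ), H (√(x ^ 2 + 2 * e)) * Real.exp (-e))
      - ∫ e in Set.Ioi (0 : ℝ), H (√(y ^ 2 + 2 * e)) * Real.exp (-e)| ≤ L * d ^ s := by
    have hix := (integrableOn_sqrt_mul_exp_neg hH hM x).mono_set Set.Ioi_subset_Ici_self
    have hiy := (integrableOn_sqrt_mul_exp_neg hH hM y).mono_set Set.Ioi_subset_Ici_self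
    have e1 : L * d ^ s = ∫ e in Set.Ioi (0 : ℝ), (L * d ^ s) * Real.exp (-e) := by
      rw [integral_const_mul, integral_exp_neg_Ioi_zero, mul_one]
    rw [e1, ← integral_sub hix hiy, ← Real.norm_eq_abs]
    apply norm_integral_le_of_norm_le (integrableOn_exp_neg.const_mul _)
    filter_upwards [ae_restrict_mem measurableSet_Ioi] with e he
    have he' : (0 : ℝ) < e := he
    rw [← sub_mul, Real.norm_eq_abs, abs_mul, Real.abs_exp]
    gcongr
    refine (h _ _).trans ?_
    gcongr
    exact abs_sqrt_sub_sqrt_le hy hxy he'.le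
  have b2 : |(∫ u in Set.Ioi (0 : ℝ), u * (H (x + u) * Real.exp (-(x * u) - u ^ 2 / 2)))
      - ∫ u in Set.Ioi (0 : ℝ), u * (H (y + u) * Real.exp (-(y * u) - u ^ 2 / 2))|
      ≤ (6 * L * d ^ s) * gaussConst := by
    have hix := integrableOn_pow_mul_shift hH hM hx (k := 1) (by norm_num)
    have hiy := integrableOn_pow_mul_shift hH hM hy (k := 1) (by norm_num)
    simp only [pow_one] at hix hiy
    rw [← integral_sub hix hiy]
    apply abs_setIntegral_le_gaussConst
    intro u hu
    have h1 := (mul_holder_growth_le hs hs1 hy hu).2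
    have h2 := h.abs_le hH hs hs1 h0 (y + u)
    rw [abs_of_nonneg (by positivity : 0 ≤ y + u)] at h2
    have ex : Real.exp (-(x * u) - u ^ 2 / 2)
        = Real.exp (-(d * u)) * (Real.exp (-(y * u)) * Real.exp (-u ^ 2 / 2)) := by
      rw [← Real.exp_add, ← Real.exp_add]; congr 1; rw [hd_def]; ring
    have ey : Real.exp (-(y * u) - u ^ 2 / 2)
        = Real.exp (-(y * u)) * Real.exp (-u ^ 2 / 2) := by
      rw [← Real.exp_add]; congr 1; ring
    have hdu : 0 ≤ d * u := by positivity
    have h3 := one_sub_exp_neg_le_rpow hdu hs.le hs1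
    rw [Real.mul_rpow hd hu.le] at h3
    have h4 : Real.exp (-(d * u)) ≤ 1 := Real.exp_le_one_iff.mpr (by linarith)
    have h4' : Real.exp (-(y * u)) ≤ 1 := Real.exp_le_one_iff.mpr (by
      have : 0 ≤ y * u := by positivity
      linarith)
    have h5 : |H (x + u) - H (y + u)| ≤ L * d ^ s := by
      have := h (x + u) (y + u)
      rwa [show x + u - (y + u) = d by rw [hd_def]; ring, abs_of_nonneg hd] at this
    have h6 : 0 ≤ 1 - Real.exp (-(d * u)) := by linarith
    set E := Real.exp (-(y * u))
    set G := Real.exp (-u ^ 2 / 2)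
    have hE : 0 < E := Real.exp_pos _
    have hG : 0 < G := Real.exp_pos _
    rw [ex, ey]
    have e7 : u * (H (x + u) * (Real.exp (-(d * u)) * (E * G))) - u * (H (y + u) * (E * G))
        = u * (H (x + u) - H (y + u)) * (Real.exp (-(d * u)) * E * G)
          - u * H (y + u) * (1 - Real.exp (-(d * u))) * (E * G) := by ring
    rw [e7]
    calc _ ≤ u * |H (x + u) - H (y + u)| * (Real.exp (-(d * u)) * E * G)
          + u * |H (y + u)| * (1 - Real.exp (-(d * u))) * (E * G) := by
          refine (abs_sub _ _).trans (add_le_add ?_ ?_)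
          · rw [abs_mul, abs_mul, abs_of_pos hu,
              abs_of_pos (by positivity : 0 < Real.exp (-(d * u)) * E * G)]
          · rw [abs_mul, abs_mul, abs_mul, abs_of_pos hu, abs_of_nonneg h6,
              abs_of_pos (by positivity : 0 < E * G)]
      _ ≤ u * (L * d ^ s) * (1 * 1 * G)
          + u * (L * (4 + (y + u) ^ s)) * (d ^ s * u ^ s) * (E * G) := by gcongr
      _ = L * d ^ s * (u + (4 + (y + u) ^ s) * E * (u * u ^ s)) * G := by ring
      _ ≤ L * d ^ s * ((1 + u) ^ 4 + 5 * (1 + u) ^ 4) * G := by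
          have : u ≤ (1 + u) ^ 4 := by
            have := one_add_mul_le_pow (a := u) (by linarith) 4
            push_cast at this
            linarith
          gcongr
      _ = _ := by ring
  refine le_trans (b := L * d ^ s + L * d ^ s + 6 * L * d ^ s * gaussConst) ?_
    (le_of_eq (by ring))
  rw [abs_le] at b0 b1 b2 ⊢
  constructor <;> linarith

/-- For Hölder data, the derivative `x * f x + H x` of the Stein solution is bounded and Hölder. -/
theorem steinSol_deriv_regular (h : RealHolder s L H) (hH : Continuous H) (hs : 0 < s)
    (hs1 : s ≤ 1) (h0 : ∫ x, H x ∂(gaussianReal 0 1) = 0) :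
    (∀ x, |x * steinSol H x + H x| ≤ (expConst + 5 * gaussConst) * L) ∧
    RealHolder s ((4 + 12 * gaussConst) * L) (fun x => x * steinSol H x + H x) := by
  have hM := h.abs_le_sq hH hs hs1 h0
  have hL := h.nonneg
  have hg := gaussConst_nonneg
  have h0' : ∫ x, H (-x) ∂(gaussianReal 0 1) = 0 := by
    have hm : (gaussianReal 0 1).map (fun x => -x) = gaussianReal 0 1 := by
      rw [gaussianReal_map_neg]; simp
    have := integral_map (μ := gaussianReal 0 1) (φ := fun x : ℝ => -x) (f := H) (by fun_prop)
      (by fun_prop)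
    rw [← this, hm, h0]
  have hcn : Continuous (fun y => H (-y)) := by fun_prop
  have refl : ∀ x, -x * steinSol H (-x) + H (-x)
      = x * steinSol (fun y => H (-y)) x + (fun y => H (-y)) x := by
    intro x
    rw [steinSol_neg hH hM h0]; ring
  constructor
  · intro x
    rcases le_total 0 x with hx | hx
    · exact abs_steinSol_deriv_le_of_nonneg h hH hs hs1 h0 hx
    · have := abs_steinSol_deriv_le_of_nonneg h.comp_neg hcn hs hs1 h0' (x := -x) (by linarith)
      rw [← refl, neg_neg] at this
      exact this
  · set g := fun x => x * steinSol H x + H x with hg_def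
    have pos : ∀ x y, 0 ≤ y → y ≤ x → |g x - g y| ≤ ((2 + 6 * gaussConst) * L) * (x - y) ^ s :=
      fun x y hy hxy => abs_steinSol_deriv_sub_le_of_nonneg h hH hs hs1 h0 hy hxy
    have neg : ∀ x y, 0 ≤ y → y ≤ x →
        |g (-x) - g (-y)| ≤ ((2 + 6 * gaussConst) * L) * (x - y) ^ s := by
      intro x y hy hxy
      simp only [hg_def]
      rw [refl, refl]
      exact abs_steinSol_deriv_sub_le_of_nonneg h.comp_neg hcn hs hs1 h0' hy hxy
    have h2 : (4 + 12 * gaussConst) * L = 2 * ((2 + 6 * gaussConst) * L) := by ring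
    rw [h2]
    exact realHolder_of_half_lines hs (by positivity) pos neg
end

/-! ### Regularity of Stein solutions for differentiable data -/

section
variable {s : ℝ} {H H₁ : ℝ → ℝ}

/-- The slope H'(0) is not bounded over the class, so it must not enter the constants. It can be
removed because linear data have a constant Stein solution and do not affect f'. -/
lemma abs_sub_linear_le (hd : ∀ x, HasDerivAt H (H₁ x) x) (h1 : RealHolder s 1 H₁) (hs : 0 < s)
    {x y : ℝ} (hy : 0 ≤ y) (hxy : y ≤ x) :
    |(H x - H₁ 0 * x) - (H y - H₁ 0 * y)| ≤ (x - y) * x ^ s := by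
  rcases hxy.eq_or_lt with h | h
  · subst h; simp
  · have hder : ∀ z, HasDerivAt (fun z => H z - H₁ 0 * z) (H₁ z - H₁ 0) z := by
      intro z
      exact ((hd z).sub ((hasDerivAt_id z).const_mul (H₁ 0))).congr_deriv (by simp)
    obtain ⟨z, hz, hz2⟩ := exists_hasDerivAt_eq_slope (fun z => H z - H₁ 0 * z)
      (fun z => H₁ z - H₁ 0) h
      (fun z _ => (hder z).continuousAt.continuousWithinAt) (fun z _ => hder z)
    have hxy' : 0 < x - y := by linarith
    have e : (H x - H₁ 0 * x) - (H y - H₁ 0 * y) = (x - y) * (H₁ z - H₁ 0) := by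
      rw [hz2]; field_simp
    rw [e, abs_mul, abs_of_pos hxy']
    gcongr
    have := h1 z 0
    have hz0 : 0 ≤ z := hy.trans hz.1.le
    rw [one_mul, sub_zero, abs_of_nonneg hz0] at this
    exact this.trans (Real.rpow_le_rpow hz0 hz.2.le hs.le)

lemma hasDerivAt_comp_neg_and (hd : ∀ x, HasDerivAt H (H₁ x) x) (x : ℝ) :
    HasDerivAt (fun x => H (-x)) (-H₁ (-x)) x :=
  ((hd (-x)).comp x (hasDerivAt_neg x)).congr_deriv (by simp)

lemma RealHolder.neg {L : ℝ} (h : RealHolder s L H) : RealHolder s L (fun x => -H x) := by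
  intro x y
  refine le_trans (le_of_eq ?_) (h x y)
  rw [show -H x - -H y = -(H x - H y) by ring, abs_neg]

lemma abs_sub_linear_zero_le (hd : ∀ x, HasDerivAt H (H₁ x) x) (h1 : RealHolder s 1 H₁)
    (hs : 0 < s) (hs1 : s ≤ 1) (x : ℝ) :
    |(H x - H₁ 0 * x) - H 0| ≤ 2 * (1 + x ^ 2) := by
  have key : |(H x - H₁ 0 * x) - H 0| ≤ |x| * |x| ^ s := by
    rcases le_total 0 x with hx | hx
    · have := abs_sub_linear_le hd h1 hs le_rfl hx
      simpa [abs_of_nonneg hx] using this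
    · have := abs_sub_linear_le (H := fun x => H (-x)) (H₁ := fun x => -H₁ (-x))
        (hasDerivAt_comp_neg_and hd) h1.comp_neg.neg hs le_rfl (x := -x) (by linarith)
      simpa [abs_of_nonpos hx] using this
  refine key.trans ?_
  have h2 := rpow_le_one_add (abs_nonneg x) hs.le hs1
  have h3 := abs_nonneg x
  rw [← sq_abs x]
  nlinarith [sq_nonneg (|x| - 1)]

/-- The normal law has mean zero, hence subtracting H'(0) x preserves centring and the bound is free
of H'(0). -/
lemma abs_sub_linear_at_zero_le (hd : ∀ x, HasDerivAt H (H₁ x) x) (h1 : RealHolder s 1 H₁)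
    (hs : 0 < s) (hs1 : s ≤ 1) (h0 : ∫ x, H x ∂(gaussianReal 0 1) = 0) : |H 0| ≤ 4 := by
  have hc : Continuous H := continuous_iff_continuousAt.mpr fun x => (hd x).continuousAt
  have hb := abs_sub_linear_zero_le hd h1 hs hs1
  have hi : Integrable (fun x : ℝ => x) (gaussianReal 0 1) :=
    (memLp_id_gaussianReal (μ := 0) (v := 1) 1).integrable (by norm_num)
  have h2 : Integrable (fun x => (H x - H₁ 0 * x) - H 0) (gaussianReal 0 1) :=
    integrable_of_le_sq (by fun_prop) hb
  have hHi : Integrable H (gaussianReal 0 1) :=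
    ((h2.add (hi.const_mul (H₁ 0))).add (integrable_const (H 0))).congr
      (ae_of_all _ fun x => by simp only [Pi.add_apply]; ring)
  have hz : ∫ x, (H x - H₁ 0 * x) ∂(gaussianReal 0 1) = 0 := by
    rw [integral_sub hHi (hi.const_mul _), h0, integral_const_mul, integral_id_gaussianReal]
    simp
  have := abs_zero_le_of_centred (H := fun x => H x - H₁ 0 * x) (by fun_prop) (M := 2)
    (by simpa using hb) hz
  simp only [mul_zero, sub_zero] at this
  linarith

lemma exists_growth_of_hasDerivAt (hd : ∀ x, HasDerivAt H (H₁ x) x) (h1 : RealHolder s 1 H₁)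
    (hs : 0 < s) (hs1 : s ≤ 1) : ∃ M, ∀ x, |H x| ≤ M * (1 + x ^ 2) := by
  refine ⟨2 + |H₁ 0| + |H 0|, fun x => ?_⟩
  have h2 := abs_sub_linear_zero_le hd h1 hs hs1 x
  have h3 : |H x| ≤ |(H x - H₁ 0 * x) - H 0| + |H₁ 0 * x| + |H 0| := by
    have h5 := abs_add_le ((H x - H₁ 0 * x) - H 0 + H₁ 0 * x) (H 0)
    have h6 := abs_add_le ((H x - H₁ 0 * x) - H 0) (H₁ 0 * x)
    rw [show H x - H₁ 0 * x - H 0 + H₁ 0 * x + H 0 = H x by ring] at h5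
    linarith
  rw [abs_mul] at h3
  have h4 : |x| ≤ 1 + x ^ 2 := by rw [← sq_abs x]; nlinarith [sq_nonneg (|x| - 1)]
  have h5 : |H₁ 0| * |x| ≤ |H₁ 0| * (1 + x ^ 2) := by gcongr
  have h6 : |H 0| ≤ |H 0| * (1 + x ^ 2) := by
    have := mul_nonneg (abs_nonneg (H 0)) (sq_nonneg x)
    linarith
  linarith

/-- The derivative of the Stein solution as a single integral over the half-line. -/
lemma steinSol_deriv_eq_integral (hH : Continuous H) {M : ℝ}
    (hM : ∀ x, |H x| ≤ M * (1 + x ^ 2)) {x : ℝ} (hx : 0 ≤ x) :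
    x * steinSol H x + H x
      = ∫ u in Set.Ioi (0 : ℝ), (u * H x - x * (H (x + u) - H x))
          * Real.exp (-(x * u) - u ^ 2 / 2) := by
  have hone : ∀ y : ℝ, |(fun _ : ℝ => (1 : ℝ)) y| ≤ 1 * (1 + y ^ 2) := by
    intro y; simp; positivity
  -- For constant data the formula says that (x + u) exp(-x u - u²/2) integrates to 1, so H x can be
  -- moved under the integral.
  have e1 := integral_shift_eq_sqrt (H := fun _ => 1) continuous_const hone hx
  simp only [one_mul] at e1
  rw [integral_exp_neg_Ioi_zero] at e1
  have i0 := integrableOn_pow_mul_shift hH hM hx (k := 0) (by norm_num)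
  have j0 := integrableOn_pow_mul_shift (H := fun _ => 1) continuous_const hone hx (k := 0)
    (by norm_num)
  have j1 := integrableOn_pow_mul_shift (H := fun _ => 1) continuous_const hone hx (k := 1)
    (by norm_num)
  simp only [pow_zero, pow_one, one_mul] at i0 j0 j1
  have ij : IntegrableOn (fun u => (x + u) * Real.exp (-(x * u) - u ^ 2 / 2)) (Set.Ioi 0) :=
    ((j0.const_mul x).add j1).congr (ae_of_all _ fun u => by simp only [Pi.add_apply]; ring)
  have e2 : ∀ u, (u * H x - x * (H (x + u) - H x)) * Real.exp (-(x * u) - u ^ 2 / 2)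
      = H x * ((x + u) * Real.exp (-(x * u) - u ^ 2 / 2))
        - x * (H (x + u) * Real.exp (-(x * u) - u ^ 2 / 2)) := fun u => by ring
  simp only [e2]
  rw [integral_sub (ij.const_mul _) (i0.const_mul _), integral_const_mul, integral_const_mul, e1,
    steinSol_eq]
  ring

/-- The kernel u H(x) - x (H(x + u) - H(x)) annihilates linear functions, so H may be replaced by H
- H'(0) x, of growth x^(1+s). For x ≥ 1 the factor u integrated against exp(-x u) gives x^(-2),
hence x^(s-1). -/
lemma abs_steinSol_deriv_le_rpow (hd : ∀ x, HasDerivAt H (H₁ x) x) (h1 : RealHolder s 1 H₁)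
    (hs : 0 < s) (hs1 : s ≤ 1) (h0 : ∫ x, H x ∂(gaussianReal 0 1) = 0) {x : ℝ} (hx : 0 ≤ x) :
    |x * steinSol H x + H x| ≤ 9 + 7 * gaussConst ∧
      (0 < x → |x * steinSol H x + H x| ≤ (9 + 7 * gaussConst) * x ^ (s - 1)) := by
  have hc : Continuous H := continuous_iff_continuousAt.mpr fun x => (hd x).continuousAt
  obtain ⟨M, hM⟩ := exists_growth_of_hasDerivAt hd h1 hs hs1
  have hg := gaussConst_nonneg
  set H₀ : ℝ → ℝ := fun x => H x - H₁ 0 * x with hH₀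
  have hz : |H₀ 0| ≤ 4 := by
    simpa [hH₀] using abs_sub_linear_at_zero_le hd h1 hs hs1 h0
  have hxs : |H₀ x| ≤ 4 + x * x ^ s := by
    have h3 := abs_sub_linear_le hd h1 hs le_rfl hx
    have h4 : |H₀ x| ≤ |H₀ x - H₀ 0| + |H₀ 0| := by
      have := abs_add_le (H₀ x - H₀ 0) (H₀ 0); simpa using this
    simp only [sub_zero] at h3
    have h5 : |H₀ x - H₀ 0| ≤ x * x ^ s := by simpa [hH₀] using h3
    linarith
  have hN : ∀ u, 0 < u → |u * H x - x * (H (x + u) - H x)|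
      ≤ u * (4 + x * x ^ s) + x * (u * (x + u) ^ s) := by
    intro u hu
    have h3 := abs_sub_linear_le hd h1 hs hx (x := x + u) (by linarith)
    rw [show x + u - x = u by ring] at h3
    have e : u * H x - x * (H (x + u) - H x) = u * H₀ x - x * (H₀ (x + u) - H₀ x) := by
      simp only [hH₀]; ring
    rw [e]
    refine (abs_sub _ _).trans ?_
    rw [abs_mul, abs_mul, abs_of_pos hu, abs_of_nonneg hx]
    gcongr
  rcases le_total x 1 with hx1 | hx1
  · have hb : |x * steinSol H x + H x| ≤ 7 * gaussConst := by
      rw [steinSol_deriv_eq_integral hc hM hx]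
      apply abs_setIntegral_le_gaussConst
      intro u hu
      rw [abs_mul, Real.abs_exp]
      have h3 : x ^ s ≤ 1 := Real.rpow_le_one hx hx1 hs.le
      have h4 : (x + u) ^ s ≤ 2 + u :=
        (rpow_le_one_add (by positivity) hs.le hs1).trans (by linarith)
      have hxu : 0 ≤ x * u := by positivity
      calc _ ≤ (u * (4 + x * x ^ s) + x * (u * (x + u) ^ s)) * Real.exp (-u ^ 2 / 2) := by
            gcongr
            · exact hN u hu
            · linarith
        _ ≤ (u * (4 + 1 * 1) + 1 * (u * (2 + u))) * Real.exp (-u ^ 2 / 2) := by gcongr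
        _ ≤ (7 * (1 + u) ^ 4) * Real.exp (-u ^ 2 / 2) := by
            gcongr
            have := one_le_pow₀ (n := 2) (by linarith : 1 ≤ 1 + u)
            nlinarith
        _ = _ := by ring
    refine ⟨by linarith, fun hx0 => ?_⟩
    have h3 : 1 ≤ x ^ (s - 1) := Real.one_le_rpow_of_pos_of_le_one_of_nonpos hx0 hx1 (by linarith)
    nlinarith
  · have hx0 : 0 < x := by linarith
    have i1 := Real.integral_rpow_mul_exp_neg_mul_Ioi (a := 2) (r := x) two_pos hx0
    have i2 := Real.integral_rpow_mul_exp_neg_mul_Ioi (a := 3) (r := x) three_pos hx0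
    have g2 : Real.Gamma 2 = 1 := by simp
    have g3 : Real.Gamma 3 = 2 := by
      rw [show (3 : ℝ) = 2 + 1 by norm_num, Real.Gamma_add_one (by norm_num), g2, mul_one]
    rw [g2, mul_one] at i1
    rw [g3] at i2
    norm_num at i1 i2
    have n1 : IntegrableOn (fun t : ℝ => t * Real.exp (-(x * t))) (Set.Ioi 0) := by
      apply Integrable.of_integral_ne_zero
      rw [i1]; positivity
    have n2 : IntegrableOn (fun t : ℝ => t ^ 2 * Real.exp (-(x * t))) (Set.Ioi 0) := by
      apply Integrable.of_integral_ne_zero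
      rw [i2]; positivity
    set X := x * x ^ s with hX
    have hX1 : 1 ≤ X := by
      have := Real.one_le_rpow hx1 hs.le
      nlinarith
    -- The 9 is 7/x² from the first moment of exp(-x u) plus x · 2/x³ from the second.
    have hXe : X * (9 / x ^ 2) = 9 * x ^ (s - 1) := by
      rw [hX, Real.rpow_sub_one hx0.ne']; field_simp
    have hb : |x * steinSol H x + H x| ≤ 9 * x ^ (s - 1) := by
      rw [steinSol_deriv_eq_integral hc hM hx, ← Real.norm_eq_abs]
      have hint : ∫ u in Set.Ioi (0 : ℝ), (X * 7 * (u * Real.exp (-(x * u)))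
          + X * x * (u ^ 2 * Real.exp (-(x * u)))) = 9 * x ^ (s - 1) := by
        rw [integral_add (n1.const_mul _) (n2.const_mul _), integral_const_mul,
          integral_const_mul, i1, i2, ← hXe]
        field_simp; norm_num
      rw [← hint]
      apply norm_integral_le_of_norm_le ((n1.const_mul _).add (n2.const_mul _))
      filter_upwards [ae_restrict_mem measurableSet_Ioi] with u hu
      have hu0 : (0 : ℝ) < u := hu
      have h3 : (x + u) ^ s ≤ x ^ s + u ^ s := Real.rpow_add_le_add_rpow hx hu0.le hs.le hs1
      have h4 : x * u ^ s ≤ X * (1 + x * u) := by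
        have h5 : (x * u) ^ s ≤ 1 + x * u := rpow_le_one_add (by positivity) hs.le hs1
        rw [Real.mul_rpow hx hu0.le] at h5
        have h6 : 1 ≤ x ^ s := Real.one_le_rpow hx1 hs.le
        have h7 : 0 ≤ u ^ s := by positivity
        have h8 : 0 ≤ x * u := by positivity
        have h9 : u ^ s ≤ x ^ s * u ^ s := le_mul_of_one_le_left h7 h6
        calc x * u ^ s ≤ x * (1 + x * u) := by gcongr; linarith
          _ ≤ x * x ^ s * (1 + x * u) := by
              gcongr; nlinarith
      have hxu : 0 ≤ x * u := by positivity
      rw [Real.norm_eq_abs, abs_mul, Real.abs_exp]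
      calc _ ≤ (u * (4 + X) + x * (u * (x + u) ^ s)) * Real.exp (-(x * u)) := by
            gcongr
            · exact hN u hu0
            · have : 0 ≤ u ^ 2 := sq_nonneg u
              linarith
        _ ≤ (u * (4 + X) + x * (u * (x ^ s + u ^ s))) * Real.exp (-(x * u)) := by gcongr
        _ = (u * (4 + X) + (u * X + u * (x * u ^ s))) * Real.exp (-(x * u)) := by
            rw [hX]; ring
        _ ≤ (u * (4 * X + X) + (u * X + u * (X * (1 + x * u)))) * Real.exp (-(x * u)) := by
            gcongr; linarith
        _ = _ := by simp only [Pi.add_apply]; ring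
    have h3 : x ^ (s - 1) ≤ 1 := Real.rpow_le_one_of_one_le_of_nonpos hx1 (by linarith)
    have h4 : 0 ≤ x ^ (s - 1) := by positivity
    exact ⟨by nlinarith, fun _ => by nlinarith⟩

/-- Integrate |f'(z)| ≤ C z^(s-1) and use x^s - y^s ≤ (x - y)^s. Monotonicity of (C/s) z^s ± f
replaces the integral and needs the derivative only at z > 0. -/
lemma abs_steinSol_sub_le_of_nonneg (hd : ∀ x, HasDerivAt H (H₁ x) x) (h1 : RealHolder s 1 H₁)
    (hs : 0 < s) (hs1 : s ≤ 1) (h0 : ∫ x, H x ∂(gaussianReal 0 1) = 0) {x y : ℝ} (hy : 0 ≤ y)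
    (hxy : y ≤ x) :
    |steinSol H x - steinSol H y| ≤ (9 + 7 * gaussConst) / s * (x - y) ^ s := by
  have hc : Continuous H := continuous_iff_continuousAt.mpr fun x => (hd x).continuousAt
  obtain ⟨M, hM⟩ := exists_growth_of_hasDerivAt hd h1 hs hs1
  have hg := gaussConst_nonneg
  set C := 9 + 7 * gaussConst with hC
  have hC0 : 0 ≤ C := by positivity
  have hder := hasDerivAt_steinSol hc hM
  have mono : ∀ σ : ℝ, |σ| = 1 →
      MonotoneOn (fun z => C / s * z ^ s - σ * steinSol H z) (Set.Ici 0) := by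
    intro σ hσ
    have hd' : ∀ z : ℝ, 0 < z → HasDerivAt (fun z => C / s * z ^ s - σ * steinSol H z)
        (C / s * (s * z ^ (s - 1)) - σ * (z * steinSol H z + H z)) z := by
      intro z hz
      exact ((Real.hasDerivAt_rpow_const (Or.inl hz.ne')).const_mul _).sub ((hder z).const_mul σ)
    have hcf : Continuous (steinSol H) :=
      continuous_iff_continuousAt.mpr fun x => (hder x).continuousAt
    apply monotoneOn_of_deriv_nonneg (convex_Ici 0)
    · apply Continuous.continuousOn
      have : Continuous fun z : ℝ => z ^ s := Real.continuous_rpow_const hs.le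
      fun_prop
    · intro z hz
      rw [interior_Ici] at hz
      exact (hd' z hz).differentiableAt.differentiableWithinAt
    · intro z hz
      rw [interior_Ici] at hz
      have hz0 : 0 < z := hz
      rw [(hd' z hz).deriv]
      have h3 := (abs_steinSol_deriv_le_rpow hd h1 hs hs1 h0 hz0.le).2 hz0
      have h4 : σ * (z * steinSol H z + H z) ≤ |z * steinSol H z + H z| := by
        refine (le_abs_self _).trans ?_
        rw [abs_mul, hσ, one_mul]
      have e : C / s * (s * z ^ (s - 1)) = C * z ^ (s - 1) := by field_simp
      rw [e]; linarith
  have hx : 0 ≤ x := hy.trans hxy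
  have m1 := mono 1 (by simp) (Set.mem_Ici.mpr hy) (Set.mem_Ici.mpr hx) hxy
  have m2 := mono (-1) (by simp) (Set.mem_Ici.mpr hy) (Set.mem_Ici.mpr hx) hxy
  simp only at m1 m2
  have h5 : x ^ s ≤ (x - y) ^ s + y ^ s := by
    have := Real.rpow_add_le_add_rpow (sub_nonneg.mpr hxy) hy hs.le hs1
    rwa [sub_add_cancel] at this
  have h6 : C / s * x ^ s ≤ C / s * ((x - y) ^ s + y ^ s) := by gcongr
  rw [abs_le]
  constructor <;> linarith

/-- For `C^{1,s}` data the Stein solution `f` is `s`-Hölder, and its derivative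
`g x = x * f x + H x` is bounded and differentiable with bounded `s`-Hölder derivative. -/
theorem exists_steinSol_second_regular (hs : 0 < s) (hs1 : s ≤ 1) : ∃ C, 0 ≤ C ∧
    ∀ H H₁ : ℝ → ℝ, Continuous H₁ → (∀ x, HasDerivAt H (H₁ x) x) → RealHolder s 1 H₁ →
      ∫ x, H x ∂(gaussianReal 0 1) = 0 →
      (∀ x, |x * steinSol H x + H x| ≤ C) ∧
      ∃ g₁ : ℝ → ℝ, (∀ x, HasDerivAt (fun x => x * steinSol H x + H x) (g₁ x) x) ∧
        (∀ x, |g₁ x| ≤ C) ∧ RealHolder s C g₁ := by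
  have hg := gaussConst_nonneg
  have he := expConst_nonneg
  set C₁ := 9 + 7 * gaussConst with hC₁
  have hC₁0 : 0 ≤ C₁ := by positivity
  set L := 1 + 2 * (C₁ / s) with hL
  have hL0 : 0 ≤ L := by positivity
  refine ⟨C₁ + (expConst + 5 * gaussConst) * L + (4 + 12 * gaussConst) * L, by positivity,
    fun H H₁ hH₁ hd h1 h0 => ?_⟩
  have hc : Continuous H := continuous_iff_continuousAt.mpr fun x => (hd x).continuousAt
  obtain ⟨M, hM⟩ := exists_growth_of_hasDerivAt hd h1 hs hs1
  have hder := hasDerivAt_steinSol hc hM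
  have hcf : Continuous (steinSol H) :=
    continuous_iff_continuousAt.mpr fun x => (hder x).continuousAt
  have hd' := hasDerivAt_comp_neg_and hd
  have h1' : RealHolder s 1 (fun x => -H₁ (-x)) := h1.comp_neg.neg
  have h0' : ∫ x, H (-x) ∂(gaussianReal 0 1) = 0 := by
    have hm : (gaussianReal 0 1).map (fun x => -x) = gaussianReal 0 1 := by
      rw [gaussianReal_map_neg]; simp
    have := integral_map (μ := gaussianReal 0 1) (φ := fun x : ℝ => -x) (f := H) (by fun_prop)
      (by fun_prop)
    rw [← this, hm, h0]
  have refl := steinSol_neg hc hM h0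
  have gbound : ∀ x, |x * steinSol H x + H x| ≤ C₁ := by
    intro x
    rcases le_total 0 x with hx | hx
    · exact (abs_steinSol_deriv_le_rpow hd h1 hs hs1 h0 hx).1
    · have := (abs_steinSol_deriv_le_rpow hd' h1' hs hs1 h0' (x := -x) (by linarith)).1
      have e := refl (-x)
      rw [neg_neg] at e this
      rw [e]
      convert this using 2; ring
  have fholder : RealHolder s (2 * (C₁ / s)) (steinSol H) := by
    have pos : ∀ x y, 0 ≤ y → y ≤ x → |steinSol H x - steinSol H y| ≤ C₁ / s * (x - y) ^ s :=
      fun x y hy hxy => abs_steinSol_sub_le_of_nonneg hd h1 hs hs1 h0 hy hxy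
    have neg : ∀ x y, 0 ≤ y → y ≤ x →
        |steinSol H (-x) - steinSol H (-y)| ≤ C₁ / s * (x - y) ^ s := by
      intro x y hy hxy
      rw [refl, refl, show ∀ a b : ℝ, -a - -b = -(a - b) by intros; ring, abs_neg]
      exact abs_steinSol_sub_le_of_nonneg hd' h1' hs hs1 h0' hy hxy
    exact realHolder_of_half_lines hs (by positivity) pos neg
  -- Differentiating Stein's equation shows that g = f' satisfies g' - x g = H' + f. This new datum
  -- is s-Hölder, so the Hölder theory applies to g.
  set K : ℝ → ℝ := fun x => H₁ x + steinSol H x with hK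
  have hKc : Continuous K := by fun_prop
  have hKh : RealHolder s L K := by
    intro x y
    have a1 := h1 x y
    have a2 := fholder x y
    have : |K x - K y| ≤ |H₁ x - H₁ y| + |steinSol H x - steinSol H y| := by
      have := abs_add_le (H₁ x - H₁ y) (steinSol H x - steinSol H y)
      refine le_trans (le_of_eq ?_) this
      simp only [hK]; congr 1; ring
    rw [hL, add_mul]
    linarith
  have hKM : ∀ x, |K x| ≤ (|K 0| + 2 * L) * (1 + x ^ 2) := by
    intro x
    have a1 := hKh.sub_zero_le hs hs1 x
    have a2 : |K x| ≤ |K x - K 0| + |K 0| := by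
      have := abs_add_le (K x - K 0) (K 0); simpa using this
    have := mul_nonneg (abs_nonneg (K 0)) (sq_nonneg x)
    linarith
  have hKi := integrable_mul_exp_neg_sq hKc hKM
  set g : ℝ → ℝ := fun x => x * steinSol H x + H x with hg_def
  have hgd : ∀ x, HasDerivAt g (x * g x + K x) x := by
    intro x
    have : HasDerivAt g (1 * steinSol H x + x * (x * steinSol H x + H x) + H₁ x) x :=
      ((hasDerivAt_id x).mul (hder x)).add (hd x)
    refine this.congr_deriv ?_
    simp only [hg_def, hK]; ring
  set ψ : ℝ → ℝ := fun t => g t * Real.exp (-t ^ 2 / 2) with hψ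
  have hψd : ∀ t, HasDerivAt ψ (K t * Real.exp (-t ^ 2 / 2)) t := by
    intro t
    have h2 : HasDerivAt (fun y : ℝ => Real.exp (-y ^ 2 / 2))
        (Real.exp (-t ^ 2 / 2) * (-t)) t := by
      have : HasDerivAt (fun y : ℝ => -y ^ 2 / 2) (-t) t := by
        have := ((hasDerivAt_pow 2 t).neg).div_const 2
        refine this.congr_deriv ?_
        push_cast; ring
      exact this.exp
    have : HasDerivAt ψ _ t := (hgd t).mul h2
    refine this.congr_deriv ?_
    ring
  have hψb : ∀ t, ‖ψ t‖ ≤ C₁ * Real.exp (-t ^ 2 / 2) := by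
    intro t
    rw [Real.norm_eq_abs, abs_mul, Real.abs_exp]
    gcongr
    exact gbound t
  have hexp : Filter.Tendsto (fun t : ℝ => C₁ * Real.exp (-t ^ 2 / 2)) Filter.atTop (nhds 0) := by
    have h2 : Filter.Tendsto (fun t : ℝ => -t ^ 2 / 2) Filter.atTop Filter.atBot := by
      have := ((Filter.tendsto_pow_atTop (α := ℝ) (n := 2) (by norm_num)).atTop_div_const
        (by norm_num : (0 : ℝ) < 2))
      refine (Filter.tendsto_neg_atTop_atBot.comp this).congr fun t => ?_
      simp only [Function.comp_apply]; ring
    simpa using (Real.tendsto_exp_atBot.comp h2).const_mul C₁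
  have ttop : Filter.Tendsto ψ Filter.atTop (nhds 0) :=
    squeeze_zero_norm hψb hexp
  have tbot : Filter.Tendsto ψ Filter.atBot (nhds 0) := by
    refine squeeze_zero_norm hψb ((hexp.comp Filter.tendsto_neg_atBot_atTop).congr fun t => ?_)
    simp
  -- Since g is bounded, ψ vanishes at both ends, and K exp(-t²/2) is its derivative.
  have hK0 : ∫ x, K x ∂(gaussianReal 0 1) = 0 := by
    rw [integral_gaussianReal_eq, integral_of_hasDerivAt_of_tendsto hψd hKi tbot ttop]
    simp
  -- The same primitive integrated over (x, ∞) identifies g with the Stein solution for K, with no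
  -- homogeneous part.
  have hsol : steinSol K = g := by
    ext x
    have := integral_Ioi_of_hasDerivAt_of_tendsto (a := x)
      (hψd x).continuousAt.continuousWithinAt (fun t _ => hψd t) hKi.integrableOn ttop
    rw [steinSol, this]
    have e : Real.exp (x ^ 2 / 2) * Real.exp (-x ^ 2 / 2) = 1 := by
      rw [← Real.exp_add, show x ^ 2 / 2 + -x ^ 2 / 2 = 0 by ring, Real.exp_zero]
    simp only [hψ]
    linear_combination g x * e
  obtain ⟨r1, r2⟩ := steinSol_deriv_regular hKh hKc hs hs1 hK0
  rw [hsol] at r1 r2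
  have p1 : 0 ≤ (expConst + 5 * gaussConst) * L := by positivity
  have p2 : 0 ≤ (4 + 12 * gaussConst) * L := by positivity
  refine ⟨fun x => (gbound x).trans (by linarith), fun x => x * g x + K x, hgd,
    fun x => (r1 x).trans (by linarith), fun x y => (r2 x y).trans ?_⟩
  gcongr
  linarith
end

/-! ### From the elephant random walk to the Markov functionals -/

lemma IsRademacher.ae {Ω : Type*} [MeasurableSpace Ω] {P : Measure Ω} [IsProbabilityMeasure P]
    {s : ℝ} {Y : Ω → ℝ} (h : IsRademacher P s Y) (hY : Measurable Y) :
    ∀ᵐ ω ∂P, Y ω = 1 ∨ Y ω = -1 := by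
  have h1 : MeasurableSet {ω | Y ω = 1} := hY (measurableSet_singleton 1)
  have h2 : MeasurableSet {ω | Y ω = -1} := hY (measurableSet_singleton (-1))
  have hd : Disjoint {ω | Y ω = 1} {ω | Y ω = -1} := by
    rw [Set.disjoint_left]
    intro ω (a : Y ω = 1) (b : Y ω = -1)
    linarith
  have hu : P.real ({ω | Y ω = 1} ∪ {ω | Y ω = -1}) = 1 := by
    rw [measureReal_union hd h2, h.1, h.2]; ring
  have hc : P.real ({ω | Y ω = 1} ∪ {ω | Y ω = -1})ᶜ = 0 := by
    rw [probReal_compl_eq_one_sub (h1.union h2), hu, sub_self]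
  rw [measureReal_eq_zero_iff] at hc
  filter_upwards [compl_mem_ae_iff.mpr hc] with ω hω
  rwa [compl_compl] at hω

lemma integrable_comp_of_ae_bounded {Ω : Type*} [MeasurableSpace Ω] {P : Measure Ω}
    [IsFiniteMeasure P] {Y : Ω → ℝ} (hY : Measurable Y) {R : ℝ} (hR : ∀ᵐ ω ∂P, |Y ω| ≤ R)
    {g : ℝ → ℝ} (hg : Continuous g) : Integrable (fun ω => g (Y ω)) P := by
  obtain ⟨B, hB⟩ := (isCompact_Icc (a := -R) (b := R)).exists_bound_of_continuousOn hg.continuousOn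
  refine Integrable.of_bound (hg.measurable.comp hY).aestronglyMeasurable B ?_
  filter_upwards [hR] with ω hω
  exact hB _ (abs_le.mp hω)

lemma IsElephantWalk.measurable_position {Ω : Type*} [MeasurableSpace Ω] {P : Measure Ω} {p q : ℝ}
    {X α : ℕ → Ω → ℝ} {β : ℕ → Ω → ℕ} (h : IsElephantWalk P p q X α β) (n : ℕ) :
    Measurable (position X n) := by
  unfold position
  exact Finset.measurable_fun_sum _ fun i hi => h.measurable_X i (Finset.mem_Icc.mp hi).1

section
variable {Ω : Type*} [MeasurableSpace Ω] {P : Measure Ω} [IsProbabilityMeasure P] {p q : ℝ}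
  {X α : ℕ → Ω → ℝ} {β : ℕ → Ω → ℕ}

lemma IsElephantWalk.ae_step (h : IsElephantWalk P p q X α β) {n : ℕ} (hn : 1 ≤ n) :
    ∀ᵐ ω ∂P, X n ω = 1 ∨ X n ω = -1 := by
  induction n using Nat.strong_induction_on with
  | _ n ih =>
    rcases hn.eq_or_lt with rfl | hn2
    · exact h.first_step.ae (h.measurable_X 1 le_rfl)
    · have hall : ∀ᵐ ω ∂P, ∀ k ∈ Finset.Icc 1 (n - 1), X k ω = 1 ∨ X k ω = -1 := by
        rw [Filter.eventually_all_finset]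
        intro k hk
        rw [Finset.mem_Icc] at hk
        exact ih k (by omega) hk.1
      filter_upwards [hall, (h.law_α n hn2).ae (h.measurable_α n hn2)] with ω h1 h2
      rw [h.step n hn2 ω]
      rcases h1 _ (h.mem_β n hn2 ω) with h3 | h3 <;> rcases h2 with h4 | h4 <;> simp [h3, h4]

lemma IsElephantWalk.ae_abs_position_le (h : IsElephantWalk P p q X α β) (n : ℕ) :
    ∀ᵐ ω ∂P, |position X n ω| ≤ n := by
  have hall : ∀ᵐ ω ∂P, ∀ k ∈ Finset.Icc 1 n, X k ω = 1 ∨ X k ω = -1 := by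
    rw [Filter.eventually_all_finset]
    intro k hk
    exact h.ae_step (Finset.mem_Icc.mp hk).1
  filter_upwards [hall] with ω hω
  unfold position
  refine (Finset.abs_sum_le_sum_abs _ _).trans ?_
  calc ∑ i ∈ Finset.Icc 1 n, |X i ω| ≤ ∑ i ∈ Finset.Icc 1 n, (1 : ℝ) := by
        apply Finset.sum_le_sum
        intro i hi
        rcases hω i hi with h1 | h1 <;> simp [h1]
    _ = n := by simp

omit [IsProbabilityMeasure P] in
/-- The expectation of a function of one remembered and possibly reversed step. -/
lemma IsElephantWalk.integral_indicator (h : IsElephantWalk P p q X α β) {n : ℕ} (hn : 1 ≤ n)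
    {k : ℕ} (hk : k ∈ Finset.Icc 1 n) (a : ℝ) {g : ℝ → ℝ} (hg : Continuous g) :
    ∫ ω, ({a} : Set ℝ).indicator 1 (α (n + 1) ω) * (({k} : Set ℕ).indicator 1 (β (n + 1) ω)
        * g (position X n ω + a * X k ω)) ∂P
      = P.real {ω | α (n + 1) ω = a} * (1 / n * ∫ ω, g (position X n ω + a * X k ω) ∂P) := by
  have hn2 : 2 ≤ n + 1 := by omega
  have hα := h.measurable_α (n + 1) hn2
  have hβ := h.measurable_β (n + 1) hn2
  have hXm : Measurable (fun ω (i : Finset.Icc 1 (n + 1 - 1)) => X i ω) :=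
    measurable_pi_lambda _ fun i => h.measurable_X i (Finset.mem_Icc.mp i.2).1
  have hk' : k ∈ Finset.Icc 1 (n + 1 - 1) := by simpa using hk
  set G : (Finset.Icc 1 (n + 1 - 1) → ℝ) → ℝ :=
    fun x => g ((∑ i, x i) + a * x ⟨k, hk'⟩) with hG
  have hGm : Measurable G := by
    apply hg.measurable.comp
    fun_prop
  have hGe : ∀ ω, G (fun i : Finset.Icc 1 (n + 1 - 1) => X i ω)
      = g (position X n ω + a * X k ω) := by
    intro ω
    simp only [hG, position]
    congr 2
    exact Finset.sum_coe_sort (Finset.Icc 1 (n + 1 - 1)) (fun i => X i ω)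
  have ind1 : Measurable (({a} : Set ℝ).indicator (1 : ℝ → ℝ)) :=
    measurable_one.indicator (measurableSet_singleton a)
  have ind2 : Measurable (({k} : Set ℕ).indicator (1 : ℕ → ℝ)) :=
    measurable_one.indicator (measurableSet_singleton k)
  have e1 := (h.indep_α (n + 1) hn2).integral_fun_comp_mul_comp
    (f := ({a} : Set ℝ).indicator (1 : ℝ → ℝ))
    (g := fun z : ℕ × (Finset.Icc 1 (n + 1 - 1) → ℝ) =>
      ({k} : Set ℕ).indicator (1 : ℕ → ℝ) z.1 * G z.2) hα.aemeasurable
    (hβ.prodMk hXm).aemeasurable ind1.aestronglyMeasurable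
    ((ind2.comp measurable_fst).mul (hGm.comp measurable_snd)).aestronglyMeasurable
  have e2 := (h.indep_β (n + 1) hn2).integral_fun_comp_mul_comp
    (f := ({k} : Set ℕ).indicator (1 : ℕ → ℝ)) (g := G) hβ.aemeasurable hXm.aemeasurable
    ind2.aestronglyMeasurable hGm.aestronglyMeasurable
  simp only [hGe] at e1 e2
  rw [e1, e2]
  have c1 : ∫ ω, ({a} : Set ℝ).indicator (1 : ℝ → ℝ) (α (n + 1) ω) ∂P
      = P.real {ω | α (n + 1) ω = a} := by
    have : (fun ω => ({a} : Set ℝ).indicator (1 : ℝ → ℝ) (α (n + 1) ω))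
        = {ω | α (n + 1) ω = a}.indicator 1 := by
      ext ω; simp [Set.indicator_apply]
    have hm : MeasurableSet {ω | α (n + 1) ω = a} := hα (measurableSet_singleton a)
    rw [this, integral_indicator_one hm]
  have c2 : ∫ ω, ({k} : Set ℕ).indicator (1 : ℕ → ℝ) (β (n + 1) ω) ∂P = 1 / n := by
    have : (fun ω => ({k} : Set ℕ).indicator (1 : ℕ → ℝ) (β (n + 1) ω))
        = {ω | β (n + 1) ω = k}.indicator 1 := by
      ext ω; simp [Set.indicator_apply]
    have hm : MeasurableSet {ω | β (n + 1) ω = k} := hβ (measurableSet_singleton k)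
    rw [this, integral_indicator_one hm,
      h.law_β (n + 1) hn2 k hk']
    push_cast; ring_nf
  rw [c1, c2]

/-- This is the Markov property of T_n. The law of the next step depends on the past only through
the mean of X_1, ..., X_n, that is through T_n / n. -/
lemma IsElephantWalk.integral_position_succ (h : IsElephantWalk P p q X α β) {n : ℕ}
    (hn : 1 ≤ n) {g : ℝ → ℝ} (hg : Continuous g) :
    ∫ ω, g (position X (n + 1) ω) ∂P
      = ∫ ω, ((1 + (2 * p - 1) / n * position X n ω) / 2 * g (position X n ω + 1)
          + (1 - (2 * p - 1) / n * position X n ω) / 2 * g (position X n ω - 1)) ∂P := by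
  have hn2 : 2 ≤ n + 1 := by omega
  have hn0 : (n : ℝ) ≠ 0 := by
    have : (0 : ℝ) < n := by exact_mod_cast hn
    exact this.ne'
  have hTm := h.measurable_position n
  have hTb := h.ae_abs_position_le n
  have hall : ∀ᵐ ω ∂P, ∀ k ∈ Finset.Icc 1 n, X k ω = 1 ∨ X k ω = -1 := by
    rw [Filter.eventually_all_finset]
    intro k hk
    exact h.ae_step (Finset.mem_Icc.mp hk).1
  have hint : ∀ k ∈ Finset.Icc 1 n, ∀ a : ℝ, |a| ≤ 1 →
      Integrable (fun ω => g (position X n ω + a * X k ω)) P := by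
    intro k hk a ha
    apply integrable_comp_of_ae_bounded (R := n + 1)
      (hTm.add ((h.measurable_X k (Finset.mem_Icc.mp hk).1).const_mul a)) _ hg
    filter_upwards [hTb, hall] with ω h1 h2
    refine (abs_add_le _ _).trans (add_le_add h1 ?_)
    rw [abs_mul]
    rcases h2 k hk with h3 | h3 <;> simp [h3, ha]
  -- splitting according to the remembered time and its sign
  have hsplit : ∀ᵐ ω ∂P, g (position X (n + 1) ω) = ∑ k ∈ Finset.Icc 1 n,
      (({1} : Set ℝ).indicator (1 : ℝ → ℝ) (α (n + 1) ω)
          * (({k} : Set ℕ).indicator (1 : ℕ → ℝ) (β (n + 1) ω) * g (position X n ω + 1 * X k ω))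
        + ({-1} : Set ℝ).indicator (1 : ℝ → ℝ) (α (n + 1) ω)
          * (({k} : Set ℕ).indicator (1 : ℕ → ℝ) (β (n + 1) ω)
            * g (position X n ω + (-1) * X k ω))) := by
    filter_upwards [(h.law_α (n + 1) hn2).ae (h.measurable_α (n + 1) hn2)] with ω hω
    have hb : β (n + 1) ω ∈ Finset.Icc 1 n := by simpa using h.mem_β (n + 1) hn2 ω
    have hT : position X (n + 1) ω = position X n ω + α (n + 1) ω * X (β (n + 1) ω) ω := by
      unfold position
      rw [Finset.sum_Icc_succ_top (by omega), h.step (n + 1) hn2 ω]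
    rw [Finset.sum_eq_single_of_mem _ hb]
    · rcases hω with h1 | h1
      · simp [hT, h1, show ¬ ((1 : ℝ) = -1) by norm_num]
      · simp [hT, h1, show ¬ ((-1 : ℝ) = 1) by norm_num]
    · intro k _ hk
      have : ¬ (β (n + 1) ω = k) := fun e => hk e.symm
      simp [Set.indicator_apply, this]
  have hintI : ∀ k ∈ Finset.Icc 1 n, ∀ a : ℝ, |a| ≤ 1 →
      Integrable (fun ω => ({a} : Set ℝ).indicator (1 : ℝ → ℝ) (α (n + 1) ω)
          * (({k} : Set ℕ).indicator (1 : ℕ → ℝ) (β (n + 1) ω)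
            * g (position X n ω + a * X k ω))) P := by
    intro k hk a ha
    have ind1 : Measurable (({a} : Set ℝ).indicator (1 : ℝ → ℝ)) :=
      measurable_one.indicator (measurableSet_singleton a)
    have ind2 : Measurable (({k} : Set ℕ).indicator (1 : ℕ → ℝ)) :=
      measurable_one.indicator (measurableSet_singleton k)
    apply Integrable.bdd_mul (c := 1) _ (ind1.comp (h.measurable_α (n + 1) hn2)).aestronglyMeasurable
    · refine ae_of_all _ fun ω => ?_
      simp only [Set.indicator_apply, Function.comp]
      split_ifs <;> simp
    · apply Integrable.bdd_mul (c := 1) (hint k hk a ha)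
        (ind2.comp (h.measurable_β (n + 1) hn2)).aestronglyMeasurable
      refine ae_of_all _ fun ω => ?_
      simp only [Set.indicator_apply, Function.comp]
      split_ifs <;> simp
  rw [integral_congr_ae hsplit, integral_finsetSum]
  swap
  · exact fun k hk => (hintI k hk 1 (by simp)).add (hintI k hk (-1) (by simp))
  have hterm : ∀ k ∈ Finset.Icc 1 n, ∫ ω, (({1} : Set ℝ).indicator (1 : ℝ → ℝ) (α (n + 1) ω)
          * (({k} : Set ℕ).indicator (1 : ℕ → ℝ) (β (n + 1) ω) * g (position X n ω + 1 * X k ω))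
        + ({-1} : Set ℝ).indicator (1 : ℝ → ℝ) (α (n + 1) ω)
          * (({k} : Set ℕ).indicator (1 : ℕ → ℝ) (β (n + 1) ω)
            * g (position X n ω + (-1) * X k ω))) ∂P
      = ∫ ω, (p * (1 / n)) * g (position X n ω + 1 * X k ω)
          + ((1 - p) * (1 / n)) * g (position X n ω + (-1) * X k ω) ∂P := by
    intro k hk
    rw [integral_add (hintI k hk 1 (by simp)) (hintI k hk (-1) (by simp)),
      h.integral_indicator hn hk 1 hg, h.integral_indicator hn hk (-1) hg,
      (h.law_α (n + 1) hn2).1, (h.law_α (n + 1) hn2).2,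
      integral_add ((hint k hk 1 (by simp)).const_mul _) ((hint k hk (-1) (by simp)).const_mul _),
      integral_const_mul, integral_const_mul]
    ring
  rw [Finset.sum_congr rfl hterm, ← integral_finsetSum]
  swap
  · exact fun k hk =>
      ((hint k hk 1 (by simp)).const_mul _).add ((hint k hk (-1) (by simp)).const_mul _)
  apply integral_congr_ae
  filter_upwards [hall] with ω hω
  -- As X k = ±1, the term is affine in X k, so the sum over k sees only the position.
  have hterm2 : ∀ k ∈ Finset.Icc 1 n, p * (1 / n) * g (position X n ω + 1 * X k ω)
      + (1 - p) * (1 / n) * g (position X n ω + (-1) * X k ω)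
      = (1 / n) * ((1 + (2 * p - 1) * X k ω) / 2 * g (position X n ω + 1)
          + (1 - (2 * p - 1) * X k ω) / 2 * g (position X n ω - 1)) := by
    intro k hk
    rcases hω k hk with h1 | h1
    · rw [h1, one_mul, show position X n ω + -1 * 1 = position X n ω - 1 by ring]; ring
    · rw [h1, show position X n ω + 1 * -1 = position X n ω - 1 by ring,
        show position X n ω + -1 * -1 = position X n ω + 1 by ring]; ring
  rw [Finset.sum_congr rfl hterm2, ← Finset.mul_sum, Finset.sum_add_distrib, ← Finset.sum_mul,
    ← Finset.sum_mul, ← Finset.sum_div, ← Finset.sum_div, Finset.sum_add_distrib,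
    Finset.sum_sub_distrib, ← Finset.mul_sum]
  have hcard : ∑ _k ∈ Finset.Icc 1 n, (1 : ℝ) = n := by simp
  rw [hcard, show ∑ i ∈ Finset.Icc 1 n, X i ω = position X n ω from rfl]
  field_simp

/-- Expectations of functions of the position of the elephant random walk. -/
theorem IsElephantWalk.integral_position (h : IsElephantWalk P p q X α β) {n : ℕ} (hn : 1 ≤ n)
    {g : ℝ → ℝ} (hg : Continuous g) :
    ∫ ω, g (position X n ω) ∂P = walkExp (2 * p - 1) q n (fun k => g k) := by
  induction n, hn using Nat.le_induction generalizing g with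
  | base =>
    have e1 : ∀ ω, position X 1 ω = X 1 ω := fun ω => by simp [position]
    simp only [e1]
    have hX := h.measurable_X 1 le_rfl
    have m1 : MeasurableSet {ω | X 1 ω = 1} := hX (measurableSet_singleton 1)
    have m2 : MeasurableSet {ω | X 1 ω = -1} := hX (measurableSet_singleton (-1))
    have : ∀ᵐ ω ∂P, g (X 1 ω) = {ω | X 1 ω = 1}.indicator (fun _ => g 1) ω
        + {ω | X 1 ω = -1}.indicator (fun _ => g (-1)) ω := by
      filter_upwards [h.first_step.ae hX] with ω hω
      rcases hω with h1 | h1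
      · simp [h1, show ¬ ((1 : ℝ) = -1) by norm_num]
      · simp [h1, show ¬ ((-1 : ℝ) = 1) by norm_num]
    rw [integral_congr_ae this, integral_add ((integrable_const _).indicator m1)
      ((integrable_const _).indicator m2), integral_indicator_const _ m1,
      integral_indicator_const _ m2, h.first_step.1, h.first_step.2]
    simp [walkExp]
  | succ n hn ih =>
    rw [h.integral_position_succ hn hg, walkExp_succ _ _ hn]
    have := ih (g := fun x => (1 + (2 * p - 1) / n * x) / 2 * g (x + 1)
      + (1 - (2 * p - 1) / n * x) / 2 * g (x - 1)) (by fun_prop)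
    rw [this]
    congr 1
    ext k
    simp only [walkOp]
    push_cast
    rw [add_zero, sub_zero]
end

/-! ### The quantile coupling and the Wasserstein distance -/

/-- The quantile function of `μ` on `(0, 1)`, extended by zero. -/
noncomputable def quantile (μ : Measure ℝ) : ℝ → ℝ :=
  (Set.Ioo 0 1).indicator fun u => sInf {x | u ≤ cdf μ x}

/-- Right-continuity of the distribution function puts the infimum in the set. This Galois
connection yields the measurability and the law of the quantile function. -/
lemma quantile_le_iff (μ : Measure ℝ) [IsProbabilityMeasure μ] {u : ℝ} (hu : u ∈ Set.Ioo (0 : ℝ) 1)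
    (t : ℝ) : quantile μ u ≤ t ↔ u ≤ cdf μ t := by
  rw [quantile, Set.indicator_of_mem hu]
  have hne : {x | u ≤ cdf μ x}.Nonempty :=
    (((tendsto_cdf_atTop μ).eventually (lt_mem_nhds hu.2)).exists).imp fun _ h => h.le
  obtain ⟨b, hb⟩ := ((tendsto_cdf_atBot μ).eventually (gt_mem_nhds hu.1)).exists
  have hbdd : BddBelow {x | u ≤ cdf μ x} := by
    refine ⟨b, fun x hx => ?_⟩
    by_contra! hxb
    exact absurd (hx.trans (monotone_cdf μ hxb.le)) (not_le.mpr hb)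
  constructor
  · intro h
    have hright : Filter.Tendsto (cdf μ) (nhdsWithin t (Set.Ioi t)) (nhds (cdf μ t)) :=
      ((cdf μ).right_continuous t).mono_left (nhdsWithin_mono _ Set.Ioi_subset_Ici_self)
    refine ge_of_tendsto hright ?_
    filter_upwards [self_mem_nhdsWithin] with s (hs : t < s)
    obtain ⟨x, hx, hxs⟩ := exists_lt_of_csInf_lt hne (h.trans_lt hs)
    exact le_trans hx (monotone_cdf μ hxs.le)
  · exact fun h => csInf_le hbdd h

lemma measurable_quantile (μ : Measure ℝ) [IsProbabilityMeasure μ] : Measurable (quantile μ) := by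
  refine measurable_of_Iic fun t => ?_
  have e : quantile μ ⁻¹' Set.Iic t = (Set.Ioo 0 1 ∩ Set.Iic (cdf μ t)) ∪
      ((Set.Ioo 0 1)ᶜ ∩ {_u | (0 : ℝ) ≤ t}) := by
    ext u
    by_cases hu : u ∈ Set.Ioo (0 : ℝ) 1
    · simp [quantile_le_iff μ hu, hu.1, hu.2]
    · have : quantile μ u = 0 := Set.indicator_of_notMem hu _
      simp only [Set.mem_preimage, this, Set.mem_union, Set.mem_inter_iff, hu, Set.mem_compl_iff]
      simp
  rw [e]
  exact (measurableSet_Ioo.inter measurableSet_Iic).union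
    (measurableSet_Ioo.compl.inter (MeasurableSet.const _))

lemma map_quantile (μ : Measure ℝ) [IsProbabilityMeasure μ] :
    (volume.restrict (Set.Ioo (0 : ℝ) 1)).map (quantile μ) = μ := by
  have : IsProbabilityMeasure (volume.restrict (Set.Ioo (0 : ℝ) 1)) := ⟨by simp⟩
  have := Measure.isProbabilityMeasure_map (μ := volume.restrict (Set.Ioo (0 : ℝ) 1))
    (measurable_quantile μ).aemeasurable
  refine Measure.ext_of_Iic _ _ fun t => ?_
  rw [Measure.map_apply (measurable_quantile μ) measurableSet_Iic, ← ofReal_cdf,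
    Measure.restrict_apply (measurable_quantile μ measurableSet_Iic)]
  have e : quantile μ ⁻¹' Set.Iic t ∩ Set.Ioo 0 1 = Set.Iic (cdf μ t) ∩ Set.Ioo 0 1 := by
    ext u
    simp only [Set.mem_inter_iff, Set.mem_preimage, Set.mem_Iic]
    exact and_congr_left fun hu => quantile_le_iff μ hu t
  rw [e]
  apply le_antisymm
  · calc volume (Set.Iic (cdf μ t) ∩ Set.Ioo 0 1) ≤ volume (Set.Ioc 0 (cdf μ t)) :=
          measure_mono fun u hu => ⟨hu.2.1, hu.1⟩
      _ = ENNReal.ofReal (cdf μ t) := by simp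
  · calc ENNReal.ofReal (cdf μ t) = volume (Set.Ioo 0 (cdf μ t)) := by simp
      _ ≤ volume (Set.Iic (cdf μ t) ∩ Set.Ioo 0 1) :=
          measure_mono fun u hu => ⟨hu.2.le, hu.1, hu.2.trans_le (cdf_le_one μ t)⟩

/-- The left side is the area of the region where `quantile μ u` ≤ t < `quantile ν u`. By Tonelli it
can be sliced at fixed t, where u must lie between the two distribution functions. -/
lemma lintegral_volume_quantile_le (μ ν : Measure ℝ) [IsProbabilityMeasure μ]
    [IsProbabilityMeasure ν] :
    ∫⁻ u in Set.Ioo 0 1, volume (Set.Ico (quantile μ u) (quantile ν u))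
      ≤ ∫⁻ t, ENNReal.ofReal (cdf μ t - cdf ν t) := by
  have hm := measurable_quantile μ
  have hm' := measurable_quantile ν
  have hS : MeasurableSet {z : ℝ × ℝ | quantile μ z.1 ≤ z.2 ∧ z.2 < quantile ν z.1} :=
    (measurableSet_le (hm.comp measurable_fst) measurable_snd).inter
      (measurableSet_lt measurable_snd (hm'.comp measurable_fst))
  have h1 := Measure.prod_apply (μ := volume.restrict (Set.Ioo (0 : ℝ) 1)) (ν := volume) hS
  have h2 := Measure.prod_apply_symm (μ := volume.restrict (Set.Ioo (0 : ℝ) 1)) (ν := volume) hS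
  calc ∫⁻ u in Set.Ioo 0 1, volume (Set.Ico (quantile μ u) (quantile ν u))
      = _ := h1.symm
    _ = _ := h2
    _ ≤ _ := by
      refine lintegral_mono fun t => ?_
      rw [Measure.restrict_apply (measurable_prodMk_right hS)]
      calc _ ≤ volume (Set.Ioc (cdf ν t) (cdf μ t)) := by
            refine measure_mono ?_
            rintro u ⟨⟨h3, h4⟩, h5⟩
            refine ⟨?_, (quantile_le_iff μ h5 t).mp h3⟩
            by_contra! h6
            exact absurd ((quantile_le_iff ν h5 t).mpr h6) (not_le.mpr h4)
        _ = _ := by simp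

/-- The quantile coupling has transport cost at most the `L¹` distance of the distribution
functions. -/
lemma wassersteinOne_le_lintegral_cdf (μ ν : Measure ℝ) [IsProbabilityMeasure μ]
    [IsProbabilityMeasure ν] :
    wassersteinOne μ ν ≤ ∫⁻ t, ENNReal.ofReal |cdf μ t - cdf ν t| := by
  have hm := measurable_quantile μ
  have hm' := measurable_quantile ν
  have hmeas : ∀ x : Measure ℝ, Measurable (cdf x) := fun x => (monotone_cdf x).measurable
  refine (iInf₂_le ((volume.restrict (Set.Ioo (0 : ℝ) 1)).map fun u => (quantile μ u, quantile ν u))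
    ⟨?_, ?_⟩).trans ?_
  rotate_left
  · rw [Measure.map_map measurable_fst (hm.prodMk hm')]; exact map_quantile μ
  · rw [Measure.map_map measurable_snd (hm.prodMk hm')]; exact map_quantile ν
  rw [lintegral_map (by fun_prop) (hm.prodMk hm')]
  have e1 : ∀ a b : ℝ, ENNReal.ofReal |a - b| = ENNReal.ofReal (b - a) + ENNReal.ofReal (a - b) := by
    intro a b
    rcases le_total a b with h | h
    · rw [ENNReal.ofReal_of_nonpos (sub_nonpos.mpr h), add_zero, abs_of_nonpos (sub_nonpos.mpr h),
        neg_sub]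
    · rw [ENNReal.ofReal_of_nonpos (sub_nonpos.mpr h), zero_add, abs_of_nonneg (sub_nonneg.mpr h)]
  simp only [e1]
  have hcm : Measurable fun t => ENNReal.ofReal (cdf ν t - cdf μ t) :=
    ((hmeas ν).sub (hmeas μ)).ennreal_ofReal
  rw [lintegral_add_left (by fun_prop), lintegral_add_left hcm]
  have h1 := lintegral_volume_quantile_le μ ν
  have h2 := lintegral_volume_quantile_le ν μ
  simp only [Real.volume_Ico] at h1 h2
  exact (add_le_add h1 h2).trans_eq (add_comm _ _)

/-- Test function whose integral against `μ` is `∫ t in [-R, R], σ t * cdf μ t`. -/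
noncomputable def stepMixture (σ : ℝ → ℝ) (R x : ℝ) : ℝ :=
  ∫ t in Set.Icc (-R) R, σ t * (Set.Ici x).indicator 1 t

section
variable {σ : ℝ → ℝ} (hσ : Measurable σ) (hσ1 : ∀ t, |σ t| ≤ 1)
include hσ hσ1

lemma integrableOn_stepMixture (R x : ℝ) :
    IntegrableOn (fun t => σ t * (Set.Ici x).indicator (1 : ℝ → ℝ) t) (Set.Icc (-R) R) := by
  refine Integrable.of_bound
    (hσ.mul (measurable_one.indicator measurableSet_Ici)).aestronglyMeasurable 1
    (ae_of_all _ fun t => ?_)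
  rw [norm_mul, Real.norm_eq_abs]
  refine mul_le_one₀ (hσ1 t) (norm_nonneg _) ?_
  rw [Set.indicator_apply]; split_ifs <;> simp

lemma abs_stepMixture_sub_le (R x y : ℝ) :
    |stepMixture σ R x - stepMixture σ R y| ≤ |x - y| := by
  wlog hxy : x ≤ y generalizing x y
  · rw [abs_sub_comm, abs_sub_comm x]; exact this y x (le_of_not_ge hxy)
  unfold stepMixture
  rw [← integral_sub (integrableOn_stepMixture hσ hσ1 R x) (integrableOn_stepMixture hσ hσ1 R y)]
  have hind : Integrable ((Set.Ico x y).indicator (1 : ℝ → ℝ)) :=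
    (integrable_indicator_iff measurableSet_Ico).mpr (integrableOn_const (by simp))
  calc _ ≤ ∫ t in Set.Icc (-R) R, (Set.Ico x y).indicator (1 : ℝ → ℝ) t := by
        rw [← Real.norm_eq_abs]
        refine norm_integral_le_of_norm_le hind.integrableOn (ae_of_all _ fun t => ?_)
        rw [← mul_sub, norm_mul, Real.norm_eq_abs, Real.norm_eq_abs]
        have h1 := hσ1 t
        have h2 : |(Set.Ici x).indicator (1 : ℝ → ℝ) t - (Set.Ici y).indicator (1 : ℝ → ℝ) t|
            = (Set.Ico x y).indicator (1 : ℝ → ℝ) t := by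
          simp only [Set.indicator_apply, Set.mem_Ici, Set.mem_Ico, Pi.one_apply]
          by_cases h3 : x ≤ t <;> by_cases h4 : y ≤ t
          · simp [h3, h4]
          · simp [h3, h4, not_le.mp h4]
          · exact absurd (hxy.trans h4) h3
          · simp [h3, h4]
        rw [h2]
        have h5 : 0 ≤ (Set.Ico x y).indicator (1 : ℝ → ℝ) t :=
          Set.indicator_nonneg (fun _ _ => zero_le_one) t
        nlinarith
    _ ≤ ∫ t, (Set.Ico x y).indicator (1 : ℝ → ℝ) t :=
        integral_mono_measure Measure.restrict_le_self
          (ae_of_all _ fun t => Set.indicator_nonneg (fun _ _ => zero_le_one) t) hind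
    _ = |x - y| := by
        rw [integral_indicator_one measurableSet_Ico, abs_sub_comm,
          abs_of_nonneg (sub_nonneg.mpr hxy)]
        simp [Measure.real, hxy]

lemma integral_stepMixture (μ : Measure ℝ) [IsProbabilityMeasure μ] (R : ℝ) :
    ∫ x, stepMixture σ R x ∂μ = ∫ t in Set.Icc (-R) R, σ t * cdf μ t := by
  unfold stepMixture
  rw [integral_integral_swap]
  · refine integral_congr_ae (ae_of_all _ fun t => ?_)
    dsimp only
    rw [integral_const_mul, cdf_eq_real, ← integral_indicator_one measurableSet_Iic]
    rfl
  · have hS : MeasurableSet {z : ℝ × ℝ | z.1 ≤ z.2} := measurableSet_le measurable_fst measurable_snd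
    have e : (Function.uncurry fun x t => σ t * (Set.Ici x).indicator (1 : ℝ → ℝ) t)
        = fun z : ℝ × ℝ => σ z.2 * {z : ℝ × ℝ | z.1 ≤ z.2}.indicator (1 : ℝ × ℝ → ℝ) z := by
      ext z; rfl
    rw [e]
    refine Integrable.of_bound ((hσ.comp measurable_snd).mul
      (measurable_one.indicator hS)).aestronglyMeasurable 1 (ae_of_all _ fun z => ?_)
    rw [norm_mul, Real.norm_eq_abs]
    refine mul_le_one₀ (hσ1 _) (norm_nonneg _) ?_
    rw [Set.indicator_apply]; split_ifs <;> simp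
end

/-- The Wasserstein distance is controlled by the integrals of `1`-Lipschitz functions. -/
theorem wassersteinOne_le_of_lipschitz (μ ν : Measure ℝ) [IsProbabilityMeasure μ]
    [IsProbabilityMeasure ν] {b : ℝ}
    (hb : ∀ f : ℝ → ℝ, (∀ x y, |f x - f y| ≤ |x - y|) → ∫ x, f x ∂μ - ∫ x, f x ∂ν ≤ b) :
    wassersteinOne μ ν ≤ ENNReal.ofReal b := by
  refine (wassersteinOne_le_lintegral_cdf μ ν).trans ?_
  have hmeas : ∀ x : Measure ℝ, Measurable (cdf x) := fun x => (monotone_cdf x).measurable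
  set G : ℝ → ℝ := fun t => cdf μ t - cdf ν t with hG
  have hGm : Measurable G := (hmeas μ).sub (hmeas ν)
  -- With the sign of G as density, the step mixture is a Lipschitz function that realizes the L¹
  -- distance on a window.
  set σ : ℝ → ℝ := fun t => if 0 ≤ G t then 1 else -1 with hσd
  have hσ : Measurable σ :=
    Measurable.ite (measurableSet_le measurable_const hGm) measurable_const measurable_const
  have hσ1 : ∀ t, |σ t| ≤ 1 := by intro t; simp only [hσd]; split_ifs <;> simp
  have hσG : ∀ t, σ t * G t = |G t| := by
    intro t
    simp only [hσd]
    split_ifs with h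
    · rw [one_mul, abs_of_nonneg h]
    · rw [abs_of_neg (not_le.mp h), neg_one_mul]
  have hfin : ∀ x : Measure ℝ, ∀ R, IntegrableOn (fun t => σ t * cdf x t) (Set.Icc (-R) R) := by
    intro x R
    refine Integrable.of_bound (hσ.mul (hmeas x)).aestronglyMeasurable 1 (ae_of_all _ fun t => ?_)
    rw [norm_mul, Real.norm_eq_abs, Real.norm_eq_abs, abs_of_nonneg (cdf_nonneg x t)]
    exact mul_le_one₀ (hσ1 t) (cdf_nonneg x t) (cdf_le_one x t)
  -- The window is needed because the distribution functions are not separately integrable; it is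
  -- then exhausted by monotone convergence.
  have hlim := (aecover_Icc (μ := (volume : Measure ℝ)) Filter.tendsto_neg_atTop_atBot
    Filter.tendsto_id).lintegral_tendsto_of_countably_generated
    (f := fun t => ENNReal.ofReal |G t|) hGm.abs.ennreal_ofReal.aemeasurable
  refine le_of_tendsto' hlim fun R => ?_
  have hint : IntegrableOn (fun t => |G t|) (Set.Icc (-R) R) := by
    have := (hfin μ R).sub (hfin ν R)
    refine this.congr (ae_of_all _ fun t => ?_)
    simp only [Pi.sub_apply, ← mul_sub]
    exact hσG t
  simp only [id]
  rw [← ofReal_integral_eq_lintegral_ofReal hint (ae_of_all _ fun t => abs_nonneg _)]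
  apply ENNReal.ofReal_le_ofReal
  have := hb (stepMixture σ R) (abs_stepMixture_sub_le hσ hσ1 R)
  rw [integral_stepMixture hσ hσ1, integral_stepMixture hσ hσ1,
    ← integral_sub (hfin μ R) (hfin ν R)] at this
  refine le_trans (le_of_eq ?_) this
  refine integral_congr_ae (ae_of_all _ fun t => ?_)
  simp only [← mul_sub]
  exact (hσG t).symm

/-! ### The normalizing sequences -/

section
variable {p : ℝ} (hp : 0 < p)
include hp

lemma aSeq_pos {n : ℕ} (hn : 1 ≤ n) : 0 < aSeq p n := by
  have hn' : (1 : ℝ) ≤ n := by exact_mod_cast hn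
  exact div_pos (mul_pos (Real.Gamma_pos_of_pos (by linarith)) (Real.Gamma_pos_of_pos (by linarith)))
    (Real.Gamma_pos_of_pos (by linarith))

lemma aSeq_one : aSeq p 1 = 1 := by
  have : Real.Gamma (2 * p) ≠ 0 := (Real.Gamma_pos_of_pos (by linarith)).ne'
  rw [aSeq, Nat.cast_one, Real.Gamma_one, one_mul, show 1 + 2 * p - 1 = 2 * p by ring, div_self this]

lemma aSeq_succ {n : ℕ} (hn : 1 ≤ n) :
    (1 + (2 * p - 1) / n) * aSeq p (n + 1) = aSeq p n := by
  have hn' : (1 : ℝ) ≤ n := by exact_mod_cast hn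
  have h0 : (n : ℝ) + 2 * p - 1 ≠ 0 := by linarith
  have hn0 : (n : ℝ) ≠ 0 := by linarith
  have hG : Real.Gamma (n + 2 * p - 1) ≠ 0 := (Real.Gamma_pos_of_pos (by linarith)).ne'
  rw [aSeq, aSeq, Nat.cast_add_one, Real.Gamma_add_one hn0,
    show (n : ℝ) + 1 + 2 * p - 1 = (n + 2 * p - 1) + 1 by ring, Real.Gamma_add_one h0]
  field_simp
  ring

lemma walkMean_eq (q : ℝ) {n : ℕ} (hn : 1 ≤ n) :
    walkMean (2 * p - 1) q n * aSeq p n = 2 * q - 1 := by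
  induction n, hn using Nat.le_induction with
  | base => rw [walkMean_one, aSeq_one hp, mul_one]
  | succ n hn ih =>
    rw [walkMean_succ _ _ hn, ← ih, ← aSeq_succ hp hn]; ring

lemma vSeq_pos {n : ℕ} (hn : 1 ≤ n) : 0 < vSeq p n := by
  refine Finset.sum_pos (fun i hi => pow_pos (aSeq_pos hp (Finset.mem_Icc.mp hi).1) 2) ⟨1, ?_⟩
  simp [hn]

omit hp in
variable (p) in
/-- The variance scale `v_n / a_n ^ 2`. -/
noncomputable def varScale (n : ℕ) : ℝ := vSeq p n / aSeq p n ^ 2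

lemma varScale_pos {n : ℕ} (hn : 1 ≤ n) : 0 < varScale p n :=
  div_pos (vSeq_pos hp hn) (pow_pos (aSeq_pos hp hn) 2)

lemma varScale_one : varScale p 1 = 1 := by
  simp [varScale, vSeq, aSeq_one hp]

lemma varScale_succ {n : ℕ} (hn : 1 ≤ n) :
    varScale p (n + 1) = (1 + (2 * p - 1) / n) ^ 2 * varScale p n + 1 := by
  have h1 := aSeq_pos hp hn
  have h2 := aSeq_pos hp (n := n + 1) (by omega)
  have e : 1 + (2 * p - 1) / n = aSeq p n / aSeq p (n + 1) := by
    rw [eq_div_iff h2.ne', aSeq_succ hp hn]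
  rw [varScale, varScale, e, vSeq, Finset.sum_Icc_succ_top (by omega)]
  rw [show ∑ i ∈ Finset.Icc 1 n, aSeq p i ^ 2 = vSeq p n from rfl]
  field_simp

/-- In the induction (1 + c/n)² n ≥ n + 2c. The constant 1 + 2|c| multiplies the added 1 and so
compensates a negative 2c. -/
lemma le_varScale {n : ℕ} (hn : 1 ≤ n) : n ≤ (1 + 2 * |2 * p - 1|) * varScale p n := by
  set c := 2 * p - 1 with hc
  have ha := abs_nonneg c
  induction n, hn using Nat.le_induction with
  | base => rw [varScale_one hp]; push_cast; linarith
  | succ n hn ih =>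
    have hn' : (0 : ℝ) < n := by exact_mod_cast hn
    rw [varScale_succ hp hn, ← hc]
    have h1 : (1 + c / n) ^ 2 * n ≤ (1 + c / n) ^ 2 * ((1 + 2 * |c|) * varScale p n) := by gcongr
    have h2 : n + 2 * c ≤ (1 + c / n) ^ 2 * n := by
      have : (1 + c / n) ^ 2 * n = n + 2 * c + c ^ 2 / n := by field_simp; ring
      rw [this]; linarith [div_nonneg (sq_nonneg c) hn'.le]
    have h3 := neg_abs_le c
    push_cast
    nlinarith

/-- Both recursions add 1, and their factors differ exactly by (c/n)². -/
lemma varScale_sub_walkSq_succ (q : ℝ) {n : ℕ} (hn : 1 ≤ n) :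
    varScale p (n + 1) - walkSq (2 * p - 1) q (n + 1)
      = (1 + 2 * ((2 * p - 1) / n)) * (varScale p n - walkSq (2 * p - 1) q n)
        + ((2 * p - 1) / n) ^ 2 * varScale p n := by
  rw [varScale_succ hp hn, walkSq_succ _ _ hn]; ring

omit hp in
lemma two_mul_div_ge {c : ℝ} (hc : -1 ≤ c) {n : ℕ} (hn : 2 ≤ n) : 0 ≤ 1 + 2 * (c / n) := by
  have hn' : (2 : ℝ) ≤ n := by exact_mod_cast hn
  have : -1 / 2 ≤ c / n := by rw [div_le_div_iff₀ (by norm_num) (by linarith)]; linarith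
  linarith

/-- The factor 1 + 2c/n can be negative only at n = 1, where the difference is zero. -/
lemma walkSq_le_varScale (q : ℝ) {n : ℕ} (hn : 1 ≤ n) :
    walkSq (2 * p - 1) q n ≤ varScale p n := by
  induction n, hn using Nat.le_induction with
  | base => rw [walkSq_one, varScale_one hp]
  | succ n hn ih =>
    have h := varScale_sub_walkSq_succ hp q hn
    have hV := varScale_pos hp hn
    have h2 : 0 ≤ ((2 * p - 1) / n) ^ 2 * varScale p n := by positivity
    rcases hn.eq_or_lt with rfl | hn2
    · rw [varScale_one hp, walkSq_one, sub_self, mul_zero, zero_add] at h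
      rw [varScale_one hp] at h2
      linarith
    · have h3 := two_mul_div_ge (c := 2 * p - 1) (by linarith) hn2
      nlinarith [mul_nonneg h3 (sub_nonneg.mpr ih)]

lemma varScale_le_of_nonpos (hc0 : 2 * p - 1 ≤ 0) {n : ℕ} (hn : 1 ≤ n) : varScale p n ≤ n := by
  induction n, hn using Nat.le_induction with
  | base => rw [varScale_one hp]; norm_num
  | succ n hn ih =>
    have hn' : (1 : ℝ) ≤ n := by exact_mod_cast hn
    rw [varScale_succ hp hn]
    have h1 : -1 ≤ (2 * p - 1) / n := by rw [le_div_iff₀ (by linarith)]; linarith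
    have h2 : (2 * p - 1) / n ≤ 0 := div_nonpos_of_nonpos_of_nonneg hc0 (by linarith)
    have h3 : (1 + (2 * p - 1) / n) ^ 2 ≤ 1 := pow_le_one₀ (by linarith) (by linarith)
    have := mul_le_of_le_one_left (varScale_pos hp hn).le h3
    push_cast
    linarith

/-- The constant -c is a supersolution: the factor 1 + 2c/n lowers it by 2c²/n, while V_n ≤ n bounds
the forcing by c²/n. -/
lemma varScale_sub_walkSq_le_of_nonpos (q : ℝ) (hc0 : 2 * p - 1 ≤ 0) {n : ℕ} (hn : 1 ≤ n) :
    varScale p n - walkSq (2 * p - 1) q n ≤ -(2 * p - 1) := by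
  induction n, hn using Nat.le_induction with
  | base => rw [varScale_one hp, walkSq_one]; linarith
  | succ n hn ih =>
    have hn' : (1 : ℝ) ≤ n := by exact_mod_cast hn
    rw [varScale_sub_walkSq_succ hp q hn]
    rcases hn.eq_or_lt with rfl | hn2
    · rw [varScale_one hp, walkSq_one]; push_cast; nlinarith
    · have h3 := two_mul_div_ge (c := 2 * p - 1) (by linarith) hn2
      have h4 : ((2 * p - 1) / n) ^ 2 * varScale p n ≤ (2 * p - 1) ^ 2 / n := by
        calc ((2 * p - 1) / n) ^ 2 * varScale p n ≤ ((2 * p - 1) / n) ^ 2 * n := by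
              gcongr; exact varScale_le_of_nonpos hp hc0 hn
          _ = _ := by field_simp
      have h5 := mul_le_mul_of_nonneg_left ih h3
      have e : (1 + 2 * ((2 * p - 1) / n)) * -(2 * p - 1)
          = -(2 * p - 1) - 2 * ((2 * p - 1) ^ 2 / n) := by ring
      have h6 : 0 ≤ (2 * p - 1) ^ 2 / n := by positivity
      linarith

/-- For c > 0 the rough bound V_n = O(n^(1+c)), valid since 2c + c² < 1 + c, gives forcing n^(2c - 1
- c), critical with margin c. -/
lemma exists_varScale_sub_walkSq_le (hp2 : p ≤ 3 / 4) (q : ℝ) : ∃ B, 0 ≤ B ∧ ∀ n : ℕ, 1 ≤ n →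
    varScale p n - walkSq (2 * p - 1) q n ≤ B * (n : ℝ) ^ (2 * max (2 * p - 1) 0) := by
  set c := 2 * p - 1 with hc
  rcases le_or_gt c 0 with h0 | h0
  · refine ⟨1, zero_le_one, fun n hn => ?_⟩
    rw [max_eq_right h0, mul_zero, Real.rpow_zero, mul_one]
    exact (varScale_sub_walkSq_le_of_nonpos hp q h0 hn).trans (by linarith)
  · obtain ⟨B, hB, hV⟩ := exists_le_rpow_of_growth_lt (x := varScale p) (κ := 2 * c + c ^ 2)
      (θ := 1 + c) (C := 1) le_rfl (by positivity) (by nlinarith) (by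
        intro n hn
        have hn' : (1 : ℝ) ≤ n := by exact_mod_cast hn
        rw [varScale_succ hp hn, ← hc, add_sub_cancel_left, one_mul]
        have h1 : 1 ≤ (n : ℝ) ^ c := Real.one_le_rpow hn' h0.le
        have h2 : (1 + c / n) ^ 2 ≤ 1 + (2 * c + c ^ 2) / n := by
          have : c ^ 2 / n ^ 2 ≤ c ^ 2 / n := by gcongr; nlinarith
          calc (1 + c / n) ^ 2 = 1 + 2 * c / n + c ^ 2 / n ^ 2 := by ring
            _ ≤ 1 + 2 * c / n + c ^ 2 / n := by linarith
            _ = _ := by ring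
        have := mul_le_mul_of_nonneg_right h2 (varScale_pos hp hn).le
        linarith)
    rw [max_eq_left h0.le]
    refine exists_le_rpow_of_growth (x := fun n => varScale p n - walkSq c q n) (κ := 2 * c)
      (ε := c) (C := c ^ 2 * B) le_rfl (by positivity) h0 (by linarith) fun n hn => ?_
    have hn' : (0 : ℝ) < n := by exact_mod_cast hn
    have h1 := varScale_sub_walkSq_succ hp q hn
    rw [h1, ← hc, ← mul_div_assoc]
    refine add_le_add le_rfl ?_
    calc (c / n) ^ 2 * varScale p n ≤ (c / n) ^ 2 * (B * (n : ℝ) ^ (1 + c)) := by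
          gcongr; exact hV n hn
      _ = c ^ 2 * B * (n : ℝ) ^ (2 * c - 1 - c) := by
          rw [show 2 * c - 1 - c = 1 + c - 2 by ring, Real.rpow_sub hn']
          have : (n : ℝ) ^ (2 : ℝ) = n ^ 2 := by norm_cast
          rw [this]; field_simp

lemma aSeq_le_rpow (hc : 0 ≤ 2 * p - 1) (hc1 : 2 * p - 1 ≤ 1) {n : ℕ} (hn : 1 ≤ n) :
    aSeq p n * (n : ℝ) ^ (2 * p - 1) ≤ 1 := by
  induction n, hn using Nat.le_induction with
  | base => simp [aSeq_one hp]
  | succ n hn ih =>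
    have hn' : (0 : ℝ) < n := by exact_mod_cast hn
    refine le_trans ?_ ih
    rw [← aSeq_succ hp hn]
    have h1 : (1 + 1 / (n : ℝ)) ^ (2 * p - 1) ≤ 1 + (2 * p - 1) * (1 / n) :=
      rpow_one_add_le_one_add_mul_self
        ((show (-1 : ℝ) ≤ 0 by norm_num).trans (by positivity)) hc hc1
    have h2 : ((n + 1 : ℕ) : ℝ) ^ (2 * p - 1)
        = (1 + 1 / (n : ℝ)) ^ (2 * p - 1) * (n : ℝ) ^ (2 * p - 1) := by
      rw [← Real.mul_rpow (by positivity) hn'.le]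
      congr 1; push_cast; field_simp
    rw [h2]
    have h3 := aSeq_pos hp (n := n + 1) (by omega)
    calc aSeq p (n + 1) * ((1 + 1 / (n : ℝ)) ^ (2 * p - 1) * (n : ℝ) ^ (2 * p - 1))
        ≤ aSeq p (n + 1) * ((1 + (2 * p - 1) * (1 / n)) * (n : ℝ) ^ (2 * p - 1)) := by gcongr
      _ = _ := by ring

/-- Here the two terms of the rate appear. For c ≤ 0 the quotient is of order 1/n ≤ n^(-r/2), as r ≤
2. For c > 0 it is (n^c a_n)² / v_n, and n^c a_n ≤ 1. -/
lemma rpow_div_varScale_le (hp2 : p ≤ 3 / 4) {r : ℝ} (hr : r ≤ 2) {n : ℕ} (hn : 1 ≤ n) :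
    (n : ℝ) ^ (2 * max (2 * p - 1) 0) / varScale p n
      ≤ (1 + 2 * |2 * p - 1|) * (1 / (n : ℝ) ^ (r / 2) + 1 / vSeq p n) := by
  have hn' : (1 : ℝ) ≤ n := by exact_mod_cast hn
  have hn0 : (0 : ℝ) < n := by linarith
  have hv := vSeq_pos hp hn
  have hV := varScale_pos hp hn
  have ha := abs_nonneg (2 * p - 1)
  rcases le_or_gt (2 * p - 1) 0 with h0 | h0
  · rw [max_eq_right h0, mul_zero, Real.rpow_zero]
    have h1 : 1 / varScale p n ≤ (1 + 2 * |2 * p - 1|) * (1 / n) := by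
      rw [mul_one_div, div_le_div_iff₀ hV hn0, one_mul]
      exact le_varScale hp hn
    have h2 : 1 / (n : ℝ) ≤ 1 / (n : ℝ) ^ (r / 2) := by
      apply one_div_le_one_div_of_le (by positivity)
      calc (n : ℝ) ^ (r / 2) ≤ (n : ℝ) ^ (1 : ℝ) :=
            Real.rpow_le_rpow_of_exponent_le hn' (by linarith)
        _ = n := Real.rpow_one _
    refine h1.trans ?_
    gcongr
    linarith [one_div_pos.mpr hv]
  · rw [max_eq_left h0.le, varScale, div_div_eq_mul_div]
    have h1 := aSeq_le_rpow hp h0.le (by linarith) hn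
    have h2 := aSeq_pos hp hn
    have h3 : (n : ℝ) ^ (2 * (2 * p - 1)) * aSeq p n ^ 2 ≤ 1 := by
      have : (n : ℝ) ^ (2 * (2 * p - 1)) * aSeq p n ^ 2 = (aSeq p n * (n : ℝ) ^ (2 * p - 1)) ^ 2 := by
        rw [mul_comm 2, Real.rpow_mul hn0.le, Real.rpow_two]; ring
      rw [this]
      exact pow_le_one₀ (by positivity) h1
    have h4 : 0 ≤ 1 / (n : ℝ) ^ (r / 2) := by positivity
    have h5 : (n : ℝ) ^ (2 * (2 * p - 1)) * aSeq p n ^ 2 / vSeq p n ≤ 1 / vSeq p n := by gcongr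
    have h6 : 0 ≤ 1 / vSeq p n := by positivity
    nlinarith
end

/-! ### Central differences of smooth functions -/

/-- Central difference of a function of a real variable. -/
noncomputable def realDif (u : ℝ → ℝ) (x : ℝ) : ℝ := (u (x + 1) - u (x - 1)) / 2

lemma dif_intCast (u : ℝ → ℝ) : dif (fun k => u k) = fun k : ℤ => realDif u k := by
  ext k; simp [dif, realDif]

lemma HasDerivAt.realDif {u u' : ℝ → ℝ} (h : ∀ x, HasDerivAt u (u' x) x) (x : ℝ) :
    HasDerivAt (realDif u) (_root_.realDif u' x) x :=
  (((h (x + 1)).comp_add_const x 1).sub ((h (x - 1)).comp_sub_const x 1)).div_const 2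

lemma exists_hasDerivAt_eq {u u' : ℝ → ℝ} (h : ∀ x, HasDerivAt u (u' x) x) {a b : ℝ} (hab : a < b) :
    ∃ ξ ∈ Set.Ioo a b, u b - u a = (b - a) * u' ξ := by
  obtain ⟨ξ, hξ, e⟩ := exists_hasDerivAt_eq_slope u u' hab
    (fun x _ => (h x).continuousAt.continuousWithinAt) fun x _ => h x
  exact ⟨ξ, hξ, by rw [e]; field_simp [(sub_pos.mpr hab).ne']⟩

lemma abs_realDif_le {u u' : ℝ → ℝ} (h : ∀ x, HasDerivAt u (u' x) x) {B : ℝ}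
    (hB : ∀ x, |u' x| ≤ B) (x : ℝ) : |realDif u x| ≤ B := by
  obtain ⟨ξ, -, e⟩ := exists_hasDerivAt_eq h (show x - 1 < x + 1 by linarith)
  rw [realDif, e, show (x + 1 - (x - 1)) * u' ξ / 2 = u' ξ by ring]
  exact hB ξ

/-- The mean value theorem is applied to t ↦ u(x + t) - u(y + t), so the same intermediate point
serves x and y and the constant is preserved. -/
lemma RealHolder.realDif {s K : ℝ} {u u' : ℝ → ℝ} (h : ∀ x, HasDerivAt u (u' x) x)
    (hK : RealHolder s K u') : RealHolder s K (realDif u) := by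
  intro x y
  obtain ⟨ξ, -, e⟩ := exists_hasDerivAt_eq
    (fun t => ((h (x + t)).comp_const_add x t).sub ((h (y + t)).comp_const_add y t))
    (show (-1 : ℝ) < 1 by norm_num)
  have h2 : _root_.realDif u x - _root_.realDif u y = u' (x + ξ) - u' (y + ξ) := by
    simp only [Pi.sub_apply] at e
    simp only [_root_.realDif, sub_eq_add_neg] at *
    linarith
  rw [h2]
  simpa using hK (x + ξ) (y + ξ)

lemma RealHolder.holderOnBall {s K : ℝ} {u : ℝ → ℝ} (h : RealHolder s K u) (N : ℕ) :
    HolderOnBall N s K fun k => u k := fun x y _ _ => h x y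

lemma dif_avg_intCast (u : ℝ → ℝ) (k : ℤ) :
    dif (avg fun k => u k) k = (u (k + 2) - u (k - 2)) / 4 := by
  simp only [dif, avg, show k + 1 + 1 = k + 2 by ring, show k - 1 - 1 = k - 2 by ring,
    show k + 1 - 1 = k by ring, show k - 1 + 1 = k by ring]
  push_cast; ring

lemma rpow_le_two_mul {s t d : ℝ} (hs : 0 ≤ s) (hs1 : s ≤ 1) (ht : 0 ≤ t) (htd : t ≤ d)
    (hd : 1 ≤ d) : t ^ s ≤ d :=
  calc t ^ s ≤ d ^ s := Real.rpow_le_rpow ht htd hs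
    _ ≤ d ^ (1 : ℝ) := Real.rpow_le_rpow_of_exponent_le hd hs1
    _ = d := Real.rpow_one d

lemma abs_deriv_sub_dif_avg_le_low {s K : ℝ} (hs : 0 ≤ s) (hs1 : s ≤ 1) (hK0 : 0 ≤ K)
    {u u' : ℝ → ℝ} (h : ∀ x, HasDerivAt u (u' x) x) (hK : RealHolder s K u') (k : ℤ) :
    |u' k - dif (avg fun k => u k) k| ≤ 4 * K := by
  obtain ⟨ξ, hξ, e⟩ := exists_hasDerivAt_eq h (show (k : ℝ) - 2 < k + 2 by linarith)
  rw [dif_avg_intCast, e, show (k + 2 - ((k : ℝ) - 2)) * u' ξ / 4 = u' ξ by ring]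
  refine (hK (k : ℝ) ξ).trans ?_
  rw [mul_comm]
  gcongr
  refine (rpow_le_two_mul (d := 2) hs hs1 (abs_nonneg _) ?_ (by norm_num)).trans (by norm_num)
  rw [abs_le]; constructor <;> linarith [hξ.1, hξ.2]

/-- By symmetry of the difference the second derivative cancels to leading order. Only its increment
between two points at distance at most 4 remains. -/
lemma abs_deriv_sub_dif_avg_le_high {s K : ℝ} (hs : 0 ≤ s) (hs1 : s ≤ 1) (hK0 : 0 ≤ K)
    {u u' u'' : ℝ → ℝ} (h : ∀ x, HasDerivAt u (u' x) x) (h' : ∀ x, HasDerivAt u' (u'' x) x)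
    (hK : RealHolder s K u'') (k : ℤ) :
    |u' k - dif (avg fun k => u k) k| ≤ 4 * K := by
  obtain ⟨x, hx⟩ : ∃ x : ℝ, (k : ℝ) = x := ⟨_, rfl⟩
  obtain ⟨ξ, hξ, e⟩ := exists_hasDerivAt_eq
    (fun t => ((h (x + t)).comp_const_add x t).sub ((h (x - t)).comp_const_sub x t))
    (show (0 : ℝ) < 2 by norm_num)
  have e1 : u (x + 2) - u (x - 2) = 2 * (u' (x + ξ) + u' (x - ξ)) := by
    simp only [Pi.sub_apply, add_zero, sub_zero, sub_self, sub_neg_eq_add] at e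
    exact e
  obtain ⟨a, ha, ea⟩ := exists_hasDerivAt_eq h' (show x < x + ξ by linarith [hξ.1])
  obtain ⟨b, hb, eb⟩ := exists_hasDerivAt_eq h' (show x - ξ < x by linarith [hξ.1])
  have e2 : u' x - (u (x + 2) - u (x - 2)) / 4 = ξ / 2 * (u'' b - u'' a) := by
    rw [e1]; linear_combination (-1 / 2) * ea + (1 / 2) * eb
  rw [dif_avg_intCast, hx, e2, abs_mul]
  have h1 : |ξ / 2| ≤ 1 := by rw [abs_le]; constructor <;> linarith [hξ.1, hξ.2]
  have h2 : |b - a| ^ s ≤ 4 := by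
    refine rpow_le_two_mul hs hs1 (abs_nonneg _) ?_ (by norm_num)
    rw [abs_le]; constructor <;> linarith [hξ.1, hξ.2, ha.1, ha.2, hb.1, hb.2]
  calc |ξ / 2| * |u'' b - u'' a| ≤ 1 * (K * 4) := by
        gcongr
        exact (hK b a).trans (by gcongr)
    _ = 4 * K := by ring

/-! ### Rescaling -/

lemma hasDerivAt_comp_affine {g g' : ℝ → ℝ} (h : ∀ x, HasDerivAt g (g' x) x) (m σ x : ℝ) :
    HasDerivAt (fun x => g ((x - m) / σ)) (g' ((x - m) / σ) / σ) x := by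
  have h1 : HasDerivAt (fun x : ℝ => (x - m) / σ) (1 / σ) x :=
    ((hasDerivAt_id x).sub_const m).div_const σ
  have := (h ((x - m) / σ)).comp x h1
  rwa [mul_one_div] at this

lemma RealHolder.comp_affine {s L : ℝ} {g : ℝ → ℝ} (h : RealHolder s L g) (m : ℝ) {σ : ℝ}
    (hσ : 0 < σ) : RealHolder s (L / σ ^ s) fun x => g ((x - m) / σ) := by
  intro x y
  refine (h _ _).trans (le_of_eq ?_)
  rw [← sub_div, sub_sub_sub_cancel_right, abs_div, abs_of_pos hσ,
    Real.div_rpow (abs_nonneg _) hσ.le]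
  ring

lemma RealHolder.div_const {s L : ℝ} {g : ℝ → ℝ} (h : RealHolder s L g) {σ : ℝ}
    (hσ : 0 < σ) : RealHolder s (L / σ) fun x => g x / σ := by
  intro x y
  rw [← sub_div, abs_div, abs_of_pos hσ, div_le_iff₀ hσ]
  refine (h x y).trans (le_of_eq ?_)
  field_simp

/-! ### The rate of convergence for smooth test functions -/

lemma RealHolder.continuous {s L : ℝ} {h : ℝ → ℝ} (hh : RealHolder s L h) (hs : 0 < s) :
    Continuous h := by
  rw [continuous_iff_continuousAt]
  intro x
  rw [ContinuousAt, tendsto_iff_dist_tendsto_zero]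
  have hz : Filter.Tendsto (fun y => L * |y - x| ^ s) (nhds x) (nhds 0) := by
    have : Continuous fun y : ℝ => L * |y - x| ^ s :=
      continuous_const.mul ((by fun_prop : Continuous fun y : ℝ => |y - x|).rpow_const
        fun _ => Or.inr hs.le)
    have h2 := this.tendsto x
    simpa [Real.zero_rpow hs.ne'] using h2
  exact squeeze_zero (fun _ => dist_nonneg) (fun y => hh y x) hz

lemma RealHolder.exists_growth {s L : ℝ} {h : ℝ → ℝ} (hh : RealHolder s L h) (hs : 0 < s)
    (hs1 : s ≤ 1) : ∃ M, ∀ x, |h x| ≤ M * (1 + x ^ 2) := by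
  refine ⟨2 * L + |h 0|, fun x => ?_⟩
  have h1 := hh.sub_zero_le hs hs1 x
  have h2 : |h x| ≤ |h x - h 0| + |h 0| := by simpa using abs_add_le (h x - h 0) (h 0)
  nlinarith [mul_nonneg (abs_nonneg (h 0)) (sq_nonneg x)]

lemma integral_sub_integral_eq_zero {h : ℝ → ℝ} (hi : Integrable h (gaussianReal 0 1)) :
    ∫ x, (h x - ∫ y, h y ∂(gaussianReal 0 1)) ∂(gaussianReal 0 1) = 0 := by
  rw [integral_sub hi (integrable_const _)]; simp

/-- A bound valid eventually, and for every fixed index, holds for all indices. -/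
lemma exists_forall_le_of_eventually {ι : Type*} {D : ℕ → ι → Prop} {a b d : ℕ → ι → ℝ}
    (hb : ∀ n, 1 ≤ n → ∀ i, D n i → 0 ≤ b n i) (hdb : ∀ n, 1 ≤ n → ∀ i, D n i → d n i ≤ b n i)
    (h : ∃ B, 0 ≤ B ∧ ∃ n₀ : ℕ, 1 ≤ n₀ ∧ ∀ n, n₀ ≤ n → ∀ i, D n i → a n i ≤ B * b n i)
    (hfix : ∀ n, 1 ≤ n → ∃ C, 0 ≤ C ∧ ∀ i, D n i → a n i ≤ C * d n i) :
    ∃ B, 0 ≤ B ∧ ∀ n, 1 ≤ n → ∀ i, D n i → a n i ≤ B * b n i := by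
  obtain ⟨B, hB, n₀, -, hlarge⟩ := h
  have : ∀ n, ∃ C, 0 ≤ C ∧ (1 ≤ n → ∀ i, D n i → a n i ≤ C * d n i) := by
    intro n
    by_cases hn : 1 ≤ n
    · exact (hfix n hn).imp fun C hC => ⟨hC.1, fun _ => hC.2⟩
    · exact ⟨0, le_rfl, fun h => absurd h hn⟩
  choose C hC hCb using this
  have hsum : 0 ≤ ∑ k ∈ Finset.range n₀, C k := Finset.sum_nonneg fun k _ => hC k
  refine ⟨B + ∑ k ∈ Finset.range n₀, C k, by positivity, fun n hn i hi => ?_⟩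
  have h0 := hb n hn i hi
  rcases le_or_gt n₀ n with h1 | h1
  · exact (hlarge n h1 i hi).trans (by gcongr; linarith)
  · have h2 : C n ≤ ∑ k ∈ Finset.range n₀, C k :=
      Finset.single_le_sum (fun k _ => hC k) (Finset.mem_range.mpr h1)
    calc a n i ≤ C n * d n i := hCb n hn i hi
      _ ≤ C n * b n i := mul_le_mul_of_nonneg_left (hdb n hn i hi) (hC n)
      _ ≤ _ := by gcongr; linarith

lemma le_rpow_mul_of_nonneg {n : ℕ} (hn : 1 ≤ n) {e I : ℝ} (he : 0 ≤ e) (hI : 0 ≤ I) :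
    I ≤ (n : ℝ) ^ e * I :=
  le_mul_of_one_le_left hI (Real.one_le_rpow (by exact_mod_cast hn) he)

section
variable {c q s : ℝ} (hc : |c| < 1) (hq0 : 0 ≤ q) (hq1 : q ≤ 1) (hc2 : c ≤ 1 / 2) (hs : 0 < s)
  (hs1 : s ≤ 1)
include hc hq0 hq1 hc2 hs hs1

lemma exists_abs_steinDefect_le_low :
    ∃ B, 0 ≤ B ∧ ∀ n : ℕ, 1 ≤ n → ∀ (f : ℤ → ℝ) (K I : ℝ), 0 ≤ K →
      HolderOnBall (n + 2) s K (dif f) → BoundedOnBall (n + 2) I (dif f) →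
      |steinDefect c q n f| ≤ B * ((n : ℝ) ^ (max 1 (s / 2 + 2 * max c 0)) * K
        + (n : ℝ) ^ (2 * max c 0) * I) := by
  have hI : ∀ {n : ℕ} {f : ℤ → ℝ} {I : ℝ}, BoundedOnBall (n + 2) I (dif f) → 0 ≤ I :=
    fun h => (abs_nonneg _).trans (h 0 (by simp; positivity))
  have hcp : 0 ≤ max c 0 := le_max_right _ _
  obtain ⟨B, hB, h⟩ := exists_forall_le_of_eventually
    (D := fun n (i : (ℤ → ℝ) × ℝ × ℝ) => 0 ≤ i.2.1 ∧ HolderOnBall (n + 2) s i.2.1 (dif i.1) ∧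
      BoundedOnBall (n + 2) i.2.2 (dif i.1))
    (a := fun n i => |steinDefect c q n i.1|) (d := fun _ i => i.2.2)
    (b := fun n i => (n : ℝ) ^ (max 1 (s / 2 + 2 * max c 0)) * i.2.1
        + (n : ℝ) ^ (2 * max c 0) * i.2.2)
    (fun n hn i hi => by have := hI hi.2.2; have := hi.1; positivity)
    (fun n hn i hi => by
      have h1 := le_rpow_mul_of_nonneg hn (e := 2 * max c 0) (by positivity) (hI hi.2.2)
      have h2 : 0 ≤ (n : ℝ) ^ (max 1 (s / 2 + 2 * max c 0)) * i.2.1 := by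
        have := hi.1; positivity
      linarith)
    (by
      obtain ⟨B, hB, n₀, hn₀, h⟩ := exists_steinDefect_le_low hc hq0 hq1 hc2 hs hs1
      exact ⟨B, hB, n₀, hn₀, fun n hn i hi => h n hn i.1 i.2.1 i.2.2 hi.1 hi.2.1 hi.2.2⟩)
    (fun n hn => by
      obtain ⟨C, hC, h⟩ := exists_steinDefect_le_of_fixed hc.le hq0 hq1 hn
      exact ⟨C, hC, fun i hi => h i.1 i.2.2 hi.2.2⟩)
  exact ⟨B, hB, fun n hn f K I hK h1 h2 => h n hn (f, K, I) ⟨hK, h1, h2⟩⟩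

lemma exists_abs_steinDefect_le_high :
    ∃ B, 0 ≤ B ∧ ∀ n : ℕ, 1 ≤ n → ∀ (f : ℤ → ℝ) (K J I : ℝ), 0 ≤ K →
      HolderOnBall (n + 2) s K (dif (dif f)) → BoundedOnBall (n + 2) J (dif (dif f)) →
      BoundedOnBall (n + 2) I (dif f) →
      |steinDefect c q n f| ≤ B * ((n : ℝ) ^ (max 1 ((1 + s) / 2 + 2 * max c 0)) * K
        + (n : ℝ) ^ (1 / 2 + 2 * max c 0) * J + (n : ℝ) ^ (2 * max c 0) * I) := by
  have hI : ∀ {n : ℕ} {f : ℤ → ℝ} {I : ℝ}, BoundedOnBall (n + 2) I f → 0 ≤ I :=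
    fun h => (abs_nonneg _).trans (h 0 (by simp; positivity))
  have hcp : 0 ≤ max c 0 := le_max_right _ _
  obtain ⟨B, hB, h⟩ := exists_forall_le_of_eventually
    (D := fun n (i : (ℤ → ℝ) × ℝ × ℝ × ℝ) => 0 ≤ i.2.1 ∧
      HolderOnBall (n + 2) s i.2.1 (dif (dif i.1)) ∧
      BoundedOnBall (n + 2) i.2.2.1 (dif (dif i.1)) ∧ BoundedOnBall (n + 2) i.2.2.2 (dif i.1))
    (a := fun n i => |steinDefect c q n i.1|) (d := fun _ i => i.2.2.2)
    (b := fun n i => (n : ℝ) ^ (max 1 ((1 + s) / 2 + 2 * max c 0)) * i.2.1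
        + (n : ℝ) ^ (1 / 2 + 2 * max c 0) * i.2.2.1 + (n : ℝ) ^ (2 * max c 0) * i.2.2.2)
    (fun n hn i hi => by
      have := hI hi.2.2.1; have := hI hi.2.2.2; have := hi.1; positivity)
    (fun n hn i hi => by
      have h1 := le_rpow_mul_of_nonneg hn (e := 2 * max c 0) (by positivity) (hI hi.2.2.2)
      have h2 : 0 ≤ (n : ℝ) ^ (max 1 ((1 + s) / 2 + 2 * max c 0)) * i.2.1
          + (n : ℝ) ^ (1 / 2 + 2 * max c 0) * i.2.2.1 := by
        have := hI hi.2.2.1; have := hi.1; positivity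
      linarith)
    (by
      obtain ⟨B, hB, n₀, hn₀, h⟩ := exists_steinDefect_le_high hc hq0 hq1 hc2 hs hs1
      exact ⟨B, hB, n₀, hn₀, fun n hn i hi =>
        h n hn i.1 i.2.1 i.2.2.1 i.2.2.2 hi.1 hi.2.1 hi.2.2.1 hi.2.2.2⟩)
    (fun n hn => by
      obtain ⟨C, hC, h⟩ := exists_steinDefect_le_of_fixed hc.le hq0 hq1 hn
      exact ⟨C, hC, fun i hi => h i.1 i.2.2.2 hi.2.2.2⟩)
  exact ⟨B, hB, fun n hn f K J I hK h1 h2 h3 => h n hn (f, K, J, I) ⟨hK, h1, h2, h3⟩⟩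
end

/-- Stein's equation turns the smooth distance to the normal law into a Stein defect. -/
lemma abs_walkExp_le_of_stein {c q : ℝ} (hc : |c| ≤ 1) (hq0 : 0 ≤ q) (hq1 : q ≤ 1) {n : ℕ}
    (hn : 1 ≤ n) {g H : ℝ → ℝ} {σ S C E : ℝ} (hσ : 0 < σ) (hw : walkSq c q n ≤ σ ^ 2)
    (hS : |steinDefect c q n (fun k => g ((k - walkMean c q n) / σ))| ≤ S)
    (hC : ∀ x, |x * g x + H x| ≤ C)
    (hE : ∀ k : ℤ, |((k - walkMean c q n) / σ * g ((k - walkMean c q n) / σ)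
        + H ((k - walkMean c q n) / σ)) / σ
      - dif (avg fun k => g ((k - walkMean c q n) / σ)) k| ≤ E) :
    σ * |walkExp c q n (fun k => H ((k - walkMean c q n) / σ))|
      ≤ S + (σ ^ 2 - walkSq c q n) * (C / σ) + σ ^ 2 * E := by
  set m := walkMean c q n with hm
  set w := walkSq c q n with hwd
  set F : ℤ → ℝ := fun k => g ((k - m) / σ) with hF
  set F' : ℤ → ℝ := fun k => ((k - m) / σ * g ((k - m) / σ) + H ((k - m) / σ)) / σ with hF'
  have hw0 : 0 ≤ w := walkSq_nonneg hc hq0 hq1 hn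
  have hE0 : 0 ≤ E := (abs_nonneg _).trans (hE 0)
  -- Stein's equation splits into the defect, the error of using w instead of σ², and the error of
  -- using D A F instead of F'.
  have e : σ * walkExp c q n (fun k => H ((k - m) / σ)) = steinDefect c q n F
      + (σ ^ 2 - w) * walkExp c q n F' + w * walkExp c q n (fun k => F' k - dif (avg F) k) := by
    have h1 : (fun k : ℤ => σ ^ 2 * F' k - (k - m) * F k) = fun k : ℤ => σ * H ((k - m) / σ) := by
      ext k
      simp only [hF, hF']
      field_simp
      ring
    rw [walkExp_sub c q hn, steinDefect, ← walkExp_const_mul c q hn, ← h1,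
      walkExp_sub c q hn, walkExp_const_mul c q hn]
    ring
  have b1 : |walkExp c q n F'| ≤ C / σ := abs_walkExp_le_const hc hq0 hq1 hn fun k _ => by
    simp only [hF', abs_div, abs_of_pos hσ]
    gcongr
    exact hC _
  have b2 : |walkExp c q n (fun k => F' k - dif (avg F) k)| ≤ E :=
    abs_walkExp_le_const hc hq0 hq1 hn fun k _ => hE k
  calc σ * |walkExp c q n (fun k => H ((k - m) / σ))|
      = |σ * walkExp c q n (fun k => H ((k - m) / σ))| := by rw [abs_mul, abs_of_pos hσ]
    _ ≤ |steinDefect c q n F| + |(σ ^ 2 - w) * walkExp c q n F'|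
        + |w * walkExp c q n (fun k => F' k - dif (avg F) k)| := by
          rw [e]; exact abs_add_three _ _ _
    _ ≤ S + (σ ^ 2 - w) * (C / σ) + σ ^ 2 * E := by
          rw [abs_mul, abs_mul, abs_of_nonneg (sub_nonneg.mpr hw), abs_of_nonneg hw0]
          have := sub_nonneg.mpr hw
          gcongr

/-- The numerical estimate combining the error terms of Stein's method. -/
lemma rate_of_stein_terms {n : ℕ} (hn : 1 ≤ n) {σ M B C D r κ A T e : ℝ} (hσ : 0 < σ)
    (hM : 1 ≤ M) (hnσ : √n ≤ M * σ) (hB : 0 ≤ B) (hC : 0 ≤ C) (hD : 0 ≤ D)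
    (hr : 0 < r) (hr2 : r ≤ 2) (hY : (n : ℝ) ^ κ / σ ^ 2 ≤ A * T)
    (hT : 1 / (n : ℝ) ^ (r / 2) ≤ T)
    (he : σ * e ≤ B * ((n : ℝ) ^ (max 1 (r / 2 + κ)) * (C / (σ ^ r * σ))
        + (n : ℝ) ^ (1 / 2 + κ) * (C / σ ^ 2) + (n : ℝ) ^ κ * (C / σ))
      + D * (n : ℝ) ^ κ * (C / σ) + σ ^ 2 * (4 * (C / (σ ^ r * σ)))) :
    e ≤ ((3 * B * M ^ 2 * C + D * C) * A + (B * C * M ^ 2 + 4 * C) * M ^ 2) * T := by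
  have hn' : (0 : ℝ) < n := by exact_mod_cast hn
  set R := 1 / σ ^ r with hR
  set Y := (n : ℝ) ^ κ / σ ^ 2 with hYd
  have hσr : 0 < σ ^ r := Real.rpow_pos_of_pos hσ r
  have hR0 : 0 ≤ R := by positivity
  have hY0 : 0 ≤ Y := by positivity
  have hM2 : 1 ≤ M ^ 2 := one_le_pow₀ hM
  have hsq : √(n : ℝ) = (n : ℝ) ^ (1 / 2 : ℝ) := Real.sqrt_eq_rpow _
  have h1 : (n : ℝ) / σ ^ 2 ≤ M ^ 2 := by
    rw [div_le_iff₀ (by positivity), ← mul_pow, ← Real.sq_sqrt hn'.le]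
    gcongr
  have h2 : (n : ℝ) ^ (1 / 2 : ℝ) / σ ≤ M ^ 2 := by
    rw [← hsq, div_le_iff₀ hσ]
    exact hnσ.trans (by gcongr; nlinarith)
  have h3 : (n : ℝ) ^ (r / 2) * R ≤ M ^ 2 := by
    rw [hR, mul_one_div, div_le_iff₀ hσr]
    calc (n : ℝ) ^ (r / 2) = √(n : ℝ) ^ r := by
          rw [hsq, ← Real.rpow_mul hn'.le]; congr 1; ring
      _ ≤ (M * σ) ^ r := Real.rpow_le_rpow (Real.sqrt_nonneg _) hnσ hr.le
      _ = M ^ r * σ ^ r := Real.mul_rpow (by linarith) hσ.le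
      _ ≤ M ^ (2 : ℝ) * σ ^ r := by gcongr
      _ = M ^ 2 * σ ^ r := by norm_cast
  have h4 : R ≤ M ^ 2 * T := by
    have : R ≤ M ^ 2 * (1 / (n : ℝ) ^ (r / 2)) := by
      rw [mul_one_div, le_div_iff₀ (by positivity), mul_comm]; exact h3
    exact this.trans (by gcongr)
  -- The maximum is replaced by a sum. Against σ^(-r-2) the first term leaves σ^(-r), because n/σ²
  -- is bounded, and the second leaves Y, because n^(r/2) σ^(-r) is bounded.
  have h5 : (n : ℝ) ^ (max 1 (r / 2 + κ)) ≤ n + (n : ℝ) ^ (r / 2) * (n : ℝ) ^ κ := by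
    rcases max_choice 1 (r / 2 + κ) with h | h <;> rw [h]
    · rw [Real.rpow_one]; exact le_add_of_nonneg_right (by positivity)
    · rw [Real.rpow_add hn']; exact le_add_of_nonneg_left hn'.le
  have h6 : σ * e ≤ σ * (B * (C * R * ((n : ℝ) / σ ^ 2) + C * Y * ((n : ℝ) ^ (r / 2) * R)
      + C * Y * ((n : ℝ) ^ (1 / 2 : ℝ) / σ) + C * Y) + D * (C * Y) + 4 * (C * R)) := by
    calc σ * e ≤ B * ((n + (n : ℝ) ^ (r / 2) * (n : ℝ) ^ κ) * (C / (σ ^ r * σ))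
          + (n : ℝ) ^ (1 / 2 + κ) * (C / σ ^ 2) + (n : ℝ) ^ κ * (C / σ))
        + D * (n : ℝ) ^ κ * (C / σ) + σ ^ 2 * (4 * (C / (σ ^ r * σ))) := by
          refine he.trans ?_
          gcongr
      _ = _ := by
          rw [Real.rpow_add hn', hR, hYd]
          field_simp
  have h7 := le_of_mul_le_mul_left h6 hσ
  have hCR : 0 ≤ C * R := by positivity
  have hCY : 0 ≤ C * Y := by positivity
  calc e ≤ _ := h7
    _ ≤ B * (C * R * M ^ 2 + C * Y * M ^ 2 + C * Y * M ^ 2 + C * Y) + D * (C * Y)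
        + 4 * (C * R) := by gcongr
    _ ≤ B * (C * R * M ^ 2 + C * Y * M ^ 2 + C * Y * M ^ 2 + C * Y * M ^ 2) + D * (C * Y)
        + 4 * (C * R) := by
          have := mul_le_mul_of_nonneg_left (le_mul_of_one_le_right hCY hM2) hB
          linarith
    _ = (3 * B * M ^ 2 * C + D * C) * Y + (B * C * M ^ 2 + 4 * C) * R := by ring
    _ ≤ (3 * B * M ^ 2 * C + D * C) * (A * T) + (B * C * M ^ 2 + 4 * C) * (M ^ 2 * T) := by
          gcongr
    _ = _ := by ring

section
variable {p q : ℝ} (hp : 0 < p) (hp2 : p ≤ 3 / 4) (hq0 : 0 ≤ q) (hq1 : q ≤ 1) {s : ℝ}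
  (hs : 0 < s) (hs1 : s ≤ 1)
include hp hp2 hq0 hq1 hs hs1

omit hq0 hq1 hs hs1 in
lemma abs_memory_lt_one : |2 * p - 1| < 1 := by
  rw [abs_lt]; constructor <;> linarith

omit hp2 hq0 hq1 hs hs1 in
lemma sqrt_le_sqrt_varScale {n : ℕ} (hn : 1 ≤ n) :
    √(n : ℝ) ≤ √(1 + 2 * |2 * p - 1|) * √(varScale p n) := by
  rw [← Real.sqrt_mul (by positivity)]
  exact Real.sqrt_le_sqrt (le_varScale hp hn)

/-- Rate of convergence for Hölder test functions. -/
theorem exists_walkExp_sub_gaussian_le_low : ∃ C, 0 ≤ C ∧ ∀ n : ℕ, 1 ≤ n → ∀ h : ℝ → ℝ,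
    RealHolder s 1 h →
    |walkExp (2 * p - 1) q n
        (fun k => h ((k - walkMean (2 * p - 1) q n) / √(varScale p n)))
      - ∫ x, h x ∂(gaussianReal 0 1)| ≤ C * (1 / (n : ℝ) ^ (s / 2) + 1 / vSeq p n) := by
  set c := 2 * p - 1 with hcd
  have hc := abs_memory_lt_one hp hp2
  have hc2 : c ≤ 1 / 2 := by linarith
  obtain ⟨B, hB, hdef⟩ := exists_abs_steinDefect_le_low hc hq0 hq1 hc2 hs hs1
  obtain ⟨D, hD, hvar⟩ := exists_varScale_sub_walkSq_le hp hp2 q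
  set C := max ((expConst + 5 * gaussConst) * 1) ((4 + 12 * gaussConst) * 1) with hCd
  have hC : 0 ≤ C := le_max_of_le_right (by have := gaussConst_nonneg; positivity)
  set M := √(1 + 2 * |c|) with hMd
  have hM : 1 ≤ M := Real.one_le_sqrt.mpr (by linarith [abs_nonneg c])
  refine ⟨(3 * B * M ^ 2 * C + D * C) * (1 + 2 * |c|) + (B * C * M ^ 2 + 4 * C) * M ^ 2,
    by positivity, fun n hn h hh => ?_⟩
  have hV := varScale_pos hp hn
  set σ := √(varScale p n) with hσd
  have hσ : 0 < σ := Real.sqrt_pos.mpr hV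
  have hσ2 : σ ^ 2 = varScale p n := Real.sq_sqrt hV.le
  have hv := vSeq_pos hp hn
  have hw : walkSq c q n ≤ σ ^ 2 := hσ2 ▸ walkSq_le_varScale hp q hn
  set m := walkMean c q n with hm
  obtain ⟨M₀, hM₀⟩ := hh.exists_growth hs hs1
  have hi := integrable_of_le_sq (hh.continuous hs) hM₀
  set I₀ := ∫ x, h x ∂(gaussianReal 0 1) with hI₀
  set H : ℝ → ℝ := fun x => h x - I₀ with hHd
  have hH : RealHolder s 1 H := fun x y => by simpa [hHd] using hh x y
  have hHc : Continuous H := hH.continuous hs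
  have hH0 : ∫ x, H x ∂(gaussianReal 0 1) = 0 := integral_sub_integral_eq_zero hi
  obtain ⟨r1, r2⟩ := steinSol_deriv_regular hH hHc hs hs1 hH0
  have r1' : ∀ x, |x * steinSol H x + H x| ≤ C := fun x => (r1 x).trans (le_max_left _ _)
  have r2' : RealHolder s C fun x => x * steinSol H x + H x := fun x y =>
    (r2 x y).trans (by gcongr; exact le_max_right _ _)
  have hg := hasDerivAt_steinSol hHc (hH.abs_le_sq hHc hs hs1 hH0)
  have hu := hasDerivAt_comp_affine hg m σ
  have hK := (r2'.comp_affine m hσ).div_const hσ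
  rw [div_div] at hK
  have hK0 : 0 ≤ C / (σ ^ s * σ) := by positivity
  have hbd : ∀ x, |((x - m) / σ * steinSol H ((x - m) / σ) + H ((x - m) / σ)) / σ| ≤ C / σ := by
    intro x
    rw [abs_div, abs_of_pos hσ]
    gcongr
    exact r1' _
  have hS := hdef n hn (fun k => steinSol H ((k - m) / σ)) (C / (σ ^ s * σ)) (C / σ) hK0
    (by
      rw [dif_intCast fun x => steinSol H ((x - m) / σ)]
      exact (hK.realDif hu).holderOnBall _)
    (by
      rw [dif_intCast fun x => steinSol H ((x - m) / σ)]
      exact fun k _ => abs_realDif_le hu hbd k)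
  have hmain := abs_walkExp_le_of_stein hc.le hq0 hq1 hn hσ hw hS r1'
    (abs_deriv_sub_dif_avg_le_low hs.le hs1 hK0 hu hK)
  have heq : walkExp c q n (fun k => h ((k - m) / σ)) - I₀
      = walkExp c q n (fun k => H ((k - m) / σ)) := by
    rw [walkExp_sub c q hn (fun k => h ((k - m) / σ)) fun _ => I₀, walkExp_const c q hn]
  rw [heq]
  refine rate_of_stein_terms hn hσ hM (sqrt_le_sqrt_varScale hp hn) hB hC hD hs (by linarith)
    (κ := 2 * max c 0) (hσ2 ▸ rpow_div_varScale_le hp hp2 (by linarith) hn)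
    (le_add_of_nonneg_right (by positivity)) (hmain.trans ?_)
  have hd : (σ ^ 2 - walkSq c q n) * (C / σ) ≤ D * (n : ℝ) ^ (2 * max c 0) * (C / σ) := by
    gcongr
    rw [hσ2]; exact hvar n hn
  -- The numerical estimate allows for a second-difference term, which does not occur for Hölder
  -- data and is added as a nonnegative quantity.
  have hJ : 0 ≤ B * ((n : ℝ) ^ (1 / 2 + 2 * max c 0) * (C / σ ^ 2)) := by positivity
  linarith

/-- Rate of convergence for differentiable test functions with Hölder derivative. -/
theorem exists_walkExp_sub_gaussian_le_high : ∃ C, 0 ≤ C ∧ ∀ n : ℕ, 1 ≤ n → ∀ h h' : ℝ → ℝ,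
    (∀ x, HasDerivAt h (h' x) x) → RealHolder s 1 h' →
    |walkExp (2 * p - 1) q n
        (fun k => h ((k - walkMean (2 * p - 1) q n) / √(varScale p n)))
      - ∫ x, h x ∂(gaussianReal 0 1)| ≤ C * (1 / (n : ℝ) ^ ((1 + s) / 2) + 1 / vSeq p n) := by
  set c := 2 * p - 1 with hcd
  have hc := abs_memory_lt_one hp hp2
  have hc2 : c ≤ 1 / 2 := by linarith
  obtain ⟨B, hB, hdef⟩ := exists_abs_steinDefect_le_high hc hq0 hq1 hc2 hs hs1
  obtain ⟨D, hD, hvar⟩ := exists_varScale_sub_walkSq_le hp hp2 q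
  obtain ⟨C, hC, hreg⟩ := exists_steinSol_second_regular hs hs1
  set M := √(1 + 2 * |c|) with hMd
  have hM : 1 ≤ M := Real.one_le_sqrt.mpr (by linarith [abs_nonneg c])
  refine ⟨(3 * B * M ^ 2 * C + D * C) * (1 + 2 * |c|) + (B * C * M ^ 2 + 4 * C) * M ^ 2,
    by positivity, fun n hn h h' hd hh => ?_⟩
  have hV := varScale_pos hp hn
  set σ := √(varScale p n) with hσd
  have hσ : 0 < σ := Real.sqrt_pos.mpr hV
  have hσ2 : σ ^ 2 = varScale p n := Real.sq_sqrt hV.le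
  have hv := vSeq_pos hp hn
  have hw : walkSq c q n ≤ σ ^ 2 := hσ2 ▸ walkSq_le_varScale hp q hn
  set m := walkMean c q n with hm
  obtain ⟨M₀, hM₀⟩ := exists_growth_of_hasDerivAt hd hh hs hs1
  have hhc : Continuous h := continuous_iff_continuousAt.mpr fun x => (hd x).continuousAt
  have hi := integrable_of_le_sq hhc hM₀
  set I₀ := ∫ x, h x ∂(gaussianReal 0 1) with hI₀
  set H : ℝ → ℝ := fun x => h x - I₀ with hHd
  have hHD : ∀ x, HasDerivAt H (h' x) x := fun x => (hd x).sub_const I₀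
  have hHc : Continuous H := hhc.sub continuous_const
  have hH0 : ∫ x, H x ∂(gaussianReal 0 1) = 0 := integral_sub_integral_eq_zero hi
  obtain ⟨M₁, hM₁⟩ := exists_growth_of_hasDerivAt hHD hh hs hs1
  obtain ⟨r1, g₁, hg₁, r2, r3⟩ := hreg H h' (hh.continuous hs) hHD hh hH0
  have hg := hasDerivAt_steinSol hHc hM₁
  have hu := hasDerivAt_comp_affine hg m σ
  have hu' := fun x => (hasDerivAt_comp_affine hg₁ m σ x).div_const σ
  have hK := ((r3.comp_affine m hσ).div_const hσ).div_const hσ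
  -- With r = 1 + s this is the Hölder scale σ^(-r-1): two derivatives of the rescaling and one
  -- factor σ^(-s).
  have hσr : C / σ ^ s / σ / σ = C / (σ ^ (1 + s) * σ) := by
    rw [Real.rpow_add hσ, Real.rpow_one, div_div, div_div]; ring
  rw [hσr] at hK
  have hK0 : 0 ≤ C / (σ ^ (1 + s) * σ) := by positivity
  have hbd : ∀ x, |((x - m) / σ * steinSol H ((x - m) / σ) + H ((x - m) / σ)) / σ| ≤ C / σ := by
    intro x
    rw [abs_div, abs_of_pos hσ]
    gcongr
    exact r1 _
  have hbd' : ∀ x, |g₁ ((x - m) / σ) / σ / σ| ≤ C / σ ^ 2 := by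
    intro x
    rw [div_div, ← sq, abs_div, abs_of_pos (pow_pos hσ 2)]
    gcongr
    exact r2 _
  have hdd := HasDerivAt.realDif hu
  have hdif2 : dif (dif fun k : ℤ => steinSol H ((k - m) / σ))
      = fun k : ℤ => realDif (realDif fun x => steinSol H ((x - m) / σ)) k := by
    rw [dif_intCast fun x => steinSol H ((x - m) / σ), dif_intCast]
  have hS := hdef n hn (fun k => steinSol H ((k - m) / σ)) (C / (σ ^ (1 + s) * σ)) (C / σ ^ 2)
    (C / σ) hK0
    (by rw [hdif2]; exact ((hK.realDif hu').realDif hdd).holderOnBall _)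
    (by rw [hdif2]; exact fun k _ => abs_realDif_le hdd (abs_realDif_le hu' hbd') k)
    (by
      rw [dif_intCast fun x => steinSol H ((x - m) / σ)]
      exact fun k _ => abs_realDif_le hu hbd k)
  have hmain := abs_walkExp_le_of_stein hc.le hq0 hq1 hn hσ hw hS r1
    (abs_deriv_sub_dif_avg_le_high hs.le hs1 hK0 hu hu' hK)
  have heq : walkExp c q n (fun k => h ((k - m) / σ)) - I₀
      = walkExp c q n (fun k => H ((k - m) / σ)) := by
    rw [walkExp_sub c q hn (fun k => h ((k - m) / σ)) fun _ => I₀, walkExp_const c q hn]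
  rw [heq]
  refine rate_of_stein_terms hn hσ hM (sqrt_le_sqrt_varScale hp hn) hB hC hD (by linarith)
    (by linarith) (κ := 2 * max c 0) (hσ2 ▸ rpow_div_varScale_le hp hp2 (by linarith) hn)
    (le_add_of_nonneg_right (by positivity)) (hmain.trans ?_)
  have hd : (σ ^ 2 - walkSq c q n) * (C / σ) ≤ D * (n : ℝ) ^ (2 * max c 0) * (C / σ) := by
    gcongr
    rw [hσ2]; exact hvar n hn
  linarith
end

/-! ### Zolotarev's classes -/

lemma zolotarevIndex_of_le_one {r : ℝ} (hr : r ≤ 1) : zolotarevIndex r = 0 := by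
  have : ⌈r⌉₊ ≤ 1 := Nat.ceil_le.mpr (by simpa using hr)
  unfold zolotarevIndex
  omega

lemma zolotarevIndex_of_one_lt {r : ℝ} (hr1 : 1 < r) (hr : r ≤ 2) : zolotarevIndex r = 1 := by
  have h1 : ⌈r⌉₊ ≤ 2 := Nat.ceil_le.mpr (by simpa using hr)
  have h2 : 1 < ⌈r⌉₊ := Nat.lt_ceil.mpr (by simpa using hr1)
  unfold zolotarevIndex
  omega

lemma mem_zolotarevClass_iff_of_le_one {r : ℝ} (hr0 : 0 < r) (hr : r ≤ 1) {f : ℝ → ℝ} :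
    f ∈ zolotarevClass r ↔ RealHolder r 1 f := by
  simp only [zolotarevClass, zolotarevIndex_of_le_one hr, iteratedDeriv_zero, Nat.cast_zero,
    sub_zero, Set.mem_ofPred_eq, RealHolder, one_mul]
  refine ⟨fun h => h.2, fun h => ⟨contDiff_zero.mpr ?_, h⟩⟩
  exact RealHolder.continuous (s := r) (L := 1) (fun x y => by simpa using h x y) hr0

lemma realHolder_deriv_of_mem_zolotarevClass {r : ℝ} (hr1 : 1 < r) (hr : r ≤ 2) {f : ℝ → ℝ}
    (hf : f ∈ zolotarevClass r) :
    (∀ x, HasDerivAt f (deriv f x) x) ∧ RealHolder (r - 1) 1 (deriv f) := by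
  simp only [zolotarevClass, zolotarevIndex_of_one_lt hr1 hr, iteratedDeriv_one, Nat.cast_one,
    Set.mem_ofPred_eq] at hf
  exact ⟨fun x => (hf.1.differentiable one_ne_zero x).hasDerivAt, fun x y => by simpa using hf.2 x y⟩

lemma continuous_of_mem_zolotarevClass {r : ℝ} {f : ℝ → ℝ} (hf : f ∈ zolotarevClass r) :
    Continuous f := hf.1.continuous

lemma integrable_gaussianReal_of_mem_zolotarevClass {r : ℝ} (hr0 : 0 < r) (hr : r ≤ 2) {f : ℝ → ℝ}
    (hf : f ∈ zolotarevClass r) : Integrable f (gaussianReal 0 1) := by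
  have hc := continuous_of_mem_zolotarevClass hf
  rcases le_or_gt r 1 with h1 | h1
  · obtain ⟨M, hM⟩ := ((mem_zolotarevClass_iff_of_le_one hr0 h1).mp hf).exists_growth hr0 h1
    exact integrable_of_le_sq hc hM
  · obtain ⟨h2, h3⟩ := realHolder_deriv_of_mem_zolotarevClass h1 hr hf
    obtain ⟨M, hM⟩ := exists_growth_of_hasDerivAt h2 h3 (by linarith) (by linarith)
    exact integrable_of_le_sq hc hM

lemma exists_walkExp_sub_gaussian_le {p q r : ℝ} (hp : 0 < p) (hp2 : p ≤ 3 / 4) (hq0 : 0 ≤ q)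
    (hq1 : q ≤ 1) (hr0 : 0 < r) (hr : r ≤ 2) :
    ∃ C, 0 ≤ C ∧ ∀ n : ℕ, 1 ≤ n → ∀ f ∈ zolotarevClass r,
      |walkExp (2 * p - 1) q n
          (fun k => f ((k - walkMean (2 * p - 1) q n) / √(varScale p n)))
        - ∫ x, f x ∂(gaussianReal 0 1)| ≤ C * (1 / (n : ℝ) ^ (r / 2) + 1 / vSeq p n) := by
  rcases le_or_gt r 1 with h1 | h1
  · obtain ⟨C, hC, h⟩ := exists_walkExp_sub_gaussian_le_low hp hp2 hq0 hq1 hr0 h1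
    exact ⟨C, hC, fun n hn f hf => h n hn f ((mem_zolotarevClass_iff_of_le_one hr0 h1).mp hf)⟩
  · obtain ⟨C, hC, h⟩ := exists_walkExp_sub_gaussian_le_high hp hp2 hq0 hq1
      (s := r - 1) (by linarith) (by linarith)
    refine ⟨C, hC, fun n hn f hf => ?_⟩
    obtain ⟨h2, h3⟩ := realHolder_deriv_of_mem_zolotarevClass h1 hr hf
    simpa using h n hn f (deriv f) h2 h3

/-! ### The law of the normalized position -/

section
variable {Ω : Type*} [MeasurableSpace Ω] {P : Measure Ω} {p q : ℝ} {X α : ℕ → Ω → ℝ}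
  {β : ℕ → Ω → ℕ}

omit [MeasurableSpace Ω] in
-- Since 2q - 1 = a_n E T_n, the numerator is a_n (T_n - E T_n), and a_n cancels.
lemma normalizedPosition_eq (hp : 0 < p) (q : ℝ) (X : ℕ → Ω → ℝ) {n : ℕ} (hn : 1 ≤ n) (ω : Ω) :
    normalizedPosition p q X n ω
      = (position X n ω - walkMean (2 * p - 1) q n) / √(varScale p n) := by
  have ha := aSeq_pos hp hn
  have hv := Real.sqrt_pos.mpr (vSeq_pos hp hn)
  rw [normalizedPosition, varScale, Real.sqrt_div (vSeq_pos hp hn).le, Real.sqrt_sq ha.le,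
    ← walkMean_eq hp q hn]
  field_simp

lemma IsElephantWalk.measurable_normalizedPosition (h : IsElephantWalk P p q X α β) (n : ℕ) :
    Measurable (normalizedPosition p q X n) :=
  (((h.measurable_position n).const_mul _).sub_const _).div_const _

lemma IsElephantWalk.integrable_normalizedPosition [IsProbabilityMeasure P]
    (h : IsElephantWalk P p q X α β) (n : ℕ) {f : ℝ → ℝ} (hf : Continuous f) :
    Integrable f (P.map (normalizedPosition p q X n)) := by
  rw [integrable_map_measure hf.aestronglyMeasurable
    (h.measurable_normalizedPosition n).aemeasurable]
  exact integrable_comp_of_ae_bounded (h.measurable_position n) (h.ae_abs_position_le n)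
    (g := fun x => f ((aSeq p n * x - (2 * q - 1)) / √(vSeq p n))) (by fun_prop)

lemma IsElephantWalk.integral_normalizedPosition [IsProbabilityMeasure P]
    (h : IsElephantWalk P p q X α β) (hp : 0 < p) {n : ℕ} (hn : 1 ≤ n) {f : ℝ → ℝ}
    (hf : Continuous f) :
    ∫ x, f x ∂(P.map (normalizedPosition p q X n)) = walkExp (2 * p - 1) q n
      (fun k => f ((k - walkMean (2 * p - 1) q n) / √(varScale p n))) := by
  rw [integral_map (h.measurable_normalizedPosition n).aemeasurable hf.aestronglyMeasurable]
  simp only [normalizedPosition_eq hp q X hn]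
  exact h.integral_position hn
    (g := fun x => f ((x - walkMean (2 * p - 1) q n) / √(varScale p n))) (by fun_prop)
end

/-! ### Zolotarev and Wasserstein rates -/

theorem theorem5 (p q r : ℝ) (hp : p ∈ Set.Ioc (0 : ℝ) (3 / 4)) (hq : q ∈ Set.Ioc (0 : ℝ) 1)
    (hr : r ∈ Set.Ioc (0 : ℝ) 2) :
    ∃ C : ℝ, 0 < C ∧
      ∀ (Ω : Type*) [MeasurableSpace Ω] (P : Measure Ω) [IsProbabilityMeasure P]
        (X α : ℕ → Ω → ℝ) (β : ℕ → Ω → ℕ), IsElephantWalk P p q X α β →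
        ∀ n : ℕ, 1 ≤ n →
          (∀ f ∈ zolotarevClass r,
            Integrable f (P.map (normalizedPosition p q X n)) ∧
            Integrable f (gaussianReal 0 1)) ∧
          zolotarevDist r (P.map (normalizedPosition p q X n)) (gaussianReal 0 1)
            ≤ ((C * (1 / (n : ℝ) ^ (r / 2) + 1 / vSeq p n) : ℝ) : EReal) ∧
          (r = 1 →
            wassersteinOne (P.map (normalizedPosition p q X n)) (gaussianReal 0 1)
              ≤ ENNReal.ofReal (C * (1 / (n : ℝ) ^ (r / 2) + 1 / vSeq p n))) := by

  obtain ⟨hp0, hp2⟩ := hp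
  obtain ⟨hq0, hq1⟩ := hq
  obtain ⟨hr0, hr2⟩ := hr
  obtain ⟨C, hC, hrate⟩ := exists_walkExp_sub_gaussian_le hp0 hp2 hq0.le hq1 hr0 hr2
  -- The rate constant C is only known to be nonnegative; adding 1 makes it positive.
  refine ⟨C + 1, by linarith, fun Ω _ P _ X α β h n hn => ?_⟩
  have hv := vSeq_pos hp0 hn
  have hbound : ∀ f ∈ zolotarevClass r,
      ∫ x, f x ∂(P.map (normalizedPosition p q X n)) - ∫ x, f x ∂(gaussianReal 0 1)
        ≤ (C + 1) * (1 / (n : ℝ) ^ (r / 2) + 1 / vSeq p n) := by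
    intro f hf
    rw [h.integral_normalizedPosition hp0 hn (continuous_of_mem_zolotarevClass hf)]
    refine (le_abs_self _).trans ((hrate n hn f hf).trans ?_)
    gcongr
    linarith
  refine ⟨fun f hf => ⟨h.integrable_normalizedPosition n (continuous_of_mem_zolotarevClass hf),
    integrable_gaussianReal_of_mem_zolotarevClass hr0 hr2 hf⟩,
    iSup₂_le fun f hf => EReal.coe_le_coe_iff.mpr (hbound f hf), ?_⟩
  rintro rfl
  have := Measure.isProbabilityMeasure_map (μ := P)
    (h.measurable_normalizedPosition n).aemeasurable
  refine wassersteinOne_le_of_lipschitz _ _ fun f hf => hbound f ?_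
  exact (mem_zolotarevClass_iff_of_le_one one_pos le_rfl).mpr fun x y => by simpa using hf x y
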